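/- \textbf{Theorem.} Let $G$ be a subdivided star with $h$ branches: a center $v_0$ and, for $b=1,\dots,h$, a path $v_{b,1},\dots,v_{b,n_b}$ with $n_b\ge 1$ whose first vertex $v_{b,1}$ is joined to $v_{b,0}=v_0$; let $B_b=\{v_{b,1},\dots,v_{b,n_b}\}$ (so $v_0$ is in no $B_b$). A configuration is a bijection $C:V\to V$, where $C(v)$ is the token on the vertex $v$. A matching $M$ of $G$ routes $C$ to the configuration $MC$ obtained by swapping the two tokens at the ends of each edge of $M$. A solution for $C$ is a sequence of matchings $(M_1,\dots,M_k)$ with $M_k\cdots M_1C=\mathrm{Id}$; $k$ is its length, and $OPT$ is the minimum length of a solution for $C$. For a current configuration $C$ let $I(C)$ be the set of all edges $(v_{b,i},v_{b,i+1})$, $1\le i<n_b$, with $C(v_{b,i})\in B_b$ and $C(v_{b,i+1})\notin B_b$. The algorithm performs the following three phases; each iteration outputs a matching and applies it to the current configuration. \begin{itemize} \item Phase 1 (sort each branch): while $I(C)\neq\emptyset$, use $I(C)$. \item Phase 2 (route the tokens through the center to their correct branches): while $C(v_{b,1})\notin B_b$ for some $b$, use the following set. If $C(v_0)=v_0$,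 use $I(C)\cup\{(v_0,v_{b,1})\}$ for an arbitrary such $b$. Otherwise let $C(v_0)\in B_b$ and let $v_{c,i}$ be the vertex with $C(v_{c,i})=v_0$; use $I(C)\cup\{(v_0,v_{b,1})\}$ together with $(v_{c,i-1},v_{c,i})$ if $C(v_{c,i-1})\in B_c$, and with $(v_{c,i},v_{c,i+1})$ if $C(v_{c,i-1})\notin B_c$, $i<n_c$ and $C(v_{c,i+1})\notin B_c$. \item Phase 3 (odd-even sorting on all branches in parallel): while $C\ne\mathrm{Id}$, in the $k$-th iteration of this phase ($k=1,2,\dots$) use all edges $(v_{b,i},v_{b,i+1})$ with $1\le i<n_b$ and $i\equiv k\pmod 2$ for which $C(v_{b,i})=v_{b,x}$ and $C(v_{b,i+1})=v_{b,y}$ with $x>y$. \end{itemize} Then, for every subdivided star and every initial configuration, and whatever choices are made in Phase 2, the algorithm terminates and outputs a solution of length at most $$4\,OPT+\min\{OPT,h\}+1 .$$ Moreover the algorithm can be carried out in polynomial time: there are a fixed program for a unit-cost random access machine (registers and arrays of natural numbers; addition, truncated subtraction, comparisons) and a polynomial $P$ such that, given $h$, $n_1,\dots,n_h$ and the initial configuration,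 the program halts after at most $P(|V|)$ steps with an output of the algorithm written in memory. -/

import Mathlib

namespace TokenSwapping

/-! ### Parallel token swapping on a graph

The tokens are a copy of the vertex set; a configuration `C : V → V` (a bijection) puts the token
`C v` on the vertex `v`, and the target configuration is the identity. -/

section Problem

variable {V : Type}

/-- `M` is a matching of `G`: a set of pairwise disjoint edges. -/
def IsMatching (G : SimpleGraph V) (M : Set (Sym2 V)) : Prop :=
  M ⊆ G.edgeSet ∧ ∀ e ∈ M, ∀ f ∈ M, ∀ v, v ∈ e → v ∈ f → e = f

open Classical in
/-- The configuration `M C`: tokens at the two ends of each edge of the matching `M` are swapped. -/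
noncomputable def route (M : Set (Sym2 V)) (C : V → V) : V → V :=
  fun v => if hv : ∃ w, s(v, w) ∈ M then C hv.choose else C v

/-- The configuration `M_k ⋯ M_1 C`. -/
noncomputable def routeAll (Ms : List (Set (Sym2 V))) (C : V → V) : V → V :=
  Ms.foldl (fun D M => route M D) C

/-- `Ms` is a solution of the instance `(G, C)`: a sequence of matchings routing `C` to `id`. -/
def IsSolution (G : SimpleGraph V) (C : V → V) (Ms : List (Set (Sym2 V))) : Prop :=
  (∀ M ∈ Ms, IsMatching G M) ∧ routeAll Ms C = id

/-- The minimum number of matchings in a solution. -/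
noncomputable def OPT (G : SimpleGraph V) (C : V → V) : ℕ :=
  sInf {k | ∃ Ms, IsSolution G C Ms ∧ Ms.length = k}

end Problem

/-! ### Subdivided stars -/

section Star

variable {h : ℕ} (n : Fin h → ℕ)

/-- Vertices of the subdivided star with branches `b : Fin h` having `n b` vertices each:
`none` is the center `v₀`, and `some ⟨b, i⟩` is the vertex `v_{b,i+1}`. -/
abbrev StarVertex : Type := Option (Σ b : Fin h, Fin (n b))

variable {n}

/-- The center `v₀`. -/
def center : StarVertex n := none

/-- The vertex `v_{b,i+1}` (the index `i` starts at `0` next to the center). -/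
def br (b : Fin h) (i : Fin (n b)) : StarVertex n := some ⟨b, i⟩

/-- The neighbour of `v_{b,i+1}` on the side of the center, that is `v_{b,i}` with
`v_{b,0} = v₀`. -/
def inward (b : Fin h) (i : Fin (n b)) : StarVertex n :=
  if i.val = 0 then center else br b ⟨i.val - 1, lt_of_le_of_lt (Nat.sub_le _ _) i.isLt⟩

/-- The edge `(v_{b,i}, v_{b,i+1})`. -/
def edge (b : Fin h) (i : Fin (n b)) : Sym2 (StarVertex n) := s(inward b i, br b i)

variable (n) in
/-- The subdivided star with branch sizes `n`. -/
def starGraph : SimpleGraph (StarVertex n) :=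
  SimpleGraph.fromEdgeSet {e | ∃ b i, e = edge b i}

/-- The token (or vertex) `t` belongs to the branch `b`; the center belongs to no branch. -/
def InB (b : Fin h) (t : StarVertex n) : Prop := ∃ i, t = br b i

/-! ### The three-phase algorithm -/

/-- All edges inside a branch `b` whose inner end has a token of `B_b` and whose outer end has a
token not in `B_b`. -/
def innerSwaps (C : StarVertex n → StarVertex n) : Set (Sym2 (StarVertex n)) :=
  {e | ∃ b i, i.val ≠ 0 ∧ e = edge b i ∧ InB b (C (inward b i)) ∧ ¬ InB b (C (br b i))}

/-- The token on the vertex of branch `b` next to the center does not belong to branch `b`. -/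
def Unfinished (C : StarVertex n → StarVertex n) (b : Fin h) : Prop :=
  ∃ i : Fin (n b), i.val = 0 ∧ ¬ InB b (C (br b i))

/-- The swaps that keep the token `v₀`, lying on `v_{c,i+1}`, out of the way: it moves outward when
the next token outward is not in `B_c` and the next token inward is not in `B_c`; it is swapped
with the next token inward when that one is in `B_c`. -/
def keepOut (C : StarVertex n → StarVertex n) : Set (Sym2 (StarVertex n)) :=
  {e | ∃ c i, C (br c i) = center ∧
    ((∃ j, j.val = i.val + 1 ∧ e = edge c j ∧ ¬ InB c (C (br c j)) ∧ ¬ InB c (C (inward c i))) ∨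
      (e = edge c i ∧ InB c (C (inward c i))))}

/-- `M` is a set of swaps that an iteration of the second phase may perform on `C`. If the token
`v₀` is on the center, it is moved to any one unfinished branch; otherwise the token on the center
moves to its branch and `v₀` is kept out of the way. -/
def Phase2Swaps (C : StarVertex n → StarVertex n) (M : Set (Sym2 (StarVertex n))) : Prop :=
  ∃ b, ∃ i : Fin (n b), i.val = 0 ∧
    ((C center = center ∧ Unfinished C b ∧ M = innerSwaps C ∪ {edge b i}) ∨
      (InB b (C center) ∧ M = innerSwaps C ∪ {edge b i} ∪ keepOut C))

/-- Iteration `k` (counted from `1`) of odd-even sorting, on all branches in parallel: all edges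
`(v_{b,i}, v_{b,i+1})` with `1 ≤ i`, `i ≡ k` modulo `2`, whose tokens are in `B_b` and in
decreasing order. -/
def oddEvenSwaps (k : ℕ) (C : StarVertex n → StarVertex n) : Set (Sym2 (StarVertex n)) :=
  {e | ∃ b i, i.val ≠ 0 ∧ i.val % 2 = k % 2 ∧ e = edge b i ∧
    ∃ x y : Fin (n b), y < x ∧ C (inward b i) = br b x ∧ C (br b i) = br b y}

variable (n) in
/-- A state of the algorithm: the current phase with the current configuration, and in the third
phase the number of the next odd-even iteration. -/
inductive AlgState : Type
  | phase1 (C : StarVertex n → StarVertex n) : AlgState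
  | phase2 (C : StarVertex n → StarVertex n) : AlgState
  | phase3 (k : ℕ) (C : StarVertex n → StarVertex n) : AlgState

/-- `Step s out s'`: one step of the algorithm, where `out` is the list of matchings it appends to
the output (one for an iteration of a loop, none for the passage to the next phase). -/
inductive Step : AlgState n → List (Set (Sym2 (StarVertex n))) → AlgState n → Prop
  | sortBranches (C : StarVertex n → StarVertex n) (hC : (innerSwaps C).Nonempty) :
      Step (.phase1 C) [innerSwaps C] (.phase1 (route (innerSwaps C) C))
  | toPhase2 (C : StarVertex n → StarVertex n) (hC : ¬ (innerSwaps C).Nonempty) :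
      Step (.phase1 C) [] (.phase2 C)
  | changeBranches (C : StarVertex n → StarVertex n) (M : Set (Sym2 (StarVertex n)))
      (hC : ∃ b, Unfinished C b) (hM : Phase2Swaps C M) :
      Step (.phase2 C) [M] (.phase2 (route M C))
  | toPhase3 (C : StarVertex n → StarVertex n) (hC : ¬ ∃ b, Unfinished C b) :
      Step (.phase2 C) [] (.phase3 1 C)
  | oddEven (k : ℕ) (C : StarVertex n → StarVertex n) (hC : C ≠ id) :
      Step (.phase3 k C) [oddEvenSwaps k C] (.phase3 (k + 1) (route (oddEvenSwaps k C) C))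

/-- `Run s Ms s'`: some execution leads from `s` to `s'` and outputs `Ms` on the way. -/
inductive Run : AlgState n → List (Set (Sym2 (StarVertex n))) → AlgState n → Prop
  | nil (s : AlgState n) : Run s [] s
  | cons {s s' s'' : AlgState n} {out Ms : List (Set (Sym2 (StarVertex n)))} :
      Step s out s' → Run s' Ms s'' → Run s (out ++ Ms) s''

/-- No step is possible: the execution is over. -/
def Halted (s : AlgState n) : Prop := ∀ out s', ¬ Step s out s'

/-- `Ms` is the output of a finished execution of the algorithm on the initial configuration
`C`. -/
def IsOutput (C : StarVertex n → StarVertex n) (Ms : List (Set (Sym2 (StarVertex n)))) : Prop :=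
  ∃ s, Run (.phase1 C) Ms s ∧ Halted s

end Star

/-! ### A random access machine with unit-cost steps

Structured programs over registers and arrays of natural numbers. The only arithmetic operations
are addition, truncated subtraction and comparisons, so that numbers of polynomially many bits
arise in polynomially many steps, and polynomial time is the usual notion. -/

/-- Memory: registers and arrays. -/
structure Mem : Type where
  reg : ℕ → ℕ
  arr : ℕ → ℕ → ℕ

/-- Expressions. `cell a e` reads the cell of index `e` in the array `a`. -/
inductive Expr : Type
  | lit (c : ℕ) : Expr
  | reg (r : ℕ) : Expr
  | cell (a : ℕ) (e : Expr) : Expr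
  | add (e f : Expr) : Expr
  | sub (e f : Expr) : Expr
  | lt (e f : Expr) : Expr
  | eq (e f : Expr) : Expr

/-- Value of an expression; comparisons give `1` (true) or `0` (false). -/
def Expr.eval (σ : Mem) : Expr → ℕ
  | .lit c => c
  | .reg r => σ.reg r
  | .cell a e => σ.arr a (e.eval σ)
  | .add e f => e.eval σ + f.eval σ
  | .sub e f => e.eval σ - f.eval σ
  | .lt e f => if e.eval σ < f.eval σ then 1 else 0
  | .eq e f => if e.eval σ = f.eval σ then 1 else 0

/-- Number of steps for evaluating an expression: its number of symbols. -/
def Expr.cost : Expr → ℕ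
  | .lit _ => 1
  | .reg _ => 1
  | .cell _ e => 1 + e.cost
  | .add e f => 1 + e.cost + f.cost
  | .sub e f => 1 + e.cost + f.cost
  | .lt e f => 1 + e.cost + f.cost
  | .eq e f => 1 + e.cost + f.cost

/-- Programs. `set r e` writes to a register, `store a e f` writes the value of `f` to the cell of
index `e` of the array `a`; a condition holds when its value is not `0`. -/
inductive Prog : Type
  | skip : Prog
  | set (r : ℕ) (e : Expr) : Prog
  | store (a : ℕ) (e f : Expr) : Prog
  | seq (p q : Prog) : Prog
  | ite (e : Expr) (p q : Prog) : Prog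
  | loop (e : Expr) (p : Prog) : Prog

/-- `Exec p σ t σ'`: the program `p` started in the memory `σ` halts after exactly `t` steps in the
memory `σ'`. -/
inductive Exec : Prog → Mem → ℕ → Mem → Prop
  | skip (σ : Mem) : Exec .skip σ 1 σ
  | set (σ : Mem) (r : ℕ) (e : Expr) :
      Exec (.set r e) σ (1 + e.cost) { σ with reg := Function.update σ.reg r (e.eval σ) }
  | store (σ : Mem) (a : ℕ) (e f : Expr) :
      Exec (.store a e f) σ (1 + e.cost + f.cost)
        { σ with
          arr := Function.update σ.arr a (Function.update (σ.arr a) (e.eval σ) (f.eval σ)) }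
  | seq {p q : Prog} {σ σ' σ'' : Mem} {t u : ℕ} :
      Exec p σ t σ' → Exec q σ' u σ'' → Exec (.seq p q) σ (t + u) σ''
  | iteTrue {e : Expr} {p q : Prog} {σ σ' : Mem} {t : ℕ} :
      e.eval σ ≠ 0 → Exec p σ t σ' → Exec (.ite e p q) σ (1 + e.cost + t) σ'
  | iteFalse {e : Expr} {p q : Prog} {σ σ' : Mem} {t : ℕ} :
      e.eval σ = 0 → Exec q σ t σ' → Exec (.ite e p q) σ (1 + e.cost + t) σ'
  | loopTrue {e : Expr} {p : Prog} {σ σ' σ'' : Mem} {t u : ℕ} :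
      e.eval σ ≠ 0 → Exec p σ t σ' → Exec (.loop e p) σ' u σ'' →
        Exec (.loop e p) σ (1 + e.cost + t + u) σ''
  | loopFalse {e : Expr} {p : Prog} {σ : Mem} :
      e.eval σ = 0 → Exec (.loop e p) σ (1 + e.cost) σ

/-! ### Input and output in memory -/

section Encoding

variable {h : ℕ} {n : Fin h → ℕ}

/-- The number of a vertex: `0` for the center, then the vertices of each branch in order. -/
def code : StarVertex n → ℕ
  | none => 0
  | some ⟨b, i⟩ => 1 + ∑ c ∈ Finset.Iio b, n c + i.val

variable (n) in
/-- The number of vertices of the subdivided star. -/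
def numVertices : ℕ := 1 + ∑ b, n b

/-- The memory `σ` holds the instance: `h` is in register `0`, the branch sizes are in array `0`,
and array `1` gives for each vertex number the number of the token lying there. The rest of the
memory is arbitrary. -/
def HoldsInput (C : StarVertex n → StarVertex n) (σ : Mem) : Prop :=
  σ.reg 0 = h ∧ (∀ b : Fin h, σ.arr 0 b.val = n b) ∧ ∀ v, σ.arr 1 (code v) = code (C v)

/-- The memory `σ` holds the sequence of matchings `Ms`: register `0` contains its length, register
`1` a number `m`, and the entries of index `q < m` in the arrays `2`, `3`, `4` list (with
repetitions allowed) the swaps as: index `j` of the matching in `Ms` (from `0`), number of one end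
of the edge, number of the other end. -/
def HoldsOutput (Ms : List (Set (Sym2 (StarVertex n)))) (σ : Mem) : Prop :=
  σ.reg 0 = Ms.length ∧
  (∀ q < σ.reg 1, ∃ (j : Fin Ms.length) (u w : StarVertex n), s(u, w) ∈ Ms.get j ∧
    σ.arr 2 q = j.val ∧ σ.arr 3 q = code u ∧ σ.arr 4 q = code w) ∧
  (∀ j : Fin Ms.length, ∀ e ∈ Ms.get j, ∃ q < σ.reg 1, ∃ u w : StarVertex n, e = s(u, w) ∧
    σ.arr 2 q = j.val ∧ σ.arr 3 q = code u ∧ σ.arr 4 q = code w)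

end Encoding

end TokenSwapping

open TokenSwapping

/-! Everything is measured against a number `L` with the properties in `LowerBound`. If `L`
matchings solve the instance, no token changes its depth in a branch by more than `L`, and at most
`L` tokens are misplaced: such a token has to step from the center into its branch, and a matching
takes at most one token off the center. For every such `L` the invariant `AlgInv` allots `L`
iterations to the first phase, `L + min L h` to the second and `2L + 1` to the third.

Phases one and three are analysed by the 0-1 principle. Fix a threshold `z`, call a token low if its
target depth is at most `z`, and cut a branch after its first `P` positions. `Spread` bounds the
number of high tokens inside the cut plus that of low tokens outside it, unless one of the two
vanishes. A compare-exchange across a cut improves the bounds known at the two neighbouring cuts by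
one (`Spread.route`). In phase one `z = 0`, so that low means foreign; all cuts are compared in
every iteration, and the first bound is `L` because foreign tokens lie within depth `L`. In phase
three the cuts are compared alternately and the first bound is `2L + 1`: tokens of a branch have not
overtaken one another (`Tracked`), so a high token inside the cut and a low token outside it were
initially in this weak order, and each had to travel at most `L`.

In phase two a branch starts as foreign tokens followed by own tokens. Own tokens delivered to its
front run outward and stay spaced (`ChangeInv`), so they never block the next delivery. An iteration
that finds a token other than `v₀` on the center delivers a misplaced token, which happens at most
`L` times. An iteration that finds `v₀` there is lost. There are at most `L` of these, since each is
followed by a delivery, and at most `h`: once sent into a branch, `v₀` is kept behind the foreign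
tokens (`OutwardInv`) and comes back only when that branch is finished.

As `OPT` is an infimum, a solution has to exist before it means anything. `L = numVertices n` is
always admissible, so the same invariant first proves termination, and the run of the program
supplies a finished execution. Only then is `L = OPT` used. The program performs each step by passes
over the edges, which take linear time, and there are linearly many steps. -/

namespace TokenSwapping

/-! ### Matchings as involutions -/

section Partner

variable {V : Type} {G : SimpleGraph V}

open Classical in
/-- The other end of the edge of `M` at `v`, or `v` itself if there is none. -/
noncomputable def partner (M : Set (Sym2 V)) (v : V) : V :=
  if hv : ∃ w, s(v, w) ∈ M then hv.choose else v

theorem route_eq (M : Set (Sym2 V)) (C : V → V) (v : V) : route M C v = C (partner M v) := by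
  unfold route partner
  split_ifs <;> rfl

theorem partner_eq_self {M : Set (Sym2 V)} {v : V} (hv : ∀ w, s(v, w) ∉ M) :
    partner M v = v := by
  unfold partner
  rw [dif_neg (by simpa using hv)]

theorem partner_mem {M : Set (Sym2 V)} {v w : V} (hv : s(v, w) ∈ M) : s(v, partner M v) ∈ M := by
  have h : ∃ w, s(v, w) ∈ M := ⟨w, hv⟩
  unfold partner
  rw [dif_pos h]
  exact h.choose_spec

theorem partner_eq_or_mem (M : Set (Sym2 V)) (v : V) :
    partner M v = v ∨ s(v, partner M v) ∈ M := by
  by_cases h : ∃ w, s(v, w) ∈ M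
  · exact Or.inr (partner_mem h.choose_spec)
  · exact Or.inl (partner_eq_self (by simpa using h))

theorem IsMatching.partner_eq {M : Set (Sym2 V)} (hM : IsMatching G M) {v w : V}
    (hv : s(v, w) ∈ M) : partner M v = w := by
  have := hM.2 _ (partner_mem hv) _ hv v (by simp) (by simp)
  rcases Sym2.eq_iff.1 this with ⟨-, h1⟩ | ⟨h1, h2⟩
  · exact h1
  · rw [h2, h1]

theorem IsMatching.partner_partner {M : Set (Sym2 V)} (hM : IsMatching G M) (v : V) :
    partner M (partner M v) = v := by
  rcases partner_eq_or_mem M v with h | h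
  · rw [h, h]
  · exact hM.partner_eq (by rwa [Sym2.eq_swap])

theorem IsMatching.bijective_route {M : Set (Sym2 V)} (hM : IsMatching G M) {C : V → V}
    (hC : Function.Bijective C) : Function.Bijective (route M C) := by
  have : route M C = C ∘ partner M := funext (route_eq M C)
  rw [this]
  exact hC.comp (Function.Involutive.bijective hM.partner_partner)

end Partner

/-! ### Positions on the branches -/

section Star

variable {h : ℕ} {n : Fin h → ℕ}

/-- The vertex at distance `p` from the center on branch `b`. -/
def vx (b : Fin h) (p : ℕ) : StarVertex n :=
  if hp : 0 < p ∧ p - 1 < n b then br b ⟨p - 1, hp.2⟩ else center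

/-- The distance from the center for a vertex of branch `b`, and `0` for the other vertices. -/
def depth (b : Fin h) : StarVertex n → ℕ
  | none => 0
  | some ⟨c, i⟩ => if c = b then i.val + 1 else 0

@[simp] theorem vx_zero (b : Fin h) : vx b 0 = (center : StarVertex n) := by simp [vx]

@[simp] theorem depth_center (b : Fin h) : depth b (center : StarVertex n) = 0 := rfl

theorem depth_br (b c : Fin h) (i : Fin (n c)) :
    depth b (br c i) = if c = b then i.val + 1 else 0 := rfl

@[simp] theorem depth_br_self (b : Fin h) (i : Fin (n b)) : depth b (br b i) = i.val + 1 := by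
  simp [depth_br]

theorem br_eq_vx (b : Fin h) (i : Fin (n b)) : br b i = vx b (i.val + 1) := by
  simp [vx]

theorem inward_eq_vx (b : Fin h) (i : Fin (n b)) : inward b i = vx b i.val := by
  unfold inward vx
  by_cases h0 : i.val = 0
  · simp [h0]
  · have : 0 < i.val ∧ i.val - 1 < n b := ⟨by omega, by omega⟩
    rw [if_neg h0, dif_pos this]

theorem edge_eq_vx (b : Fin h) (i : Fin (n b)) : edge b i = s(vx b i.val, vx b (i.val + 1)) := by
  rw [edge, inward_eq_vx, br_eq_vx]

theorem depth_vx {b : Fin h} {p : ℕ} (hp : p ≤ n b) : depth b (vx b p : StarVertex n) = p := by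
  unfold vx
  split_ifs with h1
  · rw [depth_br_self]; simp only; omega
  · rw [depth_center]; omega

theorem depth_vx_of_ne {b c : Fin h} (hbc : c ≠ b) (p : ℕ) :
    depth b (vx c p : StarVertex n) = 0 := by
  unfold vx
  split_ifs with h1
  · rw [depth_br, if_neg hbc]
  · rfl

theorem depth_le (b : Fin h) (v : StarVertex n) : depth b v ≤ n b := by
  rcases v with _ | ⟨c, i⟩
  · exact Nat.zero_le _
  · have : depth b (some ⟨c, i⟩ : StarVertex n) = if c = b then i.val + 1 else 0 := rfl
    rw [this]
    split_ifs with hcb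
    · subst hcb; exact i.isLt
    · exact Nat.zero_le _

theorem InB_iff (b : Fin h) (v : StarVertex n) : InB b v ↔ 0 < depth b v := by
  constructor
  · rintro ⟨i, rfl⟩; simp
  · rcases v with _ | ⟨c, i⟩
    · intro h0; exact absurd h0 (lt_irrefl 0)
    · intro h0
      have : depth b (some ⟨c, i⟩ : StarVertex n) = if c = b then i.val + 1 else 0 := rfl
      rw [this] at h0
      split_ifs at h0 with hcb
      · subst hcb; exact ⟨i, rfl⟩
      · omega

theorem vx_depth {b : Fin h} {v : StarVertex n} (hv : 0 < depth b v) : vx b (depth b v) = v := by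
  obtain ⟨i, rfl⟩ := (InB_iff b v).2 hv
  rw [depth_br_self, br_eq_vx]

theorem eq_center_or_vx (v : StarVertex n) :
    v = center ∨ ∃ b p, 0 < p ∧ p ≤ n b ∧ v = vx b p := by
  rcases v with _ | ⟨c, i⟩
  · exact Or.inl rfl
  · exact Or.inr ⟨c, i.val + 1, Nat.succ_pos _, i.isLt, br_eq_vx c i⟩

theorem eq_center_or_depth_pos (v : StarVertex n) : v = center ∨ ∃ b, 0 < depth b v := by
  rcases eq_center_or_vx v with h0 | ⟨b, p, h1, h2, rfl⟩
  · exact Or.inl h0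
  · exact Or.inr ⟨b, by rw [depth_vx h2]; exact h1⟩

theorem depth_unique {b c : Fin h} {v : StarVertex n} (hb : 0 < depth b v) (hc : 0 < depth c v) :
    b = c := by
  by_contra hne
  rw [← vx_depth hb, depth_vx_of_ne hne] at hc
  exact lt_irrefl _ hc

theorem vx_inj {b : Fin h} {p q : ℕ} (hp : p ≤ n b) (hq : q ≤ n b)
    (hpq : (vx b p : StarVertex n) = vx b q) : p = q := by
  rw [← depth_vx hp, hpq, depth_vx hq]

theorem vx_eq_vx {b c : Fin h} {p q : ℕ} (hp0 : 0 < p) (hp : p ≤ n b) (hq : q ≤ n c)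
    (hpq : (vx b p : StarVertex n) = vx c q) : b = c ∧ p = q := by
  have hbc : b = c := by
    by_contra hne
    have := depth_vx_of_ne (n := n) (Ne.symm hne) q
    rw [← hpq, depth_vx hp] at this
    omega
  subst hbc
  exact ⟨rfl, vx_inj hp hq hpq⟩

theorem vx_ne_center {b : Fin h} {p : ℕ} (hp0 : 0 < p) (hp : p ≤ n b) :
    (vx b p : StarVertex n) ≠ center := by
  intro h0
  have := depth_vx hp
  rw [h0, depth_center] at this
  omega

/-! ### Matchings of the star given by a selection of edges -/

/-- The edges of the star selected by `S`, where `S b p` selects the edge between the positions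
`p` and `p + 1` of branch `b`. -/
def edgesOf (S : Fin h → ℕ → Prop) : Set (Sym2 (StarVertex n)) :=
  {e | ∃ b p, p < n b ∧ S b p ∧ e = s(vx b p, vx b (p + 1))}

variable (n) in
/-- The edges selected by `S` are pairwise disjoint. -/
structure SelectsMatching (S : Fin h → ℕ → Prop) : Prop where
  next : ∀ b p, p + 1 < n b → S b p → ¬ S b (p + 1)
  zero : ∀ b c, 0 < n b → 0 < n c → S b 0 → S c 0 → b = c

theorem adj_iff (v w : StarVertex n) :
    (starGraph n).Adj v w ↔ ∃ b p, p < n b ∧ s(v, w) = s(vx b p, vx b (p + 1)) := by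
  unfold starGraph
  rw [SimpleGraph.fromEdgeSet_adj]
  constructor
  · rintro ⟨⟨b, i, hi⟩, -⟩
    exact ⟨b, i.val, i.isLt, by rw [hi, edge_eq_vx]⟩
  · rintro ⟨b, p, hp, he⟩
    refine ⟨⟨b, ⟨p, hp⟩, by rw [he, edge_eq_vx]⟩, ?_⟩
    rintro rfl
    have h2 : (vx b p : StarVertex n) = vx b (p + 1) := by
      rw [Sym2.eq_iff] at he
      rcases he with ⟨h1, h2⟩ | ⟨h1, h2⟩ <;> rw [← h1, ← h2]
    have := vx_inj hp.le hp h2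
    omega

/-- Two different edges of the star meet either at the center or as consecutive edges of one branch;
the two fields exclude exactly these cases. -/
theorem SelectsMatching.isMatching {S : Fin h → ℕ → Prop} (hS : SelectsMatching n S) :
    IsMatching (starGraph n) (edgesOf S) := by
  constructor
  · rintro e ⟨b, p, hp, -, rfl⟩
    rw [SimpleGraph.mem_edgeSet, adj_iff]
    exact ⟨b, p, hp, rfl⟩
  · rintro e ⟨b, p, hp, hbp, rfl⟩ f ⟨c, q, hq, hcq, rfl⟩ v hv hw
    rw [Sym2.mem_iff] at hv hw
    rcases hv with rfl | rfl
    · rcases Nat.eq_zero_or_pos p with rfl | hp0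
      · rcases hw with h1 | h1
        · rcases Nat.eq_zero_or_pos q with rfl | hq0
          · obtain rfl := hS.zero b c hp hq hbp hcq
            rfl
          · obtain ⟨rfl, rfl⟩ := vx_eq_vx hq0 hq.le hp.le h1.symm
            rfl
        · obtain ⟨rfl, h2⟩ := vx_eq_vx (Nat.succ_pos q) hq hp.le h1.symm
          omega
      · rcases hw with h1 | h1
        · obtain ⟨rfl, rfl⟩ := vx_eq_vx hp0 hp.le hq.le h1
          rfl
        · obtain ⟨rfl, rfl⟩ := vx_eq_vx hp0 hp.le hq h1
          exact absurd hbp (hS.next b q hp hcq)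
    · rcases hw with h1 | h1
      · obtain ⟨rfl, rfl⟩ := vx_eq_vx (Nat.succ_pos p) hp hq.le h1
        exact absurd hcq (hS.next b p hq hbp)
      · obtain ⟨rfl, h2⟩ := vx_eq_vx (Nat.succ_pos p) hp hq h1
        obtain rfl : p = q := by omega
        rfl

section Route

variable {S : Fin h → ℕ → Prop} (D : StarVertex n → StarVertex n)

theorem SelectsMatching.partner_inner (hS : SelectsMatching n S) {b : Fin h} {p : ℕ}
    (hp : p < n b) (hbp : S b p) :
    partner (edgesOf S) (vx b p : StarVertex n) = vx b (p + 1) :=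
  hS.isMatching.partner_eq ⟨b, p, hp, hbp, rfl⟩

theorem SelectsMatching.partner_outer (hS : SelectsMatching n S) {b : Fin h} {p : ℕ}
    (hp : p < n b) (hbp : S b p) :
    partner (edgesOf S) (vx b (p + 1) : StarVertex n) = vx b p :=
  hS.isMatching.partner_eq ⟨b, p, hp, hbp, Sym2.eq_swap⟩

theorem SelectsMatching.route_inner (hS : SelectsMatching n S) {b : Fin h} {p : ℕ}
    (hp : p < n b) (hbp : S b p) :
    route (edgesOf S) D (vx b p) = D (vx b (p + 1)) := by
  rw [route_eq, hS.partner_inner hp hbp]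

theorem SelectsMatching.route_outer (hS : SelectsMatching n S) {b : Fin h} {p : ℕ}
    (hp : p < n b) (hbp : S b p) :
    route (edgesOf S) D (vx b (p + 1)) = D (vx b p) := by
  rw [route_eq, hS.partner_outer hp hbp]

theorem route_edgesOf_of_not {b : Fin h} {p : ℕ} (hp : p + 1 ≤ n b)
    (h1 : p + 1 < n b → ¬ S b (p + 1)) (h2 : ¬ S b p) :
    route (edgesOf S) D (vx b (p + 1)) = D (vx b (p + 1)) := by
  rw [route_eq, partner_eq_self]
  rintro w ⟨c, q, hq, hcq, he⟩
  rw [Sym2.eq_iff] at he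
  rcases he with ⟨h3, -⟩ | ⟨h3, -⟩
  · obtain ⟨rfl, rfl⟩ := vx_eq_vx (Nat.succ_pos p) hp hq.le h3
    exact h1 hq hcq
  · obtain ⟨rfl, h4⟩ := vx_eq_vx (Nat.succ_pos p) hp hq h3
    obtain rfl : p = q := by omega
    exact h2 hcq

theorem route_edgesOf_center (h1 : ∀ b, 0 < n b → ¬ S b 0) :
    route (edgesOf S) D center = D center := by
  rw [route_eq, partner_eq_self]
  rintro w ⟨c, q, hq, hcq, he⟩
  rw [Sym2.eq_iff] at he
  rcases he with ⟨h3, -⟩ | ⟨h3, -⟩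
  · rcases Nat.eq_zero_or_pos q with rfl | hq0
    · exact h1 c hq hcq
    · exact absurd h3.symm (vx_ne_center hq0 hq.le)
  · exact absurd h3.symm (vx_ne_center (Nat.succ_pos q) hq)

end Route

theorem depth_adj {v w : StarVertex n} (b : Fin h) (hvw : (starGraph n).Adj v w) :
    depth b v ≤ depth b w + 1 := by
  obtain ⟨c, p, hp, he⟩ := (adj_iff v w).1 hvw
  rw [Sym2.eq_iff] at he
  by_cases hcb : c = b
  · subst hcb
    have h1 := depth_vx hp.le
    have h2 : depth c (vx c (p + 1) : StarVertex n) = p + 1 := depth_vx hp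
    rcases he with ⟨rfl, rfl⟩ | ⟨rfl, rfl⟩ <;> omega
  · rcases he with ⟨rfl, rfl⟩ | ⟨rfl, rfl⟩ <;>
      rw [depth_vx_of_ne hcb, depth_vx_of_ne hcb] <;> omega

/-- This makes the center a bottleneck: every entry into a branch passes through it. -/
theorem center_of_adj {v w : StarVertex n} {b : Fin h} (hvw : (starGraph n).Adj v w)
    (hv : 0 < depth b v) (hw : depth b w = 0) : w = center := by
  obtain ⟨c, p, hp, he⟩ := (adj_iff v w).1 hvw
  rw [Sym2.eq_iff] at he
  by_cases hcb : c = b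
  · subst hcb
    rcases he with ⟨rfl, rfl⟩ | ⟨rfl, rfl⟩
    · rw [depth_vx hp] at hw; omega
    · rw [depth_vx hp.le] at hw; rw [hw, vx_zero]
  · rcases he with ⟨rfl, rfl⟩ | ⟨rfl, rfl⟩ <;>
      rw [depth_vx_of_ne hcb] at hv <;> omega

/-! ### Lower bounds on the length of a solution -/

/-- The tokens that lie outside of their branch. -/
def misplaced (C : StarVertex n → StarVertex n) : Set (StarVertex n) :=
  {t | ∃ c v, C v = t ∧ 0 < depth c t ∧ depth c v = 0}

/-- The properties of an instance that a bound `L` on the length of a solution gives. -/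
structure LowerBound (L : ℕ) (C : StarVertex n → StarVertex n) : Prop where
  misplaced_le : (misplaced C).ncard ≤ L
  depth_le : ∀ b v, depth b v ≤ depth b (C v) + L
  le_depth : ∀ b v, depth b (C v) ≤ depth b v + L

theorem IsMatching.depth_partner {M : Set (Sym2 (StarVertex n))}
    (hM : IsMatching (starGraph n) M) (b : Fin h) (v : StarVertex n) :
    depth b v ≤ depth b (partner M v) + 1 := by
  rcases partner_eq_or_mem M v with h1 | h1
  · rw [h1]; omega
  · exact depth_adj b ((SimpleGraph.mem_edgeSet _).1 (hM.1 h1))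

/-- A token stops being misplaced only by stepping from the center into its branch, and only one
token is on the center. Hence a matching repairs at most one token. -/
theorem misplaced_subset_insert {M : Set (Sym2 (StarVertex n))}
    (hM : IsMatching (starGraph n) M) (C : StarVertex n → StarVertex n) :
    misplaced C ⊆ insert (C center) (misplaced (route M C)) := by
  rintro t ⟨c, v, rfl, h1, h2⟩
  rcases Nat.eq_zero_or_pos (depth c (partner M v)) with h3 | h3
  · exact Or.inr ⟨c, partner M v, by rw [route_eq, hM.partner_partner], h1, h3⟩
  · rcases partner_eq_or_mem M v with h4 | h4
    · rw [h4] at h3; omega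
    · have := center_of_adj (((SimpleGraph.mem_edgeSet _).1 (hM.1 h4)).symm) h3 h2
      rw [this]
      exact Or.inl rfl

theorem lowerBound_of_isSolution (Ms : List (Set (Sym2 (StarVertex n)))) :
    ∀ C, IsSolution (starGraph n) C Ms → LowerBound Ms.length C := by
  induction Ms with
  | nil =>
    rintro C ⟨-, hC⟩
    have hC : C = id := hC
    subst hC
    refine ⟨?_, by simp, by simp⟩
    have : misplaced (id : StarVertex n → StarVertex n) = ∅ := by
      ext t
      simp only [misplaced, Set.mem_ofPred_eq, Set.mem_empty_iff_false, iff_false]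
      rintro ⟨c, v, rfl, h1, h2⟩
      simp only [id] at h1
      omega
    rw [this]; simp
  | cons M Ms ih =>
    rintro C ⟨hMs, hC⟩
    have hM := hMs M (by simp)
    have h1 := ih (route M C) ⟨fun N hN => hMs N (by simp [hN]), hC⟩
    have key : ∀ v, route M C (partner M v) = C v := fun v => by
      rw [route_eq, hM.partner_partner]
    refine ⟨?_, fun b v => ?_, fun b v => ?_⟩
    · have h2 := Set.ncard_le_ncard (misplaced_subset_insert hM C) (Set.toFinite _)
      have h3 := Set.ncard_insert_le (C center) (misplaced (route M C))
      have := h1.misplaced_le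
      simp only [List.length_cons]
      omega
    · have h2 := h1.depth_le b (partner M v)
      have h3 := hM.depth_partner b v
      rw [key] at h2
      simp only [List.length_cons]
      omega
    · have h2 := h1.le_depth b (partner M v)
      have h3 := hM.depth_partner b (partner M v)
      rw [hM.partner_partner] at h3
      rw [key] at h2
      simp only [List.length_cons]
      omega

theorem card_starVertex : Nat.card (StarVertex n) = numVertices n := by
  simp [numVertices, add_comm]

theorem le_numVertices (b : Fin h) : n b ≤ numVertices n := by
  have := Finset.single_le_sum (f := n) (fun _ _ => Nat.zero_le _) (Finset.mem_univ b)
  unfold numVertices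
  omega

/-- A bound that presupposes no solution. It starts the argument, giving termination and thereby
solvability. -/
theorem lowerBound_numVertices (C : StarVertex n → StarVertex n) :
    LowerBound (numVertices n) C where
  misplaced_le := by
    rw [← card_starVertex]
    exact Set.ncard_le_card _
  depth_le b v := by
    have := depth_le b v
    have := le_numVertices (n := n) b
    omega
  le_depth b v := by
    have := depth_le b (C v)
    have := le_numVertices (n := n) b
    omega

/-- Solvability is needed because the infimum of the empty set is `0`. -/
theorem lowerBound_OPT {C : StarVertex n → StarVertex n}
    (hC : ∃ Ms, IsSolution (starGraph n) C Ms) : LowerBound (OPT (starGraph n) C) C := by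
  obtain ⟨Ms, hMs⟩ := hC
  obtain ⟨Ns, h1, h2⟩ := Nat.sInf_mem
    (s := {k | ∃ Ms, IsSolution (starGraph n) C Ms ∧ Ms.length = k}) ⟨_, Ms, hMs, rfl⟩
  have := lowerBound_of_isSolution Ns C h1
  rw [h2] at this
  exact this

/-! ### The swaps of the algorithm as selections of edges -/

/-- The selection of the swaps of the first phase. -/
def SortSel (D : StarVertex n → StarVertex n) (b : Fin h) (p : ℕ) : Prop :=
  0 < p ∧ 0 < depth b (D (vx b p)) ∧ depth b (D (vx b (p + 1))) = 0

/-- The selection of the swap that moves the token of the center outward. -/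
def KeepSel (D : StarVertex n → StarVertex n) (b : Fin h) (p : ℕ) : Prop :=
  0 < p ∧ D (vx b p) = center ∧ depth b (D (vx b (p + 1))) = 0 ∧ depth b (D (vx b (p - 1))) = 0

/-- The selection of the swaps of the second phase, where `b` is the branch that exchanges a token
with the center. -/
def ChangeSel (D : StarVertex n → StarVertex n) (b c : Fin h) (p : ℕ) : Prop :=
  SortSel D c p ∨ (p = 0 ∧ c = b) ∨ (D center ≠ center ∧ KeepSel D c p)

/-- The selection of the swaps of the third phase. -/
def OddEvenSel (k : ℕ) (D : StarVertex n → StarVertex n) (b : Fin h) (p : ℕ) : Prop :=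
  0 < p ∧ p % 2 = k % 2 ∧ 0 < depth b (D (vx b (p + 1))) ∧
    depth b (D (vx b (p + 1))) < depth b (D (vx b p))

theorem innerSwaps_eq (D : StarVertex n → StarVertex n) : innerSwaps D = edgesOf (SortSel D) := by
  ext e
  constructor
  · rintro ⟨b, i, h1, rfl, h2, h3⟩
    rw [InB_iff, inward_eq_vx] at h2
    rw [InB_iff, br_eq_vx] at h3
    exact ⟨b, i.val, i.isLt, ⟨by omega, h2, by omega⟩, edge_eq_vx b i⟩
  · rintro ⟨b, p, hp, ⟨h1, h2, h3⟩, rfl⟩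
    refine ⟨b, ⟨p, hp⟩, by simp only; omega, (edge_eq_vx b ⟨p, hp⟩).symm, ?_, ?_⟩
    · rwa [InB_iff, inward_eq_vx]
    · rw [InB_iff, br_eq_vx, h3]; exact lt_irrefl 0

theorem oddEvenSwaps_eq (k : ℕ) (D : StarVertex n → StarVertex n) :
    oddEvenSwaps k D = edgesOf (OddEvenSel k D) := by
  ext e
  constructor
  · rintro ⟨b, i, h1, h2, rfl, x, y, hxy, h3, h4⟩
    refine ⟨b, i.val, i.isLt, ⟨by omega, h2, ?_⟩, edge_eq_vx b i⟩
    rw [inward_eq_vx] at h3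
    rw [br_eq_vx] at h4
    rw [h3, h4, depth_br_self, depth_br_self]
    have : y.val < x.val := hxy
    omega
  · rintro ⟨b, p, hp, ⟨h1, h2, h3, h4⟩, rfl⟩
    obtain ⟨x, hx⟩ := (InB_iff b (D (vx b p))).2 (by omega)
    obtain ⟨y, hy⟩ := (InB_iff b (D (vx b (p + 1)))).2 (by omega)
    refine ⟨b, ⟨p, hp⟩, by simp only; omega, h2, (edge_eq_vx b ⟨p, hp⟩).symm, x, y, ?_, ?_, ?_⟩
    · rw [hx, hy, depth_br_self, depth_br_self] at h4
      exact Fin.lt_def.2 (by omega)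
    · rwa [inward_eq_vx]
    · rwa [br_eq_vx]

theorem unfinished_iff (hn : ∀ b, 0 < n b) (D : StarVertex n → StarVertex n) (b : Fin h) :
    Unfinished D b ↔ depth b (D (vx b 1)) = 0 := by
  constructor
  · rintro ⟨i, h1, h2⟩
    rw [InB_iff, br_eq_vx, h1] at h2
    simpa using h2
  · intro h1
    refine ⟨⟨0, hn b⟩, rfl, ?_⟩
    rw [InB_iff, br_eq_vx]
    simp [h1]

/-- The branch `b` may exchange a token with the center in the second phase. -/
def Target (D : StarVertex n → StarVertex n) (b : Fin h) : Prop :=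
  (D center = center ∧ depth b (D (vx b 1)) = 0) ∨ 0 < depth b (D center)

/-- The test `D center ≠ center` inside `ChangeSel` lets one selection describe both kinds of
iteration, without assuming `D` injective. -/
theorem phase2Swaps_iff (hn : ∀ b, 0 < n b) (D : StarVertex n → StarVertex n)
    (M : Set (Sym2 (StarVertex n))) :
    Phase2Swaps D M ↔ ∃ b, Target D b ∧ M = edgesOf (ChangeSel D b) := by
  have key1 : ∀ b : Fin h, D center = center → ∀ i : Fin (n b), i.val = 0 →
      innerSwaps D ∪ {edge b i} = edgesOf (ChangeSel D b) := by
    intro b hc i hi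
    rw [innerSwaps_eq]
    ext e
    constructor
    · rintro (⟨c, p, hp, h1, rfl⟩ | rfl)
      · exact ⟨c, p, hp, Or.inl h1, rfl⟩
      · exact ⟨b, i.val, i.isLt, Or.inr (Or.inl ⟨hi, rfl⟩), edge_eq_vx b i⟩
    · rintro ⟨c, p, hp, h1 | ⟨rfl, rfl⟩ | h1, rfl⟩
      · exact Or.inl ⟨c, p, hp, h1, rfl⟩
      · exact Or.inr (by rw [Set.mem_singleton_iff, edge_eq_vx, hi])
      · exact absurd hc h1.1
  have key2 : ∀ b : Fin h, 0 < depth b (D center) → ∀ i : Fin (n b), i.val = 0 →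
      innerSwaps D ∪ {edge b i} ∪ keepOut D = edgesOf (ChangeSel D b) := by
    intro b hc i hi
    have hcc : D center ≠ center := by
      intro h0; rw [h0, depth_center] at hc; omega
    rw [innerSwaps_eq]
    ext e
    constructor
    · rintro ((⟨c, p, hp, h1, rfl⟩ | rfl) | ⟨c, j, h1, ⟨j', h2, rfl, h3, h4⟩ | ⟨rfl, h2⟩⟩)
      · exact ⟨c, p, hp, Or.inl h1, rfl⟩
      · exact ⟨b, i.val, i.isLt, Or.inr (Or.inl ⟨hi, rfl⟩), edge_eq_vx b i⟩
      · rw [br_eq_vx] at h1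
        rw [InB_iff, br_eq_vx] at h3
        rw [InB_iff, inward_eq_vx] at h4
        refine ⟨c, j', j'.isLt, Or.inr (Or.inr ⟨hcc, by omega, ?_, by omega, ?_⟩),
          edge_eq_vx c j'⟩
        · rw [h2]; exact h1
        · rw [h2, Nat.add_sub_cancel]; omega
      -- The second clause of `keepOut` adds no new edge: `v₀` is foreign to every branch, so this
      -- is a sorting swap, or, next to the center, the exchange with the center itself.
      · rw [InB_iff, inward_eq_vx] at h2
        rw [br_eq_vx] at h1
        refine ⟨c, j, j.isLt, ?_, edge_eq_vx c j⟩
        rcases Nat.eq_zero_or_pos j.val with h0 | h0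
        · rw [h0, vx_zero] at h2
          exact Or.inr (Or.inl ⟨h0, depth_unique h2 hc⟩)
        · exact Or.inl ⟨h0, h2, by rw [h1, depth_center]⟩
    · rintro ⟨c, p, hp, h1 | ⟨rfl, rfl⟩ | ⟨-, h1, h2, h3, h4⟩, rfl⟩
      · exact Or.inl (Or.inl ⟨c, p, hp, h1, rfl⟩)
      · exact Or.inl (Or.inr (by rw [Set.mem_singleton_iff, edge_eq_vx, hi]))
      · obtain ⟨q, rfl⟩ : ∃ q, p = q + 1 := ⟨p - 1, by omega⟩
        refine Or.inr ⟨c, ⟨q, by omega⟩, by rw [br_eq_vx]; exact h2, Or.inl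
          ⟨⟨q + 1, hp⟩, rfl, (edge_eq_vx c ⟨q + 1, hp⟩).symm, ?_, ?_⟩⟩
        · rw [InB_iff, br_eq_vx]; simp only; omega
        · rw [InB_iff, inward_eq_vx]; simp only [Nat.add_sub_cancel] at h4 ⊢; omega
  constructor
  · rintro ⟨b, i, hi, ⟨h1, h2, rfl⟩ | ⟨h1, rfl⟩⟩
    · exact ⟨b, Or.inl ⟨h1, (unfinished_iff hn D b).1 h2⟩, key1 b h1 i hi⟩
    · rw [InB_iff] at h1
      exact ⟨b, Or.inr h1, key2 b h1 i hi⟩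
  · rintro ⟨b, ⟨h1, h2⟩ | h1, rfl⟩
    · exact ⟨b, ⟨0, hn b⟩, rfl, Or.inl ⟨h1, (unfinished_iff hn D b).2 h2,
        (key1 b h1 _ rfl).symm⟩⟩
    · exact ⟨b, ⟨0, hn b⟩, rfl, Or.inr ⟨(InB_iff _ _).2 h1, (key2 b h1 _ rfl).symm⟩⟩

theorem selectsMatching_sortSel (D : StarVertex n → StarVertex n) :
    SelectsMatching n (SortSel D) where
  next b p _ h1 h2 := by
    have := h1.2.2
    have := h2.2.1
    omega
  zero b c _ _ h1 _ := absurd h1.1 (lt_irrefl 0)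

theorem selectsMatching_oddEvenSel (k : ℕ) (D : StarVertex n → StarVertex n) :
    SelectsMatching n (OddEvenSel k D) where
  next b p _ h1 h2 := by
    have := h1.2.1
    have := h2.2.1
    omega
  zero b c _ _ h1 _ := absurd h1.1 (lt_irrefl 0)

/-- Two consecutive selected edges would ask for contradictory things: a common token both own and
foreign, an own token on the inner side of `v₀`, or two positions of `v₀`. Beside the exchange edge,
a sorting swap is excluded by `hb`, and a move of `v₀` from depth `1` by the fact that the token on
the center belongs to `b`. -/
theorem selectsMatching_changeSel {D : StarVertex n → StarVertex n} (hD : Function.Injective D)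
    {b : Fin h} (hb : depth b (D (vx b 1)) = 0) (hT : Target D b) :
    SelectsMatching n (ChangeSel D b) where
  next c p hp := by
    have hcc : D center ≠ center → 0 < depth b (D center) := fun h1 =>
      hT.resolve_left fun h2 => h1 h2.1
    rintro (⟨h1, h2, h3⟩ | ⟨rfl, rfl⟩ | ⟨h1, h2, h3, h4, h5⟩)
      (⟨h6, h7, h8⟩ | ⟨h6, -⟩ | ⟨h6, h7, h8, h9, h10⟩)
    · omega
    · omega
    · rw [Nat.add_sub_cancel] at h10; omega
    · rw [Nat.zero_add] at h7; omega
    · omega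
    · rw [Nat.zero_add, Nat.sub_self, vx_zero] at h10
      have := hcc h6
      omega
    · omega
    · omega
    · have := vx_inj (n := n) (by omega) (by omega) (hD (h3.trans h8.symm))
      omega
  zero c c' _ _ := by
    rintro (h1 | ⟨-, rfl⟩ | ⟨-, h1⟩) (h2 | ⟨-, rfl⟩ | ⟨-, h2⟩)
    · exact absurd h1.1 (lt_irrefl 0)
    · exact absurd h1.1 (lt_irrefl 0)
    · exact absurd h1.1 (lt_irrefl 0)
    · exact absurd h2.1 (lt_irrefl 0)
    · rfl
    · exact absurd h2.1 (lt_irrefl 0)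
    · exact absurd h1.1 (lt_irrefl 0)
    · exact absurd h1.1 (lt_irrefl 0)
    · exact absurd h1.1 (lt_irrefl 0)

/-! ### The time for sorting -/

/-- The number of the first `P` vertices of branch `b` whose token is at depth at most `z` in the
target configuration. -/
def lowCount (b : Fin h) (z : ℕ) (D : StarVertex n → StarVertex n) (P : ℕ) : ℕ :=
  Nat.count (fun p => depth b (D (vx b (p + 1))) ≤ z) P

theorem lowCount_succ (b : Fin h) (z : ℕ) (D : StarVertex n → StarVertex n) (P : ℕ) :
    lowCount b z D (P + 1) =
      lowCount b z D P + if depth b (D (vx b (P + 1))) ≤ z then 1 else 0 :=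
  Nat.count_succ _ _

theorem lowCount_le (b : Fin h) (z : ℕ) (D : StarVertex n → StarVertex n) (P : ℕ) :
    lowCount b z D P ≤ P :=
  Nat.count_le _

theorem lowCount_mono (b : Fin h) (z : ℕ) (D : StarVertex n → StarVertex n) {P Q : ℕ}
    (hPQ : P ≤ Q) : lowCount b z D P ≤ lowCount b z D Q :=
  Nat.count_monotone _ hPQ

/-- Swaps on one side of a cut do not change the count of a prefix, so only a swap across the cut
matters. The two cases are proved together because the induction needs the other one at the previous
cut. -/
theorem SelectsMatching.lowCount_route {S : Fin h → ℕ → Prop} (hS : SelectsMatching n S)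
    (D : StarVertex n → StarVertex n) (b : Fin h) (h0 : ¬ S b 0) (z : ℕ) :
    ∀ P, P + 1 ≤ n b →
      (P + 1 < n b → S b (P + 1) → lowCount b z (route (edgesOf S) D) (P + 1) =
        lowCount b z D P + if depth b (D (vx b (P + 2))) ≤ z then 1 else 0) ∧
      ((P + 1 < n b → ¬ S b (P + 1)) →
        lowCount b z (route (edgesOf S) D) (P + 1) = lowCount b z D (P + 1)) := by
  intro P
  induction P with
  | zero =>
    intro hP
    constructor
    · intro h1 h2
      rw [lowCount_succ, hS.route_inner D h1 h2]
      simp [lowCount]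
    · intro h1
      rw [lowCount_succ, lowCount_succ, route_edgesOf_of_not D hP h1 h0]
      simp [lowCount]
  | succ P ih =>
    intro hP
    obtain ⟨ih1, ih2⟩ := ih (by omega)
    by_cases hSP : S b (P + 1)
    · have h1 : P + 2 < n b → ¬ S b (P + 2) := fun h1 => hS.next b (P + 1) h1 hSP
      refine ⟨fun h2 h3 => absurd h3 (h1 h2), fun _ => ?_⟩
      rw [lowCount_succ, ih1 hP hSP, hS.route_outer D hP hSP, lowCount_succ b z D (P + 1),
        lowCount_succ b z D P]
      simp only [show P + 1 + 1 = P + 2 from rfl]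
      omega
    · have h1 := ih2 fun _ => hSP
      constructor
      · intro h2 h3
        rw [lowCount_succ, h1, hS.route_inner D h2 h3]
      · intro h2
        rw [lowCount_succ, h1, route_edgesOf_of_not D hP h2 hSP, lowCount_succ _ _ _ (P + 1)]

theorem SelectsMatching.lowCount_route_last {S : Fin h → ℕ → Prop} (hS : SelectsMatching n S)
    (D : StarVertex n → StarVertex n) (b : Fin h) (h0 : ¬ S b 0) (z : ℕ) :
    lowCount b z (route (edgesOf S) D) (n b) = lowCount b z D (n b) := by
  rcases Nat.eq_zero_or_pos (n b) with h1 | h1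
  · rw [h1]; simp [lowCount]
  · obtain ⟨m, hm⟩ : ∃ m, n b = m + 1 := ⟨n b - 1, by omega⟩
    rw [hm]
    exact (hS.lowCount_route D b h0 z m hm.ge).2 fun h2 => by omega

/-- The number of high tokens among the first `P` plus that of low tokens among the others is at
most `B`, unless one of the two numbers is zero. -/
def Spread (B : ℕ) (b : Fin h) (z : ℕ) (D : StarVertex n → StarVertex n) (P : ℕ) : Prop :=
  lowCount b z D P < P → lowCount b z D P < lowCount b z D (n b) →
    P + lowCount b z D (n b) ≤ 2 * lowCount b z D P + B

theorem Spread.zero (B : ℕ) (b : Fin h) (z : ℕ) (D : StarVertex n → StarVertex n) :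
    Spread B b z D 0 := fun h1 => by omega

theorem Spread.last (B : ℕ) (b : Fin h) (z : ℕ) (D : StarVertex n → StarVertex n) :
    Spread B b z D (n b) := fun _ h1 => absurd h1 (lt_irrefl _)

theorem Spread.mono {B B' : ℕ} (hB : B ≤ B') {b : Fin h} {z : ℕ} {D : StarVertex n → StarVertex n}
    {P : ℕ} (hP : Spread B b z D P) : Spread B' b z D P := fun h1 h2 => by
  have := hP h1 h2
  omega

/-- A compare-exchange step between the positions `P + 1` and `P + 2`. -/
theorem Spread.route {S : Fin h → ℕ → Prop} (hS : SelectsMatching n S)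
    {D : StarVertex n → StarVertex n} {b : Fin h} (h0 : ¬ S b 0) {z B P : ℕ} (hP : P + 1 < n b)
    (h1 : S b (P + 1) → depth b (D (vx b (P + 1))) ≤ z → depth b (D (vx b (P + 2))) ≤ z)
    (h2 : ¬ S b (P + 1) → depth b (D (vx b (P + 2))) ≤ z → depth b (D (vx b (P + 1))) ≤ z)
    (h3 : Spread B b z D P) (h4 : Spread B b z D (P + 2)) :
    Spread (B - 1) b z (route (edgesOf S) D) (P + 1) := by
  obtain ⟨h5, h6⟩ := hS.lowCount_route D b h0 z P hP.le
  have h7 := lowCount_succ b z D P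
  have h8 : lowCount b z D (P + 2) = lowCount b z D (P + 1) +
      if depth b (D (vx b (P + 2))) ≤ z then 1 else 0 := lowCount_succ b z D (P + 1)
  have h9 : lowCount b z D (P + 2) ≤ lowCount b z D (n b) := lowCount_mono b z D hP
  have h10 := lowCount_le b z D P
  unfold Spread at *
  rw [hS.lowCount_route_last D b h0 z]
  -- After the step the pair is low-low, low-high or high-high. In the first two cases the cut `P`,
  -- in the last one the cut `P + 2`, had a sum larger by exactly one, with both parts nonzero; its
  -- bound `B` yields `B - 1`.
  by_cases hSP : S b (P + 1)
  · rw [h5 hP hSP]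
    have h1 := h1 hSP
    split_ifs at * <;> omega
  · rw [h6 fun _ => hSP]
    have h2 := h2 hSP
    split_ifs at * <;> omega

theorem lowCount_lt_of_high {b : Fin h} {z : ℕ} {D : StarVertex n → StarVertex n} {p P : ℕ}
    (hp0 : 0 < p) (hp : p ≤ P) (hz : z < depth b (D (vx b p))) : lowCount b z D P < P := by
  induction P with
  | zero => omega
  | succ P ih =>
    rw [lowCount_succ]
    have := lowCount_le b z D P
    rcases Nat.lt_or_ge P p with h1 | h1
    · obtain rfl : p = P + 1 := by omega
      rw [if_neg (by omega)]
      omega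
    · have := ih h1
      split_ifs <;> omega

theorem lowCount_lt_of_low {b : Fin h} {z : ℕ} {D : StarVertex n → StarVertex n} {p P m : ℕ}
    (hp : P < p) (hm : p ≤ m) (hz : depth b (D (vx b p)) ≤ z) :
    lowCount b z D P < lowCount b z D m := by
  obtain ⟨q, rfl⟩ : ∃ q, p = q + 1 := ⟨p - 1, by omega⟩
  have h1 := lowCount_succ b z D q
  rw [if_pos hz] at h1
  have h2 := lowCount_mono b z D (show P ≤ q by omega)
  have h3 := lowCount_mono b z D hm
  omega

/-! ### Where tokens come from -/

theorem SelectsMatching.source {S : Fin h → ℕ → Prop} (hS : SelectsMatching n S)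
    (D : StarVertex n → StarVertex n) {b : Fin h} {p : ℕ} (hp0 : 0 < p) (hp : p ≤ n b) :
    ∃ s, s ≤ n b ∧ route (edgesOf S) D (vx b p) = D (vx b s) ∧
      ((s = p ∧ (p < n b → ¬ S b p) ∧ ¬ S b (p - 1)) ∨ (s = p + 1 ∧ p < n b ∧ S b p) ∨
        (s + 1 = p ∧ S b s)) := by
  obtain ⟨q, rfl⟩ : ∃ q, p = q + 1 := ⟨p - 1, by omega⟩
  by_cases h1 : S b q
  · exact ⟨q, by omega, hS.route_outer D hp h1, Or.inr (Or.inr ⟨rfl, h1⟩)⟩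
  · by_cases h2 : q + 1 < n b ∧ S b (q + 1)
    · exact ⟨q + 2, h2.1, hS.route_inner D h2.1 h2.2, Or.inr (Or.inl ⟨rfl, h2⟩)⟩
    · have h3 : q + 1 < n b → ¬ S b (q + 1) := fun h3 h4 => h2 ⟨h3, h4⟩
      exact ⟨q + 1, hp, route_edgesOf_of_not D hp h3 h1, Or.inl ⟨rfl, h3, h1⟩⟩

theorem SelectsMatching.source_center {S : Fin h → ℕ → Prop} (hS : SelectsMatching n S)
    (D : StarVertex n → StarVertex n) :
    route (edgesOf S) D center = D center ∨
      ∃ b, 0 < n b ∧ S b 0 ∧ route (edgesOf S) D center = D (vx b 1) := by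
  by_cases h1 : ∃ b, 0 < n b ∧ S b 0
  · obtain ⟨b, h2, h3⟩ := h1
    exact Or.inr ⟨b, h2, h3, by simpa using hS.route_inner D h2 h3⟩
  · exact Or.inl (route_edgesOf_center D fun b h2 h3 => h1 ⟨b, h2, h3⟩)

/-- A token can leave a branch only over the edge at the center, and by `hcen` only foreign tokens
do so. Hence an own token found outside its branch was outside before. -/
theorem SelectsMatching.exists_outside {S : Fin h → ℕ → Prop} (hS : SelectsMatching n S)
    {D : StarVertex n → StarVertex n}
    (hcen : ∀ b, 0 < n b → S b 0 → depth b (D (vx b 1)) = 0) {b : Fin h} {v : StarVertex n}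
    (h1 : 0 < depth b (route (edgesOf S) D v)) (h2 : depth b v = 0) :
    ∃ w, D w = route (edgesOf S) D v ∧ depth b w = 0 := by
  rcases eq_center_or_vx v with rfl | ⟨c, p, h3, h4, rfl⟩
  · rcases hS.source_center D with h5 | ⟨c, h5, h6, h7⟩
    · exact ⟨center, h5.symm, h2⟩
    · refine ⟨vx c 1, h7.symm, depth_vx_of_ne ?_ 1⟩
      rintro rfl
      rw [h7, hcen c h5 h6] at h1
      exact lt_irrefl _ h1
  · have hcb : c ≠ b := by
      rintro rfl
      rw [depth_vx h4] at h2
      omega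
    obtain ⟨s, -, h5, -⟩ := hS.source D h3 h4
    exact ⟨vx c s, h5.symm, depth_vx_of_ne hcb s⟩

theorem SelectsMatching.misplaced_subset {S : Fin h → ℕ → Prop} (hS : SelectsMatching n S)
    {D : StarVertex n → StarVertex n}
    (hcen : ∀ b, 0 < n b → S b 0 → depth b (D (vx b 1)) = 0) :
    misplaced (route (edgesOf S) D) ⊆ misplaced D := by
  rintro t ⟨c, v, rfl, h1, h2⟩
  obtain ⟨w, h3, h4⟩ := hS.exists_outside hcen h1 h2
  exact ⟨c, w, h3, h1, h4⟩

/-! ### The order of the tokens of a branch before the third phase -/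

/-- The tokens lying in their branch are ordered according to their depths in the initial
configuration `C`, and the tokens outside of their branch have been outside from the beginning. -/
structure Tracked (C D : StarVertex n → StarVertex n) : Prop where
  bij : Function.Bijective D
  ord : ∀ b p q, 0 < p → p < q → q ≤ n b → 0 < depth b (D (vx b p)) → 0 < depth b (D (vx b q)) →
    ∀ v w, C v = D (vx b p) → C w = D (vx b q) → depth b v ≤ depth b w
  out : ∀ b v, 0 < depth b (D v) → depth b v = 0 → ∀ w, C w = D v → depth b w = 0

theorem Tracked.refl {C : StarVertex n → StarVertex n} (hC : Function.Bijective C) :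
    Tracked C C where
  bij := hC
  ord b p q _ h2 h3 _ _ v w h6 h7 := by
    rw [hC.1 h6, hC.1 h7, depth_vx h3, depth_vx (by omega)]
    exact h2.le
  out b v _ h2 w h3 := by rwa [hC.1 h3]

/-- Own tokens are never swapped with each other (`hown`) and never leave (`hcen`). A token that
enters has always been outside, with initial depth `0`, and enters at the front, so the weak order
survives. -/
theorem Tracked.route {C D : StarVertex n → StarVertex n} (hD : Tracked C D)
    {S : Fin h → ℕ → Prop} (hS : SelectsMatching n S)
    (hcen : ∀ b, 0 < n b → S b 0 → depth b (D (vx b 1)) = 0)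
    (hown : ∀ b p, 0 < p → p < n b → S b p →
      depth b (D (vx b p)) = 0 ∨ depth b (D (vx b (p + 1))) = 0) :
    Tracked C (route (edgesOf S) D) where
  bij := hS.isMatching.bijective_route hD.bij
  ord b p q hp hpq hq h1 h2 v w hv hw := by
    obtain ⟨s, h3, h4, h5⟩ := hS.source D hp (by omega : p ≤ n b)
    obtain ⟨t, h6, h7, h8⟩ := hS.source D (by omega : 0 < q) hq
    rw [h4] at h1 hv
    rw [h7] at h2 hw
    -- Sources in the wrong order would need either two selected edges with a common end or a swap
    -- of two own tokens.
    have hst : s < t := by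
      by_contra hst
      rcases h5 with ⟨h5, h9, -⟩ | ⟨h5, h9, h10⟩ | ⟨h5, -⟩
      · rcases h8 with ⟨h8, -⟩ | ⟨h8, -⟩ | ⟨h8, h11⟩
        · omega
        · omega
        · obtain rfl : t = p := by omega
          exact h9 (by omega) h11
      · rcases h8 with ⟨h8, -, h11⟩ | ⟨h8, -⟩ | ⟨h8, h11⟩
        · obtain rfl : q = p + 1 := by omega
          exact h11 h10
        · omega
        · rcases (by omega : t = p ∨ t = p + 1) with rfl | rfl
          · subst h5
            have := hown b t hp h9 h10
            omega
          · exact hS.next b p (by omega) h10 h11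
      · omega
    rcases Nat.eq_zero_or_pos s with rfl | hs
    · rw [hD.out b (vx b 0) h1 (by simp) v hv]
      exact Nat.zero_le _
    · exact hD.ord b s t hs hst h6 h1 h2 v w hv hw
  out b v h1 h2 w h3 := by
    obtain ⟨u, h4, h5⟩ := hS.exists_outside hcen h1 h2
    rw [← h4] at h1 h3
    exact hD.out b u h1 h5 w h3

/-- Among `a` numbers above `z` there is one that is at least `z + a`. -/
theorem exists_large {A : Finset ℕ} {f : ℕ → ℕ} {z : ℕ} (hA : A.Nonempty)
    (hf : Set.InjOn f A) (hz : ∀ p ∈ A, z < f p) : ∃ p ∈ A, z + A.card ≤ f p := by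
  by_contra! hlt
  have h1 : A.image f ⊆ Finset.Ioo z (z + A.card) := by
    intro x hx
    obtain ⟨p, hp, rfl⟩ := Finset.mem_image.1 hx
    exact Finset.mem_Ioo.2 ⟨hz p hp, hlt p hp⟩
  have h2 := Finset.card_le_card h1
  rw [Finset.card_image_of_injOn hf, Nat.card_Ioo] at h2
  have := hA.card_pos
  omega

/-- Among `c` positive numbers up to `z` there is one that is at most `z + 1 - c`. -/
theorem exists_small {A : Finset ℕ} {f : ℕ → ℕ} {z : ℕ} (hA : A.Nonempty)
    (hf : Set.InjOn f A) (h0 : ∀ p ∈ A, 0 < f p) (hz : ∀ p ∈ A, f p ≤ z) :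
    ∃ p ∈ A, f p + A.card ≤ z + 1 := by
  by_contra! hlt
  have h1 : A.image f ⊆ Finset.Ioc (z + 1 - A.card) z := by
    intro x hx
    obtain ⟨p, hp, rfl⟩ := Finset.mem_image.1 hx
    have := hlt p hp
    exact Finset.mem_Ioc.2 ⟨by have := h0 p hp; omega, hz p hp⟩
  have h2 := Finset.card_le_card h1
  rw [Finset.card_image_of_injOn hf, Nat.card_Ioc] at h2
  have h3 := hA.card_pos
  obtain ⟨p, hp⟩ := hA
  have h4 := h0 p hp
  have h5 := hz p hp
  omega

/-- Let `a` high tokens lie inside the cut and `c` low ones outside it, with `a, c > 0`. Some high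
target is at least `z + a` and some low target at most `z + 1 - c`. Initially the first token was
not deeper than the second, and each depth differs from its target by at most `L`, so `a + c ≤ 2L +
1`. -/
theorem Tracked.spread {C D : StarVertex n → StarVertex n} (hC : Function.Bijective C)
    (hD : Tracked C D) {L : ℕ} (hL : LowerBound L C) {b : Fin h}
    (hown : ∀ p, 0 < p → p ≤ n b → 0 < depth b (D (vx b p))) (z : ℕ) {P : ℕ} (hP : P ≤ n b) :
    Spread (2 * L + 1) b z D P := by
  intro h1 h2
  set f : ℕ → ℕ := fun p => depth b (D (vx b (p + 1))) with hf
  have hinj : ∀ p, p < n b → ∀ q, q < n b → f p = f q → p = q := by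
    intro p hp q hq hpq
    have h3 : D (vx b (p + 1)) = D (vx b (q + 1)) := by
      rw [← vx_depth (hown (p + 1) (by omega) hp), ← vx_depth (hown (q + 1) (by omega) hq)]
      exact congrArg (vx b) hpq
    have := vx_inj (n := n) hp hq (hD.bij.1 h3)
    omega
  set A := (Finset.range P).filter fun p => ¬ f p ≤ z with hAdef
  set Z := (Finset.range (n b)).filter (fun p => f p ≤ z) \
    (Finset.range P).filter (fun p => f p ≤ z) with hZdef
  have hcount : ∀ m, lowCount b z D m = ((Finset.range m).filter fun p => f p ≤ z).card := by
    intro m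
    rw [lowCount, Nat.count_eq_card_filter_range]
  have hA : lowCount b z D P + A.card = P := by
    rw [hcount, hAdef, Finset.card_filter_add_card_filter_not, Finset.card_range]
  have hZ : Z.card = lowCount b z D (n b) - lowCount b z D P := by
    rw [hcount, hcount, hZdef, Finset.card_sdiff_of_subset]
    exact Finset.filter_subset_filter _ (Finset.range_mono hP)
  have hAmem : ∀ p ∈ A, p < P ∧ z < f p := by
    intro p hp
    rw [hAdef, Finset.mem_filter, Finset.mem_range] at hp
    omega
  have hZmem : ∀ p ∈ Z, P ≤ p ∧ p < n b ∧ f p ≤ z := by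
    intro p hp
    rw [hZdef, Finset.mem_sdiff, Finset.mem_filter, Finset.mem_filter, Finset.mem_range,
      Finset.mem_range] at hp
    by_contra hcon
    exact hp.2 ⟨by omega, hp.1.2⟩
  obtain ⟨p, hp, hpz⟩ := exists_large (A := A) (f := f) (z := z)
    (Finset.card_pos.1 (by omega))
    (fun x hx y hy => hinj x (by have := hAmem x hx; omega) y (by have := hAmem y hy; omega))
    (fun x hx => (hAmem x hx).2)
  obtain ⟨q, hq, hqz⟩ := exists_small (A := Z) (f := f) (z := z)
    (Finset.card_pos.1 (by omega))
    (fun x hx y hy => hinj x (hZmem x hx).2.1 y (hZmem y hy).2.1)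
    (fun x hx => hown (x + 1) (by omega) (hZmem x hx).2.1)
    (fun x hx => (hZmem x hx).2.2)
  have hp1 := hAmem p hp
  have hq1 := hZmem q hq
  obtain ⟨v, hv⟩ := hC.2 (D (vx b (p + 1)))
  obtain ⟨w, hw⟩ := hC.2 (D (vx b (q + 1)))
  have h3 := hD.ord b (p + 1) (q + 1) (by omega) (by omega) (by omega)
    (hown _ (by omega) (by omega)) (hown _ (by omega) (by omega)) v w hv hw
  have h4 := hL.le_depth b v
  have h5 := hL.depth_le b w
  have h6 : depth b (C v) = f p := by rw [hv]
  have h7 : depth b (C w) = f q := by rw [hw]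
  omega

/-! ### The first phase -/

/-- A foreign token has depth `0` in the target, hence lies at depth at most `L`. So at most `L - P`
foreign tokens are outside the cut, and at most `P` own ones inside it. -/
theorem spread_initial {C : StarVertex n → StarVertex n} {L : ℕ} (hL : LowerBound L C)
    (b : Fin h) (P : ℕ) : Spread L b 0 C P := by
  have key : ∀ d, P + d ≤ n b → lowCount b 0 C (P + d) ≤ lowCount b 0 C P + d ∧
      lowCount b 0 C (P + d) ≤ lowCount b 0 C P + (L - P) := by
    intro d
    induction d with
    | zero => intro _; simp
    | succ d ih =>
      intro hd
      obtain ⟨h1, h2⟩ := ih (by omega)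
      rw [← Nat.add_assoc, lowCount_succ]
      split_ifs with h3
      · have h4 := hL.depth_le b (vx b (P + d + 1))
        rw [depth_vx (by omega)] at h4
        omega
      · omega
  intro h1 h2
  have h3 : P ≤ n b := by
    by_contra h3
    have := lowCount_mono b 0 C (show n b ≤ P by omega)
    omega
  have h4 := key (n b - P) (by omega)
  rw [show P + (n b - P) = n b by omega] at h4
  omega

/-- For the threshold `0` an iteration of the first phase compares across all cuts at once, so every
cut gains one. -/
theorem spread_sort {D : StarVertex n → StarVertex n} {B : ℕ} {b : Fin h}
    (hD : ∀ P, P ≤ n b → Spread B b 0 D P) {P : ℕ} (hP : P ≤ n b) :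
    Spread (B - 1) b 0 (route (edgesOf (SortSel D)) D) P := by
  rcases Nat.eq_zero_or_pos P with rfl | hP0
  · exact Spread.zero _ _ _ _
  obtain ⟨Q, rfl⟩ : ∃ Q, P = Q + 1 := ⟨P - 1, by omega⟩
  rcases Nat.lt_or_ge (Q + 1) (n b) with h1 | h1
  · refine Spread.route (selectsMatching_sortSel D) (fun h0 => lt_irrefl 0 h0.1) h1 ?_ ?_
      (hD Q (by omega)) (hD (Q + 2) (by omega))
    · intro h2 _
      exact h2.2.2.le
    · intro h2 (h3 : depth b (D (vx b (Q + 1 + 1))) ≤ 0)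
      by_contra h4
      exact h2 ⟨by omega, by omega, by omega⟩
  · rw [show Q + 1 = n b by omega]
    exact Spread.last _ _ _ _

/-- A possible swap shows a high token inside a cut and a low one outside it, a sum of at least `2`.
-/
theorem one_lt_of_spread {D : StarVertex n → StarVertex n} {B : ℕ}
    (hD : ∀ b P, P ≤ n b → Spread B b 0 D P)
    (hne : (edgesOf (SortSel D) : Set (Sym2 (StarVertex n))).Nonempty) : 1 < B := by
  obtain ⟨-, b, p, hp, ⟨h1, h2, h3⟩, -⟩ := hne
  have h4 := lowCount_lt_of_high h1 le_rfl h2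
  have h5 := lowCount_lt_of_low (show p < p + 1 by omega) (show p + 1 ≤ n b from hp) h3.le
  have := hD b p hp.le h4 h5
  omega

/-! ### The third phase -/

/-- The invariant of odd-even sorting: all tokens lie in their branch, and at most `R` further
iterations are needed. -/
structure OddEvenInv (R k : ℕ) (D : StarVertex n → StarVertex n) : Prop where
  bij : Function.Bijective D
  center_eq : D center = center
  own : ∀ b p, 0 < p → p ≤ n b → 0 < depth b (D (vx b p))
  spread : ∀ b z P, P ≤ n b → Spread (R + 1) b z D P
  spread_inactive : ∀ b z P, P ≤ n b → P % 2 ≠ k % 2 → Spread R b z D P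

theorem OddEvenInv.eq_id {D : StarVertex n → StarVertex n} {k : ℕ} (hD : OddEvenInv 0 k D) :
    D = id := by
  have key : ∀ b p, 0 < p → p ≤ n b → D (vx b p) = vx b p := by
    intro b p hp0 hp
    -- With the target of the outer token as threshold, an inversion at `q` gives a sum of at least
    -- `2` at the cut `q`, while the bound is `R + 1 = 1`.
    have hlt : ∀ q, 0 < q → q < n b → depth b (D (vx b q)) < depth b (D (vx b (q + 1))) := by
      intro q h1 h2
      by_contra h3
      have h4 : depth b (D (vx b q)) ≠ depth b (D (vx b (q + 1))) := by
        intro h4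
        have h5 : D (vx b q) = D (vx b (q + 1)) := by
          rw [← vx_depth (hD.own b q h1 h2.le), h4, vx_depth (hD.own b (q + 1) (by omega) h2)]
        have := vx_inj (n := n) h2.le h2 (hD.bij.1 h5)
        omega
      have h5 := lowCount_lt_of_high (D := D) (z := depth b (D (vx b (q + 1)))) h1 le_rfl
        (show depth b (D (vx b (q + 1))) < depth b (D (vx b q)) by omega)
      have h6 := lowCount_lt_of_low (D := D) (z := depth b (D (vx b (q + 1))))
        (show q < q + 1 by omega) (show q + 1 ≤ n b from h2) le_rfl
      have := hD.spread b _ q h2.le h5 h6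
      omega
    have hadd : ∀ d q, 0 < q → q + d ≤ n b →
        depth b (D (vx b q)) + d ≤ depth b (D (vx b (q + d))) := by
      intro d q h1
      induction d with
      | zero => intro _; simp
      | succ d ih =>
        intro h2
        have h3 := ih (by omega)
        have h4 := hlt (q + d) (by omega) (by omega)
        rw [show q + (d + 1) = q + d + 1 from rfl]
        omega
    -- Strictly increasing values that start at `1` or more and end at `n b` or less leave only the
    -- value `p` at `p`.
    have h1 := hadd (p - 1) 1 (by omega) (by omega)
    have h2 := hadd (n b - p) p hp0 (by omega)
    have h3 := hD.own b 1 (by omega) (by omega)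
    have h4 := depth_le b (D (vx b (p + (n b - p))))
    rw [show 1 + (p - 1) = p by omega] at h1
    have h5 : depth b (D (vx b p)) = p := by omega
    rw [← vx_depth (hD.own b p hp0 hp), h5]
  funext v
  rcases eq_center_or_vx v with rfl | ⟨b, p, h1, h2, rfl⟩
  · exact hD.center_eq
  · exact key b p h1 h2

/-- Both neighbours of an active cut are inactive and carry the better bound `R`, so the active cut
gets `R - 1`; inactive cuts keep `R`. Then the parities change roles. -/
theorem OddEvenInv.step {D : StarVertex n → StarVertex n} {R k : ℕ} (hD : OddEvenInv R k D)
    (hR : 0 < R) : OddEvenInv (R - 1) (k + 1) (TokenSwapping.route (oddEvenSwaps k D) D) := by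
  rw [oddEvenSwaps_eq]
  have hS := selectsMatching_oddEvenSel k D
  have h0 : ∀ b, ¬ OddEvenSel k D b 0 := fun b h1 => lt_irrefl 0 h1.1
  have hact : ∀ b z P, P ≤ n b → P % 2 = k % 2 →
      Spread (R - 1) b z (route (edgesOf (OddEvenSel k D)) D) P := by
    intro b z P hP hPk
    rcases Nat.eq_zero_or_pos P with rfl | hP0
    · exact Spread.zero _ _ _ _
    obtain ⟨Q, rfl⟩ : ∃ Q, P = Q + 1 := ⟨P - 1, by omega⟩
    rcases Nat.lt_or_ge (Q + 1) (n b) with h1 | h1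
    · refine Spread.route hS (h0 b) h1 ?_ ?_
        (hD.spread_inactive b z Q (by omega) (by omega))
        (hD.spread_inactive b z (Q + 2) (by omega) (by omega))
      · intro h2 h3
        exact h2.2.2.2.le.trans h3
      · intro h2 h3
        by_contra h4
        refine h2 ⟨by omega, hPk, hD.own b (Q + 2) (by omega) (by omega), ?_⟩
        have : depth b (D (vx b (Q + 1 + 1))) ≤ z := h3
        omega
    · rw [show Q + 1 = n b by omega]
      exact Spread.last _ _ _ _
  have hinact : ∀ b z P, P ≤ n b → P % 2 ≠ k % 2 →
      Spread R b z (route (edgesOf (OddEvenSel k D)) D) P := by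
    intro b z P hP hPk
    rcases Nat.eq_zero_or_pos P with rfl | hP0
    · exact Spread.zero _ _ _ _
    obtain ⟨Q, rfl⟩ : ∃ Q, P = Q + 1 := ⟨P - 1, by omega⟩
    have h1 := (hS.lowCount_route D b (h0 b) z Q hP).2 fun _ h1 => hPk h1.2.1
    have h2 := hS.lowCount_route_last D b (h0 b) z
    have h3 := hD.spread_inactive b z (Q + 1) hP hPk
    unfold Spread at h3 ⊢
    rwa [h1, h2]
  refine ⟨hS.isMatching.bijective_route hD.bij, ?_, ?_, ?_, ?_⟩
  · rw [route_edgesOf_center D fun b _ => h0 b, hD.center_eq]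
  · intro b p hp0 hp
    obtain ⟨s, h1, h2, h3⟩ := hS.source D hp0 hp
    rw [h2]
    refine hD.own b s ?_ h1
    rcases h3 with ⟨h3, -⟩ | ⟨h3, -⟩ | ⟨-, h3⟩
    · omega
    · omega
    · exact h3.1
  · intro b z P hP
    rw [Nat.sub_add_cancel hR]
    by_cases hPk : P % 2 = k % 2
    · exact (hact b z P hP hPk).mono (by omega)
    · exact hinact b z P hP hPk
  · intro b z P hP hPk
    exact hact b z P hP (by omega)

/-! ### The second phase -/

/-- All tokens on branch `b` belong to it. -/
def Finished (D : StarVertex n → StarVertex n) (b : Fin h) : Prop :=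
  ∀ p, 0 < p → p ≤ n b → 0 < depth b (D (vx b p))

/-- The first token of branch `b` belongs to it, although others do not. -/
def FrontOnly (D : StarVertex n → StarVertex n) (b : Fin h) : Prop :=
  0 < depth b (D (vx b 1)) ∧ ¬ Finished D b

/-- Pigeonhole: a branch full of own tokens contains all of them. -/
theorem not_finished_of_outside {D : StarVertex n → StarVertex n} (hD : Function.Injective D)
    {b : Fin h} {v : StarVertex n} (h1 : 0 < depth b (D v)) (h2 : depth b v = 0) :
    ¬ Finished D b := by
  intro hf
  have h3 : ∀ i : Fin (n b), ∃ j : Fin (n b), D (br b i) = br b j := fun i => by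
    have := hf (i.val + 1) (Nat.succ_pos _) i.isLt
    rw [← br_eq_vx] at this
    exact (InB_iff b _).2 this
  choose f hf using h3
  have hinj : Function.Injective f := fun i j hij => by
    have h4 : (br b i : StarVertex n) = br b j := hD (by rw [hf, hf, hij])
    simpa [br] using h4
  obtain ⟨j, hj⟩ := (InB_iff b _).2 h1
  obtain ⟨i, rfl⟩ := Finite.surjective_of_injective hinj j
  rw [hD (hj.trans (hf i).symm)] at h2
  simp at h2

/-- The pattern of the tokens on the branches in the second phase. -/
structure ChangeInv (D : StarVertex n → StarVertex n) : Prop where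
  inj : Function.Injective D
  spaced : ∀ b p q, 0 < p → 0 < depth b (D (vx b p)) → 0 < depth b (D (vx b (p + 1))) →
    p + 1 < q → q ≤ n b → 0 < depth b (D (vx b q))
  front : ∀ b, FrontOnly D b → depth b (D center) = 0
  uniq : ∀ b c, FrontOnly D b → FrontOnly D c → b = c

/-- When no sorting swap is left, everything beyond an own token is own; in particular a branch with
an own token in front is finished. -/
theorem changeInv_of_sorted {D : StarVertex n → StarVertex n} (hD : Function.Injective D)
    (hs : ¬ (innerSwaps D).Nonempty) : ChangeInv D := by
  have h1 : ∀ b p, 0 < p → p < n b → 0 < depth b (D (vx b p)) →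
      0 < depth b (D (vx b (p + 1))) := by
    intro b p hp0 hp h1
    by_contra h2
    rw [innerSwaps_eq] at hs
    exact hs ⟨_, b, p, hp, ⟨hp0, h1, by omega⟩, rfl⟩
  have h2 : ∀ b p d, 0 < p → p + d ≤ n b → 0 < depth b (D (vx b p)) →
      0 < depth b (D (vx b (p + d))) := by
    intro b p d hp0
    induction d with
    | zero => intro _ h2; exact h2
    | succ d ih =>
      intro h2 h3
      exact h1 b (p + d) (by omega) (by omega) (ih (by omega) h3)
  have h3 : ∀ b, ¬ FrontOnly D b := by
    rintro b ⟨h3, h4⟩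
    refine h4 fun p hp0 hp => ?_
    have := h2 b 1 (p - 1) (by omega) (by omega) h3
    rwa [show 1 + (p - 1) = p by omega] at this
  refine ⟨hD, ?_, fun b hb => absurd hb (h3 b), fun b _ hb => absurd hb (h3 b)⟩
  intro b p q hp0 h4 _ h5 h6
  have := h2 b p (q - p) hp0 (by omega) h4
  rwa [show p + (q - p) = q by omega] at this

namespace ChangeInv

variable {D : StarVertex n → StarVertex n} {b : Fin h}

/-- The branch awaiting the token on the center is not finished, so an own token at its front would
contradict `front`. Thus a delivery never pushes an own token out. -/
theorem target_front (hD : ChangeInv D) (hT : Target D b) : depth b (D (vx b 1)) = 0 := by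
  rcases hT with h1 | h1
  · exact h1.2
  · by_contra h2
    have := hD.front b ⟨by omega, not_finished_of_outside hD.inj h1 (depth_center b)⟩
    omega

theorem selectsMatching (hD : ChangeInv D) (hT : Target D b) :
    SelectsMatching n (ChangeSel D b) :=
  selectsMatching_changeSel hD.inj (hD.target_front hT) hT

theorem changeSel_zero {c : Fin h} (h0 : ChangeSel D b c 0) : c = b := by
  rcases h0 with h0 | h0 | h0
  · exact absurd h0.1 (lt_irrefl 0)
  · exact h0.2
  · exact absurd h0.2.1 (lt_irrefl 0)

theorem route_center (hD : ChangeInv D) (hT : Target D b) (hb : 0 < n b) :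
    route (edgesOf (ChangeSel D b)) D center = D (vx b 1) := by
  have := (hD.selectsMatching hT).route_inner D hb (Or.inr (Or.inl ⟨rfl, rfl⟩))
  rwa [vx_zero] at this

theorem route_front (hD : ChangeInv D) (hT : Target D b) (hb : 0 < n b) :
    route (edgesOf (ChangeSel D b)) D (vx b 1) = D center := by
  have := (hD.selectsMatching hT).route_outer D hb (Or.inr (Or.inl ⟨rfl, rfl⟩))
  rwa [vx_zero] at this

/-- Which vertices have a token of their branch after an iteration. -/
theorem own_iff (hD : ChangeInv D) (hT : Target D b) {c : Fin h} {p : ℕ} (hp0 : 0 < p)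
    (hp : p ≤ n c) (hpc : p = 1 → c ≠ b) :
    -- Apart from the front of `b`, the pattern of own tokens moves by a local rule: an own token
    -- advances exactly when the next token outward is foreign. Moving `v₀` outward swaps two
    -- foreign tokens and does not affect the pattern.
    0 < depth c (route (edgesOf (ChangeSel D b)) D (vx c p)) ↔
      (0 < depth c (D (vx c p)) ∧ (p = n c ∨ 0 < depth c (D (vx c (p + 1))))) ∨
        (depth c (D (vx c p)) = 0 ∧ 1 < p ∧ 0 < depth c (D (vx c (p - 1)))) := by
  obtain ⟨s, hs, h1, h2⟩ := (hD.selectsMatching hT).source D hp0 hp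
  rw [h1]
  rcases h2 with ⟨rfl, h2, h3⟩ | ⟨rfl, h2, h3⟩ | ⟨rfl, h2⟩
  · constructor
    · intro h4
      refine Or.inl ⟨h4, ?_⟩
      by_contra h5
      exact h2 (by omega) (Or.inl ⟨hp0, h4, by omega⟩)
    · rintro (h4 | ⟨h4, h5, h6⟩)
      · exact h4.1
      · exact absurd (Or.inl ⟨by omega, h6, by rwa [Nat.sub_add_cancel hp0]⟩) h3
  · rcases h3 with ⟨h3, h4, h5⟩ | ⟨h3, -⟩ | ⟨-, h3, h4, h5, h6⟩
    · omega
    · omega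
    · have : depth c (D (vx c p)) = 0 := by rw [h4, depth_center]
      omega
  · rw [Nat.add_sub_cancel]
    rcases h2 with ⟨h3, h4, h5⟩ | ⟨h3, h4⟩ | ⟨-, h3, h4, h5, h6⟩
    · omega
    · exact absurd h4 (hpc (by omega))
    · have : depth c (D (vx c s)) = 0 := by rw [h4, depth_center]
      omega

/-- By `spaced`, two adjacent own tokens, or one at the end, are followed by own tokens only; such a
tail is blocked and stays in place. -/
theorem own_beyond (hD : ChangeInv D) (hT : Target D b) {c : Fin h} {p : ℕ} (hp0 : 0 < p)
    (h1 : 0 < depth c (D (vx c (p + 1))))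
    (h2 : p + 1 = n c ∨ 0 < depth c (D (vx c (p + 2)))) {q : ℕ} (hpq : p + 1 ≤ q)
    (hq : q ≤ n c) : 0 < depth c (route (edgesOf (ChangeSel D b)) D (vx c q)) := by
  rw [hD.own_iff hT (by omega) hq (by omega)]
  have h3 : ∀ r, p + 1 ≤ r → r ≤ n c → 0 < depth c (D (vx c r)) := by
    intro r hr1 hr2
    rcases (by omega : r = p + 1 ∨ r = p + 2 ∨ p + 2 < r) with rfl | rfl | hr
    · exact h1
    · exact h2.resolve_left (by omega)
    · exact hD.spaced c (p + 1) r (by omega) h1 (h2.resolve_left (by omega)) hr hr2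
  refine Or.inl ⟨h3 q hpq hq, ?_⟩
  rcases (by omega : q = n c ∨ q + 1 ≤ n c) with h4 | h4
  · exact Or.inl h4
  · exact Or.inr (h3 (q + 1) (by omega) h4)

theorem own_beyond_of_not_own (hD : ChangeInv D) (hT : Target D b) {c : Fin h} {p : ℕ}
    (hp0 : 0 < p) (hp : p + 1 ≤ n c) (h0 : depth c (D (vx c p)) = 0)
    (h1 : 0 < depth c (route (edgesOf (ChangeSel D b)) D (vx c (p + 1)))) {q : ℕ}
    (hpq : p + 1 ≤ q) (hq : q ≤ n c) :
    0 < depth c (route (edgesOf (ChangeSel D b)) D (vx c q)) := by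
  rw [hD.own_iff hT (by omega) hp (by omega)] at h1
  rcases h1 with ⟨h1, h2⟩ | ⟨-, -, h2⟩
  · exact hD.own_beyond hT hp0 h1 h2 hpq hq
  · rw [Nat.add_sub_cancel] at h2
    omega

theorem finished_route (hD : ChangeInv D) (hT : Target D b) (hb : 0 < n b) {c : Fin h}
    (hc : Finished D c) : Finished (route (edgesOf (ChangeSel D b)) D) c := by
  intro p hp0 hp
  rw [hD.own_iff hT hp0 hp]
  · refine Or.inl ⟨hc p hp0 hp, ?_⟩
    rcases (by omega : p = n c ∨ p + 1 ≤ n c) with h4 | h4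
    · exact Or.inl h4
    · exact Or.inr (hc (p + 1) (by omega) h4)
  · rintro rfl rfl
    have := hc 1 hp0 hp
    have := hD.target_front hT
    omega

/-- In another branch an own front token has stayed, so its outward neighbour was own or absent. By
`spaced` the branch was and remains finished. -/
theorem eq_of_frontOnly_route (hD : ChangeInv D) (hn : ∀ b, 0 < n b) (hT : Target D b) {c : Fin h}
    (hc : FrontOnly (route (edgesOf (ChangeSel D b)) D) c) : c = b := by
  by_contra hcb
  obtain ⟨h1, h2⟩ := hc
  have h3 := (hD.own_iff hT (by omega) (hn c) fun _ => hcb).1 h1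
  obtain ⟨h3, h4⟩ := h3.resolve_right (by omega)
  refine h2 fun q hq0 hq => ?_
  rcases (by omega : q = 1 ∨ 1 < q) with rfl | hq1
  · exact h1
  · have h5 := h4.resolve_left (by omega)
    have h6 : 2 = n c ∨ 0 < depth c (D (vx c 3)) := by
      rcases (by omega : 2 = n c ∨ 3 ≤ n c) with h6 | h6
      · exact Or.inl h6
      · exact Or.inr (hD.spaced c 1 3 (by omega) h3 h5 (by omega) h6)
    exact hD.own_beyond hT (p := 1) (by omega) h5 h6 (by omega) hq

theorem route (hD : ChangeInv D) (hn : ∀ b, 0 < n b) (hT : Target D b) :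
    ChangeInv (route (edgesOf (ChangeSel D b)) D) where
  inj := by
    have : Function.Bijective D := Finite.injective_iff_bijective.1 hD.inj
    exact ((hD.selectsMatching hT).isMatching.bijective_route this).1
  spaced c p q hp0 h1 h2 hpq hq := by
    rw [hD.own_iff hT (by omega) (by omega) (by omega)] at h2
    rcases h2 with ⟨h2, h3⟩ | ⟨h2, h3, h4⟩
    · exact hD.own_beyond hT hp0 h2 h3 hpq.le hq
    · rw [Nat.add_sub_cancel] at h4
      by_cases hpc : p = 1 → c ≠ b
      · rw [hD.own_iff hT hp0 (by omega) hpc] at h1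
        omega
      · push Not at hpc
        obtain ⟨rfl, rfl⟩ := hpc
        have := hD.target_front hT
        omega
  front c hc := by
    obtain rfl := hD.eq_of_frontOnly_route hn hT hc
    rw [hD.route_center hT (hn c)]
    exact hD.target_front hT
  uniq c c' hc hc' :=
    (hD.eq_of_frontOnly_route hn hT hc).trans (hD.eq_of_frontOnly_route hn hT hc').symm

/-- At the end of the second phase all tokens are on their branches. -/
theorem finished (hD : ChangeInv D) (hfront : ∀ b, 0 < depth b (D (vx b 1))) :
    D center = center ∧ ∀ b, Finished D b := by
  -- A token other than `v₀` here would belong to an unfinished branch with an own front, against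
  -- `front`.
  have hc : D center = center := by
    refine (eq_center_or_depth_pos (D center)).resolve_right ?_
    rintro ⟨b, hb⟩
    have := hD.front b ⟨hfront b, not_finished_of_outside hD.inj hb (depth_center b)⟩
    omega
  refine ⟨hc, fun b => ?_⟩
  by_contra hb
  have hb' := hb
  unfold Finished at hb'
  push Not at hb'
  obtain ⟨p, h1, h2, h3⟩ := hb'
  rcases eq_center_or_depth_pos (D (vx b p)) with h4 | ⟨c, h4⟩
  · exact vx_ne_center h1 h2 (hD.inj (h4.trans hc.symm))
  · have hcb : c ≠ b := by rintro rfl; omega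
    have h5 := not_finished_of_outside hD.inj h4 (depth_vx_of_ne hcb.symm p)
    exact hcb (hD.uniq c b ⟨hfront c, h5⟩ ⟨hfront b, hb⟩)

theorem tracked_route (hD : ChangeInv D) (hT : Target D b) {C : StarVertex n → StarVertex n}
    (ht : Tracked C D) : Tracked C (TokenSwapping.route (edgesOf (ChangeSel D b)) D) := by
  refine ht.route (hD.selectsMatching hT) ?_ ?_
  · intro c _ h2
    obtain rfl := changeSel_zero h2
    exact hD.target_front hT
  · rintro c p hp0 _ (h2 | h2 | h2)
    · exact Or.inr h2.2.2
    · omega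
    · exact Or.inr h2.2.2.2.1

theorem misplaced_subset (hD : ChangeInv D) (hT : Target D b) :
    misplaced (TokenSwapping.route (edgesOf (ChangeSel D b)) D) ⊆ misplaced D := by
  refine (hD.selectsMatching hT).misplaced_subset ?_
  intro c _ h2
  obtain rfl := changeSel_zero h2
  exact hD.target_front hT

theorem center_not_misplaced (hD : ChangeInv D) (hT : Target D b) (hn : ∀ b, 0 < n b)
    (hc : 0 < depth b (D center)) :
    D center ∉ misplaced (TokenSwapping.route (edgesOf (ChangeSel D b)) D) := by
  rintro ⟨c, v, h1, h2, h3⟩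
  obtain rfl := depth_unique hc h2
  have := (hD.route hn hT).inj (h1.trans (hD.route_front hT (hn b)).symm)
  rw [this, depth_vx (hn b)] at h3
  omega

end ChangeInv

/-- The token of the center is on the center, or is the last foreign token of a branch, or can be
moved outward. -/
def OutwardInv (D : StarVertex n → StarVertex n) : Prop :=
  ∀ c p q, 0 < p → p < q → q ≤ n c → D (vx c p) = center → depth c (D (vx c q)) = 0 →
    depth c (D (vx c (p + 1))) = 0 ∧ depth c (D (vx c (p - 1))) = 0

/-- The condition is created when `v₀` leaves the center. Later, if foreign tokens lie beyond `v₀`,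
it can move outward and does so; it stays or moves inward only when everything beyond it is own. -/
theorem OutwardInv.route {D : StarVertex n → StarVertex n} {b : Fin h} (hD : ChangeInv D)
    (hn : ∀ b, 0 < n b) (hT : Target D b) (hV : D center = center ∨ OutwardInv D) :
    OutwardInv (route (edgesOf (ChangeSel D b)) D) := by
  intro c p q hp0 hpq hq h1 h2
  have hS := hD.selectsMatching hT
  have hcen : ∀ s, 0 < s → s ≤ n c → D (vx c s) = center → D center ≠ center := by
    intro s hs0 hs h3 h4
    exact vx_ne_center hs0 hs (hD.inj (h3.trans h4.symm))
  have hown : ∀ s, 0 < s → s < q → (∀ r, s < r → r ≤ n c → 0 < depth c (D (vx c r))) → False := by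
    intro s hs0 hsq hs
    have h3 : 0 < depth c (TokenSwapping.route (edgesOf (ChangeSel D b)) D (vx c q)) := by
      rw [hD.own_iff hT (by omega) hq (by omega)]
      refine Or.inl ⟨hs q hsq hq, ?_⟩
      rcases (by omega : q = n c ∨ q + 1 ≤ n c) with h4 | h4
      · exact Or.inl h4
      · exact Or.inr (hs (q + 1) (by omega) h4)
    omega
  obtain ⟨s, hs, h3, h4⟩ := hS.source D hp0 (by omega : p ≤ n c)
  rw [h3] at h1
  rcases h4 with ⟨rfl, h4, h5⟩ | ⟨rfl, h4, h5⟩ | ⟨rfl, h4⟩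
  · have hcc := hcen s hp0 hs h1
    refine (hown s hp0 hpq fun r hr1 hr2 => ?_).elim
    by_contra h6
    obtain ⟨h7, h8⟩ := hV.resolve_left hcc c s r hp0 hr1 hr2 h1 (by omega)
    exact h4 (by omega) (Or.inr (Or.inr ⟨hcc, hp0, h1, h7, h8⟩))
  · have hcc := hcen (p + 1) (by omega) hs h1
    have hsort : 0 < depth c (D (vx c p)) := by
      rcases h5 with h5 | h5 | h5
      · exact h5.2.1
      · omega
      · have := vx_inj (n := n) hs h4.le (hD.inj (h1.trans h5.2.2.1.symm))
        omega
    rcases (by omega : q = p + 1 ∨ p + 1 < q) with rfl | hq1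
    · rw [hS.route_outer D h4 h5] at h2
      omega
    · refine (hown (p + 1) (by omega) hq1 fun r hr1 hr2 => ?_).elim
      by_contra h6
      obtain ⟨-, h8⟩ := hV.resolve_left hcc c (p + 1) r (by omega) hr1 hr2 h1 (by omega)
      rw [Nat.add_sub_cancel] at h8
      omega
  -- `v₀` has moved outward, from the center or inside the branch. An own token directly beyond it
  -- would now begin an entirely own tail, contradicting the foreign token at `q`.
  · rcases Nat.eq_zero_or_pos s with rfl | hs0
    · obtain rfl := ChangeInv.changeSel_zero h4
      have h5 := hD.target_front hT
      constructor
      · by_contra h6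
        have := hD.own_beyond_of_not_own hT (p := 1) (by omega) (by omega) h5
          (Nat.pos_of_ne_zero h6) (by omega) hq
        omega
      · rw [Nat.add_sub_cancel, vx_zero, hD.route_center hT (hn c)]
        exact h5
    · have h5 : KeepSel D c s := by
        rcases h4 with h4 | h4 | h4
        · have := h4.2.1
          rw [h1, depth_center] at this
          omega
        · omega
        · exact h4.2
      constructor
      · by_contra h6
        have := hD.own_beyond_of_not_own hT (p := s + 1) (by omega) (by omega) h5.2.2.1 (by omega)
          (by omega) hq
        omega
      · rw [Nat.add_sub_cancel, hS.route_inner D (by omega) h4]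
        exact h5.2.2.1

open Classical in
/-- The invariant of the second phase, with a bound `R` on the number of iterations of the second
and third phases: `e` counts the iterations that found the token of the center on the center, and
`m` the misplaced tokens at the beginning. -/
def ChangeBound (L R : ℕ) (D : StarVertex n → StarVertex n) : Prop :=
  ∃ e m, m ≤ L ∧ e ≤ m ∧ e ≤ h ∧
    e + (misplaced D).ncard ≤ m + (if D center = center then 0 else 1) ∧
    (e = 0 ∨ OutwardInv D ∧
      e ≤ {c | Finished D c}.ncard + (if D center = center then 0 else 1)) ∧
    (misplaced D).ncard + (min L h - e) + (2 * L + 1) ≤ R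

theorem ncard_finished_lt {D : StarVertex n → StarVertex n} {b : Fin h} (hb : ¬ Finished D b) :
    {c | Finished D c}.ncard < h := by
  have := Set.ncard_lt_card (s := {c | Finished D c}) (fun h1 => hb (by
    have : b ∈ {c | Finished D c} := by rw [h1]; trivial
    exact this))
  rwa [Nat.card_fin] at this

/-- With `v₀` on the center, `e` grows and the misplaced tokens do not increase; otherwise a
misplaced token is delivered. Either way the sum in `ChangeBound` drops. -/
theorem ChangeBound.step {D : StarVertex n → StarVertex n} {b : Fin h} {L R : ℕ}
    (hB : ChangeBound L R D) (hD : ChangeInv D) (hn : ∀ b, 0 < n b) (hT : Target D b) :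
    ∃ R', ChangeBound L R' (route (edgesOf (ChangeSel D b)) D) ∧ R' + 1 ≤ R := by
  obtain ⟨e, m, hm, hem, heh, h1, h2, h3⟩ := hB
  set D' := TokenSwapping.route (edgesOf (ChangeSel D b)) D with hD'
  have hsub := hD.misplaced_subset hT
  have hle : (misplaced D').ncard ≤ (misplaced D).ncard :=
    Set.ncard_le_ncard hsub (Set.toFinite _)
  have hfront := hD.target_front hT
  have hcen' : D' center = D (vx b 1) := hD.route_center hT (hn b)
  have hb : ¬ Finished D b := fun hb => by
    have := hb 1 one_pos (hn b)
    omega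
  have hlt := ncard_finished_lt hb
  have hfin : {c | Finished D c} ⊆ {c | Finished D' c} := fun c hc =>
    hD.finished_route hT (hn b) hc
  have hfle := Set.ncard_le_ncard hfin (Set.toFinite _)
  by_cases hc : D center = center
  · have hc' : D' center ≠ center := by
      rw [hcen']
      intro h4
      exact vx_ne_center one_pos (hn b) (hD.inj (h4.trans hc.symm))
    rw [if_pos hc] at h1 h2
    have hef : e ≤ {c | Finished D c}.ncard := by
      rcases h2 with h2 | h2
      · omega
      · exact h2.2
    -- The token that replaces `v₀` on the center is itself misplaced, which keeps `e + 1 ≤ m`.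
    have hpos : 0 < (misplaced D').ncard := by
      rw [Set.ncard_pos (Set.toFinite _)]
      obtain ⟨c, h4⟩ := (eq_center_or_depth_pos (D' center)).resolve_left hc'
      exact ⟨D' center, c, center, rfl, h4, depth_center c⟩
    refine ⟨_, ⟨e + 1, m, hm, by omega, by omega, by rw [if_neg hc']; omega, Or.inr ⟨?_, ?_⟩,
      le_rfl⟩, by omega⟩
    · exact OutwardInv.route hD hn hT (Or.inl hc)
    · rw [if_neg hc']
      omega
  · have hpos : 0 < depth b (D center) := hT.resolve_left fun h4 => hc h4.1
    rw [if_neg hc] at h1 h2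
    have hlt' : (misplaced D').ncard < (misplaced D).ncard := by
      refine Set.ncard_lt_ncard (hsub.ssubset_of_ne fun h4 => ?_) (Set.toFinite _)
      have h5 := hD.center_not_misplaced hT hn hpos
      rw [← hD', h4] at h5
      exact h5 ⟨b, center, rfl, hpos, depth_center b⟩
    refine ⟨_, ⟨e, m, hm, hem, heh, by split_ifs <;> omega, ?_, le_rfl⟩, by omega⟩
    rcases h2 with h2 | ⟨h2, h4⟩
    · exact Or.inl h2
    · refine Or.inr ⟨OutwardInv.route hD hn hT (Or.inr h2), ?_⟩
      by_cases hc' : D' center = center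
      · rw [if_pos hc']
        rw [hcen'] at hc'
        -- `v₀` returns from the front of `b` while a token of `b` enters. A foreign token farther
        -- out would, by `OutwardInv`, require the token on the center not to belong to `b`.
        have hb' : Finished D' b := by
          intro p hp0 hp
          rcases (by omega : p = 1 ∨ 1 < p) with rfl | hp1
          · rw [hD', hD.route_front hT (hn b)]
            exact hpos
          · have hown : ∀ r, 1 < r → r ≤ n b → 0 < depth b (D (vx b r)) := by
              intro r hr1 hr2
              by_contra h5
              obtain ⟨-, h6⟩ := h2 b 1 r one_pos hr1 hr2 hc' (by omega)
              rw [Nat.sub_self, vx_zero] at h6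
              omega
            rw [hD', hD.own_iff hT hp0 hp (by omega)]
            refine Or.inl ⟨hown p hp1 hp, ?_⟩
            rcases (by omega : p = n b ∨ p + 1 ≤ n b) with h5 | h5
            · exact Or.inl h5
            · exact Or.inr (hown (p + 1) (by omega) h5)
        have : {c | Finished D c}.ncard < {c | Finished D' c}.ncard := by
          refine Set.ncard_lt_ncard (hfin.ssubset_of_ne fun h5 => hb ?_) (Set.toFinite _)
          have h6 : b ∈ {c | Finished D' c} := hb'
          rw [← h5] at h6
          exact h6
        omega
      · rw [if_neg hc']
        omega

/-! ### Executions of the algorithm -/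

/-- The current configuration. -/
def AlgState.config : AlgState n → (StarVertex n → StarVertex n)
  | .phase1 D => D
  | .phase2 D => D
  | .phase3 _ D => D

/-- The invariant of the algorithm started on `C`; at most `R` further matchings are output. -/
def AlgInv (L : ℕ) (C : StarVertex n → StarVertex n) (R : ℕ) : AlgState n → Prop
  | .phase1 D => Tracked C D ∧ (misplaced D).ncard ≤ L ∧
      ∃ B, (∀ b P, P ≤ n b → Spread B b 0 D P) ∧ B + (L + min L h + (2 * L + 1)) ≤ R
  | .phase2 D => Tracked C D ∧ ChangeInv D ∧ ChangeBound L R D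
  | .phase3 k D => OddEvenInv R k D

theorem routeAll_append (Ms Ns : List (Set (Sym2 (StarVertex n))))
    (C : StarVertex n → StarVertex n) : routeAll (Ms ++ Ns) C = routeAll Ns (routeAll Ms C) :=
  List.foldl_append

/-- The budget is `L` for sorting, `L + min L h` for the second phase and `2L + 1` for odd-even
sorting. -/
theorem AlgInv.initial {C : StarVertex n → StarVertex n} {L : ℕ} (hC : Function.Bijective C)
    (hL : LowerBound L C) : AlgInv L C (4 * L + min L h + 1) (.phase1 C) :=
  ⟨Tracked.refl hC, hL.misplaced_le, L, fun b P _ => spread_initial hL b P, by omega⟩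

theorem AlgInv.step {C : StarVertex n → StarVertex n} {L : ℕ} (hn : ∀ b, 0 < n b)
    (hC : Function.Bijective C) (hL : LowerBound L C) {R : ℕ} {s s' : AlgState n}
    {out : List (Set (Sym2 (StarVertex n)))} (hs : AlgInv L C R s) (hstep : Step s out s') :
    (∀ M ∈ out, IsMatching (starGraph n) M) ∧ s'.config = routeAll out s.config ∧
      ∃ R', AlgInv L C R' s' ∧ out.length + R' ≤ R := by
  cases hstep with
  | sortBranches D hne =>
    obtain ⟨h1, h2, B, h3, h4⟩ := hs
    have hS := selectsMatching_sortSel D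
    rw [innerSwaps_eq] at hne ⊢
    have h5 := one_lt_of_spread h3 hne
    have hcen : ∀ b, 0 < n b → SortSel D b 0 → depth b (D (vx b 1)) = 0 :=
      fun b _ h6 => absurd h6.1 (lt_irrefl 0)
    refine ⟨?_, rfl, R - 1, ⟨?_, ?_, B - 1, ?_, by omega⟩, by
      simp only [List.length_singleton]; omega⟩
    · simpa using hS.isMatching
    · exact h1.route hS hcen fun b p _ _ h6 => Or.inr h6.2.2
    · exact (Set.ncard_le_ncard (hS.misplaced_subset hcen) (Set.toFinite _)).trans h2
    · exact fun b P hP => spread_sort (h3 b) hP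
  | toPhase2 D hD =>
    obtain ⟨h1, h2, B, h3, h4⟩ := hs
    refine ⟨by simp, rfl, R, ⟨h1, changeInv_of_sorted h1.bij.1 hD, 0, (misplaced D).ncard,
      h2, by omega, by omega, by omega, Or.inl rfl, by omega⟩, by simp⟩
  | changeBranches D M hD hM =>
    obtain ⟨h1, h2, h3⟩ := hs
    obtain ⟨b, hT, rfl⟩ := (phase2Swaps_iff hn D M).1 hM
    obtain ⟨R', h4, h5⟩ := h3.step h2 hn hT
    refine ⟨?_, rfl, R', ⟨h2.tracked_route hT h1, h2.route hn hT, h4⟩, by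
      simp only [List.length_singleton]; omega⟩
    simpa using (h2.selectsMatching hT).isMatching
  | toPhase3 D hD =>
    obtain ⟨h1, h2, h3⟩ := hs
    have h4 : ∀ b, 0 < depth b (D (vx b 1)) := by
      intro b
      by_contra h4
      exact hD ⟨b, (unfinished_iff hn D b).2 (by omega)⟩
    obtain ⟨h5, h6⟩ := h2.finished h4
    obtain ⟨e, m, -, -, -, -, -, h7⟩ := h3
    refine ⟨by simp, rfl, 2 * L + 1, ⟨h1.bij, h5, h6, ?_, ?_⟩, by
      simp only [List.length_nil]; omega⟩
    · exact fun b z P hP => (h1.spread hC hL (h6 b) z hP).mono (by omega)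
    · exact fun b z P hP _ => h1.spread hC hL (h6 b) z hP
  | oddEven k D hD =>
    have hR : 0 < R := by
      rcases Nat.eq_zero_or_pos R with rfl | hR
      · exact absurd (OddEvenInv.eq_id hs) hD
      · exact hR
    refine ⟨?_, rfl, R - 1, OddEvenInv.step hs hR, by simp only [List.length_singleton]; omega⟩
    rw [oddEvenSwaps_eq]
    simpa using (selectsMatching_oddEvenSel k D).isMatching

theorem AlgInv.run {C : StarVertex n → StarVertex n} {L : ℕ} (hn : ∀ b, 0 < n b)
    (hC : Function.Bijective C) (hL : LowerBound L C) {s s' : AlgState n}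
    {Ms : List (Set (Sym2 (StarVertex n)))} (hrun : Run s Ms s') :
    ∀ {R : ℕ}, AlgInv L C R s →
      (∀ M ∈ Ms, IsMatching (starGraph n) M) ∧ s'.config = routeAll Ms s.config ∧
        ∃ R', AlgInv L C R' s' ∧ Ms.length + R' ≤ R := by
  induction hrun with
  | nil s => exact fun {R} hs => ⟨by simp, rfl, R, hs, by simp⟩
  | @cons s s' s'' out Ms hstep _ ih =>
    intro R hs
    obtain ⟨h1, h2, R', h3, h4⟩ := hs.step hn hC hL hstep
    obtain ⟨h5, h6, R'', h7, h8⟩ := ih h3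
    refine ⟨?_, ?_, R'', h7, by rw [List.length_append]; omega⟩
    · intro M hM
      rcases List.mem_append.1 hM with hM | hM
      · exact h1 M hM
      · exact h5 M hM
    · rw [h6, h2, routeAll_append]

/-- An execution can only end in the third phase, with the target configuration. -/
theorem config_eq_id_of_halted (hn : ∀ b, 0 < n b) {s : AlgState n} (hs : Halted s) :
    s.config = id := by
  cases s with
  | phase1 D =>
    by_cases h1 : (innerSwaps D).Nonempty
    · exact absurd (Step.sortBranches D h1) (hs _ _)
    · exact absurd (Step.toPhase2 D h1) (hs _ _)
  | phase2 D =>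
    by_cases h1 : ∃ b, Unfinished D b
    · have h2 : ∃ b, Target D b := by
        obtain ⟨b, hb⟩ := h1
        rcases eq_center_or_depth_pos (D center) with h2 | ⟨c, h2⟩
        · exact ⟨b, Or.inl ⟨h2, (unfinished_iff hn D b).1 hb⟩⟩
        · exact ⟨c, Or.inr h2⟩
      obtain ⟨b, hb⟩ := h2
      exact absurd (Step.changeBranches D _ h1 ((phase2Swaps_iff hn D _).2 ⟨b, hb, rfl⟩)) (hs _ _)
    · exact absurd (Step.toPhase3 D h1) (hs _ _)
  | phase3 k D =>
    by_contra h1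
    exact hs _ _ (Step.oddEven k D h1)

theorem isSolution_of_isOutput (hn : ∀ b, 0 < n b) {C : StarVertex n → StarVertex n}
    (hC : Function.Bijective C) {Ms : List (Set (Sym2 (StarVertex n)))} (hMs : IsOutput C Ms) :
    IsSolution (starGraph n) C Ms := by
  obtain ⟨s, hrun, hs⟩ := hMs
  have hL := lowerBound_numVertices C
  obtain ⟨h1, h2, -⟩ := AlgInv.run hn hC hL hrun (AlgInv.initial hC hL)
  exact ⟨h1, h2.symm.trans (config_eq_id_of_halted hn hs)⟩

/-- Unfinished runs are included. Since only two steps output nothing, this also bounds every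
execution, whatever choices are made. -/
theorem length_le_of_run (hn : ∀ b, 0 < n b) {C : StarVertex n → StarVertex n}
    (hC : Function.Bijective C) (hout : ∃ Ms, IsOutput C Ms)
    {Ms : List (Set (Sym2 (StarVertex n)))} {s : AlgState n} (hrun : Run (.phase1 C) Ms s) :
    Ms.length ≤ 4 * OPT (starGraph n) C + min (OPT (starGraph n) C) h + 1 := by
  obtain ⟨Ns, hNs⟩ := hout
  have hL := lowerBound_OPT ⟨Ns, isSolution_of_isOutput hn hC hNs⟩
  obtain ⟨-, -, R', -, h1⟩ := AlgInv.run hn hC hL hrun (AlgInv.initial hC hL)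
  omega

end Star

/-! ### Reasoning about programs -/

/-- The program `p` started in `σ` halts within `T` steps in a memory satisfying `Q`. -/
def Runs (p : Prog) (σ : Mem) (T : ℕ) (Q : Mem → Prop) : Prop :=
  ∃ t σ', Exec p σ t σ' ∧ t ≤ T ∧ Q σ'

theorem Runs.mono {p : Prog} {σ : Mem} {T T' : ℕ} {Q Q' : Mem → Prop} (hp : Runs p σ T Q)
    (hT : T ≤ T') (hQ : ∀ σ', Q σ' → Q' σ') : Runs p σ T' Q' := by
  obtain ⟨t, σ', h1, h2, h3⟩ := hp
  exact ⟨t, σ', h1, h2.trans hT, hQ σ' h3⟩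

theorem Runs.seq {p q : Prog} {σ : Mem} {T U : ℕ} {Q Q' : Mem → Prop} (hp : Runs p σ T Q)
    (hq : ∀ σ', Q σ' → Runs q σ' U Q') : Runs (.seq p q) σ (T + U) Q' := by
  obtain ⟨t, σ', h1, h2, h3⟩ := hp
  obtain ⟨u, σ'', h4, h5, h6⟩ := hq σ' h3
  exact ⟨t + u, σ'', h1.seq h4, Nat.add_le_add h2 h5, h6⟩

theorem Runs.ite {e : Expr} {p q : Prog} {σ : Mem} {T : ℕ} {Q : Mem → Prop}
    (hp : e.eval σ ≠ 0 → Runs p σ T Q) (hq : e.eval σ = 0 → Runs q σ T Q) :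
    Runs (.ite e p q) σ (1 + e.cost + T) Q := by
  by_cases he : e.eval σ = 0
  · obtain ⟨t, σ', h1, h2, h3⟩ := hq he
    exact ⟨_, σ', Exec.iteFalse he h1, by omega, h3⟩
  · obtain ⟨t, σ', h1, h2, h3⟩ := hp he
    exact ⟨_, σ', Exec.iteTrue he h1, by omega, h3⟩

/-- The fuel `i` bounds the remaining iterations and may drop by more than one; the last summand
pays for the final test. -/
theorem Runs.loop_of_fuel {e : Expr} {p : Prog} {T : ℕ} {Q : Mem → Prop} {I : ℕ → Mem → Prop}
    (hI : ∀ i σ, I i σ →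
      (e.eval σ = 0 ∧ Q σ) ∨ (e.eval σ ≠ 0 ∧ 0 < i ∧ Runs p σ T fun σ' => ∃ j < i, I j σ')) :
    ∀ i σ, I i σ → Runs (.loop e p) σ (i * (1 + e.cost + T) + (1 + e.cost)) Q := by
  intro i
  induction i using Nat.strong_induction_on with
  | _ i ih =>
    intro σ hσ
    rcases hI i σ hσ with ⟨h1, h2⟩ | ⟨h1, h2, t, σ', h3, h4, j, hj, h5⟩
    · exact ⟨_, σ, Exec.loopFalse h1, by omega, h2⟩
    · obtain ⟨u, σ'', h6, h7, h8⟩ := ih j hj σ' h5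
      refine ⟨_, σ'', Exec.loopTrue h1 h3 h6, ?_, h8⟩
      have : (j + 1) * (1 + e.cost + T) ≤ i * (1 + e.cost + T) := Nat.mul_le_mul_right _ hj
      rw [Nat.add_mul, Nat.one_mul] at this
      omega

theorem Runs.loop_count {e : Expr} {p : Prog} {T k : ℕ} {I : ℕ → Mem → Prop}
    (hI : ∀ i < k, ∀ σ, I i σ → e.eval σ ≠ 0 ∧ Runs p σ T (I (i + 1)))
    (hk : ∀ σ, I k σ → e.eval σ = 0) {σ : Mem} (hσ : I 0 σ) :
    Runs (.loop e p) σ (k * (1 + e.cost + T) + (1 + e.cost)) (I k) := by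
  refine Runs.loop_of_fuel (I := fun j σ => j ≤ k ∧ I (k - j) σ) ?_ k σ ⟨le_rfl, by simpa using hσ⟩
  rintro j τ ⟨h1, h2⟩
  rcases Nat.eq_zero_or_pos j with rfl | hj
  · exact Or.inl ⟨hk τ h2, h2⟩
  · obtain ⟨h3, h4⟩ := hI (k - j) (by omega) τ h2
    refine Or.inr ⟨h3, hj, h4.mono le_rfl fun τ' h5 => ⟨j - 1, by omega, by omega, ?_⟩⟩
    rwa [show k - (j - 1) = k - j + 1 by omega]

namespace Prog

/-- Whether the program has no loop. -/
def loopFree : Prog → Bool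
  | skip => true
  | set _ _ => true
  | store _ _ _ => true
  | seq p q => p.loopFree && q.loopFree
  | ite _ p q => p.loopFree && q.loopFree
  | loop _ _ => false

/-- The effect of a program without loops. -/
def effect : Prog → Mem → Mem
  | skip, σ => σ
  | set r e, σ => { σ with reg := Function.update σ.reg r (e.eval σ) }
  | store a e f, σ =>
      { σ with arr := Function.update σ.arr a (Function.update (σ.arr a) (e.eval σ) (f.eval σ)) }
  | seq p q, σ => q.effect (p.effect σ)
  | ite e p q, σ => if e.eval σ = 0 then q.effect σ else p.effect σ
  | loop _ _, σ => σ

/-- A bound on the running time of a program without loops. -/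
def time : Prog → ℕ
  | skip => 1
  | set _ e => 1 + e.cost
  | store _ e f => 1 + e.cost + f.cost
  | seq p q => p.time + q.time
  | ite e p q => 1 + e.cost + (p.time + q.time)
  | loop _ _ => 0

/-- Reduces statements about loop-free fragments to computing a function on memories. -/
theorem exec_effect {p : Prog} (hp : p.loopFree = true) (σ : Mem) :
    ∃ t, Exec p σ t (p.effect σ) ∧ t ≤ p.time := by
  induction p generalizing σ with
  | skip => exact ⟨1, Exec.skip σ, le_rfl⟩
  | set r e => exact ⟨_, Exec.set σ r e, le_rfl⟩
  | store a e f => exact ⟨_, Exec.store σ a e f, le_rfl⟩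
  | seq p q ihp ihq =>
    simp only [loopFree, Bool.and_eq_true] at hp
    obtain ⟨t, h1, h2⟩ := ihp hp.1 σ
    obtain ⟨u, h3, h4⟩ := ihq hp.2 (p.effect σ)
    exact ⟨_, h1.seq h3, Nat.add_le_add h2 h4⟩
  | ite e p q ihp ihq =>
    simp only [loopFree, Bool.and_eq_true] at hp
    by_cases he : e.eval σ = 0
    · obtain ⟨t, h1, h2⟩ := ihq hp.2 σ
      refine ⟨_, ?_, (by simp only [time]; omega : 1 + e.cost + t ≤ _)⟩
      rw [effect, if_pos he]
      exact Exec.iteFalse he h1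
    · obtain ⟨t, h1, h2⟩ := ihp hp.1 σ
      refine ⟨_, ?_, (by simp only [time]; omega : 1 + e.cost + t ≤ _)⟩
      rw [effect, if_neg he]
      exact Exec.iteTrue he h1
  | loop e p _ => exact absurd hp (by simp [loopFree])

end Prog

theorem Runs.of_effect {p : Prog} (hp : p.loopFree = true) {σ : Mem} {Q : Mem → Prop}
    (hQ : Q (p.effect σ)) : Runs p σ p.time Q := by
  obtain ⟨t, h1, h2⟩ := Prog.exec_effect hp σ
  exact ⟨t, _, h1, h2, hQ⟩

namespace Expr

/-- Negation of conditions. -/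
def neg (e : Expr) : Expr := .eq e (.lit 0)

/-- Conjunction of conditions. -/
def conj (e f : Expr) : Expr := .eq (.add (.eq e (.lit 0)) (.eq f (.lit 0))) (.lit 0)

/-- The condition `e` holds. -/
def Holds (σ : Mem) (e : Expr) : Prop := e.eval σ ≠ 0

@[simp] theorem holds_neg (σ : Mem) (e : Expr) : (neg e).Holds σ ↔ ¬ e.Holds σ := by
  by_cases he : e.eval σ = 0 <;> simp [Holds, neg, eval, he]

@[simp] theorem holds_conj (σ : Mem) (e f : Expr) :
    (conj e f).Holds σ ↔ e.Holds σ ∧ f.Holds σ := by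
  by_cases he : e.eval σ = 0 <;> by_cases hf : f.eval σ = 0 <;> simp [Holds, conj, eval, he, hf]

@[simp] theorem holds_add (σ : Mem) (e f : Expr) :
    (add e f).Holds σ ↔ e.Holds σ ∨ f.Holds σ := by
  simp [Holds, eval]
  tauto

@[simp] theorem holds_lt (σ : Mem) (e f : Expr) :
    (lt e f).Holds σ ↔ e.eval σ < f.eval σ := by
  simp [Holds, eval]

@[simp] theorem holds_eq (σ : Mem) (e f : Expr) :
    (eq e f).Holds σ ↔ e.eval σ = f.eval σ := by
  simp [Holds, eval]

@[simp] theorem holds_reg (σ : Mem) (r : ℕ) : (reg r).Holds σ ↔ σ.reg r ≠ 0 := Iff.rfl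

end Expr

section Star

variable {h : ℕ} {n : Fin h → ℕ}

/-! ### Vertex numbers -/

variable (n) in
/-- The number of vertices in the first `k` branches. -/
def offset (k : ℕ) : ℕ := ∑ c ∈ Finset.univ.filter fun c : Fin h => c.val < k, n c

theorem offset_zero : offset n 0 = 0 := by simp [offset]

theorem offset_succ (b : Fin h) : offset n (b.val + 1) = offset n b.val + n b := by
  have : (Finset.univ.filter fun c : Fin h => c.val < b.val + 1) =
      insert b (Finset.univ.filter fun c : Fin h => c.val < b.val) := by
    ext c
    simp only [Finset.mem_filter, Finset.mem_univ, true_and, Finset.mem_insert, Fin.ext_iff]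
    omega
  rw [offset, this, Finset.sum_insert (by simp), add_comm]
  rfl

theorem offset_last : 1 + offset n h = numVertices n := by
  simp [offset, numVertices]

theorem offset_mono {k l : ℕ} (hkl : k ≤ l) : offset n k ≤ offset n l := by
  refine Finset.sum_le_sum_of_subset fun c => ?_
  simp only [Finset.mem_filter, Finset.mem_univ, true_and]
  omega

theorem code_center : code (center : StarVertex n) = 0 := rfl

theorem code_vx_succ {b : Fin h} {p : ℕ} (hp : p < n b) :
    code (vx b (p + 1) : StarVertex n) = 1 + offset n b.val + p := by
  have : (vx b (p + 1) : StarVertex n) = br b ⟨p, hp⟩ := (br_eq_vx b ⟨p, hp⟩).symm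
  rw [this, offset]
  change 1 + ∑ c ∈ Finset.Iio b, n c + p = _
  simp only [add_left_inj, add_right_inj]
  refine Finset.sum_congr ?_ fun _ _ => rfl
  ext c
  simp only [Finset.mem_Iio, Finset.mem_filter, Finset.mem_univ, true_and]
  exact Fin.lt_def

theorem code_vx {b : Fin h} {p : ℕ} (hp0 : 0 < p) (hp : p ≤ n b) :
    code (vx b p : StarVertex n) = offset n b.val + p := by
  obtain ⟨q, rfl⟩ : ∃ q, p = q + 1 := ⟨p - 1, by omega⟩
  rw [code_vx_succ hp]
  omega

theorem code_eq_zero {v : StarVertex n} : code v = 0 ↔ v = center := by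
  constructor
  · intro hv
    rcases eq_center_or_vx v with h1 | ⟨b, p, h1, h2, rfl⟩
    · exact h1
    · rw [code_vx h1 h2] at hv
      omega
  · rintro rfl
    rfl

theorem code_injective : Function.Injective (code : StarVertex n → ℕ) := by
  intro v w hvw
  rcases eq_center_or_vx w with rfl | ⟨c, q, h3, h4, rfl⟩
  · rw [code_center] at hvw
    exact code_eq_zero.1 hvw
  rcases eq_center_or_vx v with rfl | ⟨b, p, h1, h2, rfl⟩
  · rw [code_center] at hvw
    exact (code_eq_zero.1 hvw.symm).symm
  rw [code_vx h1 h2, code_vx h3 h4] at hvw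
  have h5 := offset_succ (n := n) b
  have h6 := offset_succ (n := n) c
  have hbc : b = c := by
    rcases lt_trichotomy b c with h7 | h7 | h7
    · have := offset_mono (n := n) (show b.val + 1 ≤ c.val from h7)
      omega
    · exact h7
    · have := offset_mono (n := n) (show c.val + 1 ≤ b.val from h7)
      omega
  subst hbc
  rw [show p = q by omega]

theorem code_lt (v : StarVertex n) : code v < numVertices n := by
  rw [← offset_last]
  rcases eq_center_or_vx v with rfl | ⟨b, p, h1, h2, rfl⟩
  · rw [code_center]
    omega
  · rw [code_vx h1 h2]
    have h5 := offset_succ (n := n) b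
    have := offset_mono (n := n) (show b.val + 1 ≤ h from b.isLt)
    omega

theorem exists_code_eq {x : ℕ} (hx0 : 0 < x) (hx : x < numVertices n) :
    ∃ b p, p < n b ∧ x = code (vx b (p + 1) : StarVertex n) := by
  let f : StarVertex n → Fin (numVertices n) := fun v => ⟨code v, code_lt v⟩
  have hf : Function.Bijective f := by
    rw [Fintype.bijective_iff_injective_and_card]
    refine ⟨fun v w hvw => code_injective (Fin.ext_iff.1 hvw), ?_⟩
    rw [Fintype.card_fin, ← Nat.card_eq_fintype_card, card_starVertex]
  obtain ⟨v, hv⟩ := hf.2 ⟨x, hx⟩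
  have hv : code v = x := Fin.ext_iff.1 hv
  rcases eq_center_or_vx v with rfl | ⟨b, p, h1, h2, rfl⟩
  · rw [code_center] at hv
    omega
  · obtain ⟨q, rfl⟩ : ∃ q, p = q + 1 := ⟨p - 1, by omega⟩
    exact ⟨b, q, h2, hv.symm⟩

/-- The number of the branch of a vertex, counted from `1`, and `0` for the center. -/
def branchNo : StarVertex n → ℕ
  | none => 0
  | some ⟨b, _⟩ => b.val + 1

theorem branchNo_vx_succ {b : Fin h} {p : ℕ} (hp : p < n b) :
    branchNo (vx b (p + 1) : StarVertex n) = b.val + 1 := by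
  have : (vx b (p + 1) : StarVertex n) = br b ⟨p, hp⟩ := (br_eq_vx b ⟨p, hp⟩).symm
  rw [this]
  rfl

theorem branchNo_eq_iff (b : Fin h) (v : StarVertex n) :
    branchNo v = b.val + 1 ↔ 0 < depth b v := by
  rcases eq_center_or_vx v with rfl | ⟨c, p, h1, h2, rfl⟩
  · simp [branchNo, center, depth]
  · obtain ⟨q, rfl⟩ : ∃ q, p = q + 1 := ⟨p - 1, by omega⟩
    rw [branchNo_vx_succ h2]
    by_cases hcb : c = b
    · subst hcb
      rw [depth_vx h2]
      simp
    · rw [depth_vx_of_ne hcb]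
      simpa [Fin.ext_iff] using hcb

/-! ### The output in memory -/

/-- The first `m` entries of the arrays `a`, `u`, `w` list the swaps of the matchings `Ms`. -/
structure Lists (Ms : List (Set (Sym2 (StarVertex n)))) (m : ℕ) (a u w : ℕ → ℕ) : Prop where
  sound : ∀ q < m, ∃ j M v v', Ms[j]? = some M ∧ s(v, v') ∈ M ∧ a q = j ∧ u q = code v ∧
    w q = code v'
  complete : ∀ j M, Ms[j]? = some M → ∀ e ∈ M, ∃ q < m, ∃ v v' : StarVertex n, e = s(v, v') ∧
    a q = j ∧ u q = code v ∧ w q = code v'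

theorem holdsOutput_of_lists {Ms : List (Set (Sym2 (StarVertex n)))} {σ : Mem}
    (h0 : σ.reg 0 = Ms.length) (h1 : Lists Ms (σ.reg 1) (σ.arr 2) (σ.arr 3) (σ.arr 4)) :
    HoldsOutput Ms σ := by
  refine ⟨h0, fun q hq => ?_, fun j e he => ?_⟩
  · obtain ⟨j, M, v, v', h2, h3, h4⟩ := h1.sound q hq
    obtain ⟨h5, rfl⟩ := List.getElem?_eq_some_iff.1 h2
    exact ⟨⟨j, h5⟩, v, v', h3, h4⟩
  · exact h1.complete j.val (Ms.get j) (by simp) e he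

theorem lists_nil (a u w : ℕ → ℕ) : Lists (n := n) [] 0 a u w :=
  ⟨fun q hq => absurd hq (Nat.not_lt_zero q), fun j M hj => by simp at hj⟩

theorem Lists.append_empty {Ms : List (Set (Sym2 (StarVertex n)))} {m : ℕ} {a u w : ℕ → ℕ}
    (hL : Lists Ms m a u w) : Lists (Ms ++ [∅]) m a u w := by
  constructor
  · intro q hq
    obtain ⟨j, M, v, v', h2, h3⟩ := hL.sound q hq
    obtain ⟨h5, -⟩ := List.getElem?_eq_some_iff.1 h2
    exact ⟨j, M, v, v', by rw [List.getElem?_append_left h5]; exact h2, h3⟩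
  · intro j M hj e he
    rcases Nat.lt_or_ge j Ms.length with h1 | h1
    · rw [List.getElem?_append_left h1] at hj
      exact hL.complete j M hj e he
    · rw [List.getElem?_append_right h1] at hj
      obtain ⟨h2, rfl⟩ := List.getElem?_eq_some_iff.1 hj
      simp at he

theorem Lists.append_insert {Ms : List (Set (Sym2 (StarVertex n)))} {E : Set (Sym2 (StarVertex n))}
    {m : ℕ} {a u w : ℕ → ℕ} (hL : Lists (Ms ++ [E]) m a u w) (v v' : StarVertex n) :
    Lists (Ms ++ [insert s(v, v') E]) (m + 1) (Function.update a m Ms.length)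
      (Function.update u m (code v)) (Function.update w m (code v')) := by
  constructor
  · intro q hq
    rcases Nat.lt_or_ge q m with h1 | h1
    · obtain ⟨j, M, x, x', h2, h3, h4⟩ := hL.sound q h1
      have hne : q ≠ m := by omega
      simp only [Function.update_of_ne hne]
      rcases Nat.lt_or_ge j Ms.length with h5 | h5
      · rw [List.getElem?_append_left h5] at h2
        exact ⟨j, M, x, x', by rwa [List.getElem?_append_left h5], h3, h4⟩
      · rw [List.getElem?_append_right h5] at h2
        obtain ⟨h6, h7⟩ := List.getElem?_eq_some_iff.1 h2
        simp only [List.length_singleton, Nat.lt_one_iff] at h6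
        refine ⟨j, insert s(v, v') E, x, x', ?_, ?_, h4⟩
        · rw [List.getElem?_append_right h5, h6]; rfl
        · simp only [h6, List.getElem_cons_zero] at h7
          rw [h7]
          exact Or.inr h3
    · obtain rfl : q = m := by omega
      refine ⟨Ms.length, insert s(v, v') E, v, v', by simp, Or.inl rfl, by simp, by simp, by simp⟩
  · intro j M hj e he
    have key : (∃ q < m, ∃ x x' : StarVertex n, e = s(x, x') ∧ a q = j ∧ u q = code x ∧
        w q = code x') → ∃ q < m + 1, ∃ x x' : StarVertex n, e = s(x, x') ∧
        Function.update a m Ms.length q = j ∧ Function.update u m (code v) q = code x ∧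
        Function.update w m (code v') q = code x' := by
      rintro ⟨q, h1, h2⟩
      have hne : q ≠ m := by omega
      refine ⟨q, by omega, ?_⟩
      simpa only [Function.update_of_ne hne] using h2
    rcases Nat.lt_or_ge j Ms.length with h1 | h1
    · rw [List.getElem?_append_left h1] at hj
      exact key (hL.complete j M (by rwa [List.getElem?_append_left h1]) e he)
    · rw [List.getElem?_append_right h1] at hj
      obtain ⟨h6, h7⟩ := List.getElem?_eq_some_iff.1 hj
      simp only [List.length_singleton, Nat.lt_one_iff] at h6
      simp only [h6, List.getElem_cons_zero] at h7
      obtain rfl : j = Ms.length := by omega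
      rw [← h7] at he
      rcases he with rfl | he
      · exact ⟨m, by omega, v, v', rfl, by simp, by simp, by simp⟩
      · exact key (hL.complete Ms.length E (by simp) e he)

end Star

/-! ### The program

Registers: `0` length of the output, `1` number of entries of the output, `2` number of vertices,
`3` phase, `4` parity of the iteration of the third phase, `5`, `6`, `7`, `12` auxiliary,
`8` whether the first phase goes on, `9` number of an unfinished branch or `0`, `10` whether the configuration
differs from the target, `11` number of the branch that exchanges a token with the center.
Arrays: `1` configuration, `2`, `3`, `4` output, `5` branch numbers of the vertices, `6` inward
neighbours, `7` parities of the positions, `8` selected edges (given by their outer ends). -/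

open TokenSwapping.Expr

/-- The outer end of the current edge. -/
def outerE : Expr := .reg 7

/-- The inner end of the current edge. -/
def innerE : Expr := .cell 6 outerE

/-- The branch number of the current edge. -/
def branchE : Expr := .cell 5 outerE

/-- The token on the vertex `e`. -/
def tokenE (e : Expr) : Expr := .cell 1 e

/-- The token on the vertex `e` belongs to the branch of the current edge. -/
def ownE (e : Expr) : Expr := .eq (.cell 5 (tokenE e)) branchE

/-- The current edge is selected in the first phase. -/
def sortE : Expr := conj (.lt (.lit 0) innerE) (conj (ownE innerE) (neg (ownE outerE)))

/-- The current edge moves the token of the center outward. -/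
def keepE : Expr :=
  conj (.lt (.lit 0) innerE) (conj (.eq (tokenE innerE) (.lit 0))
    (conj (neg (ownE outerE)) (neg (ownE (.cell 6 innerE)))))

/-- The current edge is selected in the second phase. -/
def changeE : Expr :=
  .add sortE (.add (conj (.eq innerE (.lit 0)) (.eq branchE (.reg 11)))
    (conj (.lt (.lit 0) (tokenE (.lit 0))) keepE))

/-- The current edge is selected in the third phase. -/
def oddEvenE : Expr :=
  conj (.lt (.lit 0) innerE) (conj (.eq (.cell 7 outerE) (.reg 4))
    (conj (ownE outerE) (conj (ownE innerE) (.lt (tokenE outerE) (tokenE innerE)))))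

/-- Given the conditions for the three phases, the condition for the current phase. -/
def byPhase (e f g : Expr) : Expr :=
  .add (conj (.eq (.reg 3) (.lit 1)) e)
    (.add (conj (.eq (.reg 3) (.lit 2)) f) (conj (.eq (.reg 3) (.lit 3)) g))

/-- Perform `p` for all edges. -/
def forEdges (p : Prog) : Prog :=
  .seq (.set 7 (.lit 1)) (.loop (.lt (.reg 7) (.reg 2)) (.seq p (.set 7 (.add (.reg 7) (.lit 1)))))

/-- Find out the swaps that are possible on the current edge. -/
def inspectEdge : Prog :=
  .seq (.ite sortE (.set 8 (.lit 1)) .skip)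
    (.seq (.ite (conj (.eq innerE (.lit 0)) (neg (ownE outerE))) (.set 9 branchE) .skip)
      (.ite (.eq (tokenE outerE) outerE) .skip (.set 10 (.lit 1))))

/-- Find out which phases go on, and the branch that exchanges a token with the center. -/
def inspect : Prog :=
  .seq (.seq (.set 8 (.lit 0)) (.seq (.set 9 (.lit 0)) (.set 10 (.lt (.lit 0) (tokenE (.lit 0))))))
    (.seq (forEdges inspectEdge)
      (.ite (.lt (.lit 0) (tokenE (.lit 0))) (.set 11 (.cell 5 (tokenE (.lit 0))))
        (.set 11 (.reg 9))))

/-- Select the edges of the matching. -/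
def selectEdges : Prog :=
  forEdges (.store 8 outerE (byPhase sortE changeE oddEvenE))

/-- Perform and output the swap on the current edge if it is selected. -/
def swapEdge : Prog :=
  .ite (.cell 8 outerE)
    (.seq (.set 12 (tokenE outerE))
      (.seq (.store 1 outerE (tokenE innerE))
        (.seq (.store 1 innerE (.reg 12))
          (.seq (.store 2 (.reg 1) (.sub (.reg 0) (.lit 1)))
            (.seq (.store 3 (.reg 1) innerE)
              (.seq (.store 4 (.reg 1) outerE)
                (.set 1 (.add (.reg 1) (.lit 1)))))))))
    .skip

/-- Perform and output the swaps on the selected edges. -/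
def swapEdges : Prog :=
  .seq (.set 0 (.add (.reg 0) (.lit 1))) (forEdges swapEdge)

/-- Perform one step of the algorithm. -/
def stepProg : Prog :=
  .seq inspect
    (.ite (byPhase (.reg 8) (.reg 9) (.reg 10))
      (.seq selectEdges (.seq swapEdges (.set 4 (.sub (.lit 1) (.reg 4)))))
      (.seq (.set 3 (.add (.reg 3) (.lit 1))) (.set 4 (.lit 1))))

/-- Initialize the arrays for one vertex. -/
def initVertex : Prog :=
  .seq (.store 5 (.reg 7) (.add (.reg 5) (.lit 1)))
    (.seq (.ite (.eq (.reg 6) (.lit 0))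
        (.seq (.store 6 (.reg 7) (.lit 0)) (.store 7 (.reg 7) (.lit 0)))
        (.seq (.store 6 (.reg 7) (.sub (.reg 7) (.lit 1)))
          (.store 7 (.reg 7) (.sub (.lit 1) (.cell 7 (.sub (.reg 7) (.lit 1)))))))
      (.seq (.set 7 (.add (.reg 7) (.lit 1))) (.set 6 (.add (.reg 6) (.lit 1)))))

/-- Initialize the arrays for one branch. -/
def initBranch : Prog :=
  .seq (.set 6 (.lit 0))
    (.seq (.loop (.lt (.reg 6) (.cell 0 (.reg 5))) initVertex)
      (.set 5 (.add (.reg 5) (.lit 1))))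

/-- Initialize the memory. -/
def initProg : Prog :=
  .seq (.seq (.store 5 (.lit 0) (.lit 0)) (.seq (.set 7 (.lit 1)) (.set 5 (.lit 0))))
    (.seq (.loop (.lt (.reg 5) (.reg 0)) initBranch)
      (.seq (.set 2 (.reg 7)) (.seq (.set 0 (.lit 0)) (.seq (.set 1 (.lit 0))
        (.seq (.set 3 (.lit 1)) (.set 4 (.lit 1)))))))

/-- The three-phase algorithm as a program. -/
def algProg : Prog :=
  .seq initProg (.loop (.lt (.reg 3) (.lit 4)) stepProg)

section Star

variable {h : ℕ} {n : Fin h → ℕ}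

variable (n) in
/-- The memory describes the subdivided star. -/
structure Layout (σ : Mem) : Prop where
  size : σ.reg 2 = numVertices n
  branch : ∀ v : StarVertex n, σ.arr 5 (code v) = branchNo v
  inw : ∀ b p, p < n b → σ.arr 6 (code (vx b (p + 1) : StarVertex n)) = code (vx b p : StarVertex n)
  par : ∀ b p, p < n b → σ.arr 7 (code (vx b (p + 1) : StarVertex n)) = p % 2

theorem Layout.congr {σ σ' : Mem} (hσ : Layout n σ) (h2 : σ'.reg 2 = σ.reg 2)
    (h5 : σ'.arr 5 = σ.arr 5) (h6 : σ'.arr 6 = σ.arr 6) (h7 : σ'.arr 7 = σ.arr 7) :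
    Layout n σ' where
  size := h2.trans hσ.size
  branch := by rw [h5]; exact hσ.branch
  inw := by rw [h6]; exact hσ.inw
  par := by rw [h7]; exact hσ.par

/-- The memory holds the configuration `D`. -/
def HoldsConfig (D : StarVertex n → StarVertex n) (σ : Mem) : Prop :=
  ∀ v, σ.arr 1 (code v) = code (D v)

/-! ### The conditions of the program -/

section Conditions

variable {D : StarVertex n → StarVertex n} {σ : Mem} {b : Fin h} {p : ℕ}

theorem eval_innerE (hσ : Layout n σ) (hp : p < n b)
    (hx : σ.reg 7 = code (vx b (p + 1) : StarVertex n)) :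
    innerE.eval σ = code (vx b p : StarVertex n) := by
  rw [innerE, Expr.eval, outerE, Expr.eval, hx, hσ.inw b p hp]

theorem eval_branchE (hσ : Layout n σ) (hp : p < n b)
    (hx : σ.reg 7 = code (vx b (p + 1) : StarVertex n)) :
    branchE.eval σ = b.val + 1 := by
  rw [branchE, Expr.eval, outerE, Expr.eval, hx, hσ.branch, branchNo_vx_succ hp]

theorem eval_tokenE (hD : HoldsConfig D σ) {e : Expr} {v : StarVertex n}
    (he : e.eval σ = code v) : (tokenE e).eval σ = code (D v) := by
  rw [tokenE, Expr.eval, he, hD]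

theorem holds_ownE (hσ : Layout n σ) (hD : HoldsConfig D σ) (hp : p < n b)
    (hx : σ.reg 7 = code (vx b (p + 1) : StarVertex n)) {e : Expr} {v : StarVertex n}
    (he : e.eval σ = code v) : (ownE e).Holds σ ↔ 0 < depth b (D v) := by
  rw [ownE, holds_eq, eval_branchE hσ hp hx, Expr.eval, eval_tokenE hD he, hσ.branch,
    branchNo_eq_iff]

theorem code_vx_pos_iff (hp : p < n b) : 0 < code (vx b p : StarVertex n) ↔ 0 < p := by
  rcases Nat.eq_zero_or_pos p with rfl | hp0
  · rw [vx_zero, code_center]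
  · rw [code_vx hp0 hp.le]
    omega

theorem holds_sortE (hσ : Layout n σ) (hD : HoldsConfig D σ) (hp : p < n b)
    (hx : σ.reg 7 = code (vx b (p + 1) : StarVertex n)) : sortE.Holds σ ↔ SortSel D b p := by
  have h1 := eval_innerE hσ hp hx
  have h2 : outerE.eval σ = code (vx b (p + 1) : StarVertex n) := hx
  rw [sortE, holds_conj, holds_conj, holds_neg, holds_lt, holds_ownE hσ hD hp hx h1,
    holds_ownE hσ hD hp hx h2, h1, Expr.eval, code_vx_pos_iff hp, SortSel, not_lt, Nat.le_zero]

theorem holds_center (hD : HoldsConfig D σ) :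
    (Expr.lt (.lit 0) (tokenE (.lit 0))).Holds σ ↔ D center ≠ center := by
  have h1 : (Expr.lit 0).eval σ = code (center : StarVertex n) := rfl
  rw [holds_lt, eval_tokenE hD h1, Expr.eval, Nat.pos_iff_ne_zero, Ne, code_eq_zero]

theorem holds_keepE (hσ : Layout n σ) (hD : HoldsConfig D σ) (hp : p < n b)
    (hx : σ.reg 7 = code (vx b (p + 1) : StarVertex n)) : keepE.Holds σ ↔ KeepSel D b p := by
  have h1 := eval_innerE hσ hp hx
  have h2 : outerE.eval σ = code (vx b (p + 1) : StarVertex n) := hx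
  rw [keepE, holds_conj, holds_conj, holds_conj, holds_neg, holds_neg, holds_lt, holds_eq,
    holds_ownE hσ hD hp hx h2, h1, eval_tokenE hD h1, Expr.eval, code_vx_pos_iff hp, KeepSel,
    code_eq_zero, not_lt, Nat.le_zero]
  -- The last conjunct reads the inward neighbour of the inner end. That cell is meaningful only for
  -- `0 < p`, since cell `0` of array `6` is never initialized.
  refine and_congr_right fun hp0 => and_congr_right fun _ => and_congr_right fun _ => ?_
  have h3 : (Expr.cell 6 innerE).eval σ = code (vx b (p - 1) : StarVertex n) := by
    rw [Expr.eval, h1]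
    have := hσ.inw b (p - 1) (by omega)
    rwa [Nat.sub_add_cancel hp0] at this
  rw [holds_ownE hσ hD hp hx h3, not_lt, Nat.le_zero]

theorem holds_changeE (hσ : Layout n σ) (hD : HoldsConfig D σ) (hp : p < n b)
    (hx : σ.reg 7 = code (vx b (p + 1) : StarVertex n)) {c : Fin h} (hc : σ.reg 11 = c.val + 1) :
    changeE.Holds σ ↔ ChangeSel D c b p := by
  have h1 : code (vx b p : StarVertex n) = 0 ↔ p = 0 := by
    have := code_vx_pos_iff hp
    omega
  rw [changeE, holds_add, holds_add, holds_conj, holds_conj, holds_center hD,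
    holds_keepE hσ hD hp hx, holds_sortE hσ hD hp hx, holds_eq, holds_eq, eval_innerE hσ hp hx,
    eval_branchE hσ hp hx, Expr.eval, Expr.eval, hc, h1, add_left_inj, ← Fin.ext_iff, ChangeSel]

/-- Inside one branch numbers increase with depth, so the program compares depths by comparing token
numbers. -/
theorem code_lt_code_iff {v w : StarVertex n} (hv : 0 < depth b v) (hw : 0 < depth b w) :
    code v < code w ↔ depth b v < depth b w := by
  rw [← vx_depth hv, ← vx_depth hw, code_vx hv (depth_le b v), code_vx hw (depth_le b w),
    depth_vx (depth_le b v), depth_vx (depth_le b w)]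
  omega

theorem holds_oddEvenE (hσ : Layout n σ) (hD : HoldsConfig D σ) (hp : p < n b)
    (hx : σ.reg 7 = code (vx b (p + 1) : StarVertex n)) {k : ℕ} (hk : σ.reg 4 = k % 2) :
    oddEvenE.Holds σ ↔ OddEvenSel k D b p := by
  have h1 := eval_innerE hσ hp hx
  have h2 : outerE.eval σ = code (vx b (p + 1) : StarVertex n) := hx
  rw [oddEvenE, holds_conj, holds_conj, holds_conj, holds_conj, holds_lt, holds_lt, holds_eq,
    holds_ownE hσ hD hp hx h2, holds_ownE hσ hD hp hx h1, eval_tokenE hD h1, eval_tokenE hD h2, h1,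
    Expr.eval, Expr.eval, Expr.eval, h2, hσ.par b p hp, hk, code_vx_pos_iff hp, OddEvenSel]
  refine and_congr_right fun _ => and_congr_right fun _ => and_congr_right fun h3 => ?_
  constructor
  · rintro ⟨h4, h5⟩
    exact (code_lt_code_iff h3 h4).1 h5
  · intro h4
    exact ⟨by omega, (code_lt_code_iff h3 (by omega)).2 h4⟩

theorem holds_byPhase_one {e f g : Expr} (h3 : σ.reg 3 = 1) :
    (byPhase e f g).Holds σ ↔ e.Holds σ := by
  simp [byPhase, Expr.eval, h3]

theorem holds_byPhase_two {e f g : Expr} (h3 : σ.reg 3 = 2) :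
    (byPhase e f g).Holds σ ↔ f.Holds σ := by
  simp [byPhase, Expr.eval, h3]

theorem holds_byPhase_three {e f g : Expr} (h3 : σ.reg 3 = 3) :
    (byPhase e f g).Holds σ ↔ g.Holds σ := by
  simp [byPhase, Expr.eval, h3]

end Conditions

/-! ### Correctness of the parts of the program -/

theorem runs_forEdges {p : Prog} (hp : p.loopFree = true) {I : ℕ → Mem → Prop} {σ : Mem}
    (hI : ∀ b q, q < n b → ∀ τ, I (code (vx b (q + 1) : StarVertex n)) τ →
      τ.reg 7 = code (vx b (q + 1) : StarVertex n) →
      (p.effect τ).reg 7 = τ.reg 7 ∧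
        I (code (vx b (q + 1) : StarVertex n) + 1) (Prog.effect
          (.set 7 (.add (.reg 7) (.lit 1))) (p.effect τ)))
    (hsize : ∀ x τ, I x τ → τ.reg 2 = numVertices n)
    (h0 : I 1 (Prog.effect (.set 7 (.lit 1)) σ)) :
    Runs (forEdges p) σ (numVertices n * (8 + p.time) + 6) (I (numVertices n)) := by
  have hN : 0 < numVertices n := by unfold numVertices; omega
  have hloop := fun (τ : Mem) (hτ : I 1 τ ∧ τ.reg 7 = 1) =>
    Runs.loop_count (e := .lt (.reg 7) (.reg 2))
      (p := .seq p (.set 7 (.add (.reg 7) (.lit 1)))) (T := p.time + 4)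
      (k := numVertices n - 1) (I := fun i τ => I (i + 1) τ ∧ τ.reg 7 = i + 1) (by
        rintro i hi τ ⟨h1, h2⟩
        obtain ⟨b, q, hq, hx⟩ := exists_code_eq (n := n) (x := i + 1) (by omega) (by omega)
        constructor
        · have := hsize _ _ h1
          simp only [Expr.eval, h2, this]
          rw [if_pos (by omega)]
          exact one_ne_zero
        · rw [hx] at h1 h2 ⊢
          obtain ⟨h3, h4⟩ := hI b q hq τ h1 h2
          refine Runs.of_effect (p := .seq p (.set 7 (.add (.reg 7) (.lit 1))))
            (by simp [Prog.loopFree, hp]) ⟨h4, ?_⟩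
          simp [Prog.effect, Expr.eval, h3, h2]) (by
        rintro τ ⟨h1, h2⟩
        have := hsize _ _ h1
        simp only [Expr.eval, h2, this]
        rw [if_neg (by omega)]) hτ
  refine Runs.mono (Runs.seq (Runs.of_effect rfl (Q := fun τ => I 1 τ ∧ τ.reg 7 = 1)
    ⟨h0, by simp [Prog.effect, Expr.eval]⟩) hloop) ?_ ?_
  -- Each pass costs `4` for the test and `4` for the increment; the extra `6` is the initial
  -- assignment and the last test.
  · simp only [Prog.time, Expr.cost]
    have : (numVertices n - 1) * (1 + (1 + 1 + 1) + (p.time + 4)) ≤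
        numVertices n * (8 + p.time) := Nat.mul_le_mul (by omega) (by omega)
    omega
  · rintro τ ⟨h1, -⟩
    rwa [Nat.sub_add_cancel hN] at h1

theorem effect_ite_holds (e : Expr) (p q : Prog) (σ : Mem) [Decidable (e.Holds σ)] :
    (Prog.ite e p q).effect σ = if e.Holds σ then p.effect σ else q.effect σ := by
  by_cases he : e.Holds σ
  · rw [if_pos he]
    exact if_neg he
  · rw [if_neg he]
    exact if_pos (not_not.1 he)

/-- The result of the inspection of the configuration `D`. -/
structure Inspected (D : StarVertex n → StarVertex n) (σ τ : Mem) : Prop where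
  arr : τ.arr = σ.arr
  reg : ∀ r < 5, τ.reg r = σ.reg r
  sort : τ.reg 8 ≠ 0 ↔ ∃ b p, p < n b ∧ SortSel D b p
  front : (τ.reg 9 = 0 ∧ ∀ b, 0 < depth b (D (vx b 1))) ∨
    ∃ b : Fin h, τ.reg 9 = b.val + 1 ∧ depth b (D (vx b 1)) = 0
  ne_id : τ.reg 10 ≠ 0 ↔ D ≠ id
  target : D center = center ∧ τ.reg 11 = τ.reg 9 ∨
    ∃ b : Fin h, 0 < depth b (D center) ∧ τ.reg 11 = b.val + 1

/-- The state of the inspection before the edge with outer end number `x`. -/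
structure Inspecting (D : StarVertex n → StarVertex n) (σ : Mem) (x : ℕ) (τ : Mem) : Prop where
  arr : τ.arr = σ.arr
  reg : ∀ r < 5, τ.reg r = σ.reg r
  sort : τ.reg 8 ≠ 0 ↔ ∃ b p, p < n b ∧ SortSel D b p ∧ code (vx b (p + 1) : StarVertex n) < x
  front : (τ.reg 9 = 0 ∧ ∀ b, code (vx b 1 : StarVertex n) < x → 0 < depth b (D (vx b 1))) ∨
    ∃ b : Fin h, τ.reg 9 = b.val + 1 ∧ depth b (D (vx b 1)) = 0
  ne_id : τ.reg 10 ≠ 0 ↔ ∃ v, D v ≠ v ∧ code v < x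

theorem code_vx_lt_succ_iff {b c : Fin h} {p q : ℕ} (hp : p < n c) (hq : q < n b) :
    code (vx c (p + 1) : StarVertex n) < code (vx b (q + 1) : StarVertex n) + 1 ↔
      code (vx c (p + 1) : StarVertex n) < code (vx b (q + 1) : StarVertex n) ∨
        (c = b ∧ p = q) := by
  rw [Nat.lt_succ_iff_lt_or_eq]
  refine or_congr_right ⟨fun h1 => ?_, ?_⟩
  · obtain ⟨h2, h3⟩ := vx_eq_vx (Nat.succ_pos p) hp hq (code_injective h1)
    exact ⟨h2, by omega⟩
  · rintro ⟨rfl, rfl⟩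
    rfl

theorem HoldsConfig.congr {D : StarVertex n → StarVertex n} {σ τ : Mem} (hD : HoldsConfig D σ)
    (h1 : τ.arr 1 = σ.arr 1) : HoldsConfig D τ := by
  unfold HoldsConfig
  rw [h1]
  exact hD

open Classical in
theorem effect_ite_set (e f : Expr) (r : ℕ) (σ : Mem) :
    (Prog.ite e (.set r f) .skip).effect σ =
      { σ with reg := Function.update σ.reg r (if e.Holds σ then f.eval σ else σ.reg r) } := by
  rw [effect_ite_holds]
  split_ifs
  · rfl
  · rw [Function.update_eq_self]
    rfl

open Classical in
theorem effect_ite_skip_set (e f : Expr) (r : ℕ) (σ : Mem) :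
    (Prog.ite e .skip (.set r f)).effect σ =
      { σ with reg := Function.update σ.reg r (if e.Holds σ then σ.reg r else f.eval σ) } := by
  rw [effect_ite_holds]
  split_ifs
  · rw [Function.update_eq_self]
    rfl
  · rfl

open Classical in
theorem effect_inspectEdge {D : StarVertex n → StarVertex n} {τ : Mem} {b : Fin h} {q : ℕ}
    (hτ : Layout n τ) (hD : HoldsConfig D τ) (hq : q < n b)
    (hx : τ.reg 7 = code (vx b (q + 1) : StarVertex n)) :
    (inspectEdge.effect τ).arr = τ.arr ∧
    (∀ r, r < 8 → (inspectEdge.effect τ).reg r = τ.reg r) ∧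
    ((inspectEdge.effect τ).reg 8 = if SortSel D b q then 1 else τ.reg 8) ∧
    ((inspectEdge.effect τ).reg 9 =
      if q = 0 ∧ depth b (D (vx b 1)) = 0 then b.val + 1 else τ.reg 9) ∧
    ((inspectEdge.effect τ).reg 10 =
      if D (vx b (q + 1)) = vx b (q + 1) then τ.reg 10 else 1) := by
  set τ₁ : Mem := ⟨Function.update τ.reg 8
    (if sortE.Holds τ then (Expr.lit 1).eval τ else τ.reg 8), τ.arr⟩ with hτ₁
  have hτ₁' : Layout n τ₁ := hτ.congr rfl rfl rfl rfl
  have hD₁ : HoldsConfig D τ₁ := hD.congr rfl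
  have hx₁ : τ₁.reg 7 = code (vx b (q + 1) : StarVertex n) := hx
  have hx₁' : outerE.eval τ₁ = code (vx b (q + 1) : StarVertex n) := hx
  set τ₂ : Mem := ⟨Function.update τ₁.reg 9
    (if (conj (.eq innerE (.lit 0)) (neg (ownE outerE))).Holds τ₁ then branchE.eval τ₁
      else τ₁.reg 9), τ₁.arr⟩ with hτ₂
  have hD₂ : HoldsConfig D τ₂ := hD.congr rfl
  have hx₂ : outerE.eval τ₂ = code (vx b (q + 1) : StarVertex n) := hx
  have heff : inspectEdge.effect τ = ⟨Function.update τ₂.reg 10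
      (if (Expr.eq (tokenE outerE) outerE).Holds τ₂ then τ₂.reg 10 else (Expr.lit 1).eval τ₂),
      τ₂.arr⟩ := by
    rw [inspectEdge, Prog.effect, Prog.effect, effect_ite_set, effect_ite_set, effect_ite_skip_set]
  have h0 : code (vx b q : StarVertex n) = 0 ↔ q = 0 := by
    have := code_vx_pos_iff hq
    omega
  have h1 : (conj (.eq innerE (.lit 0)) (neg (ownE outerE))).Holds τ₁ ↔
      q = 0 ∧ depth b (D (vx b 1)) = 0 := by
    rw [holds_conj, holds_neg, holds_eq, holds_ownE hτ₁' hD₁ hq hx₁ hx₁', eval_innerE hτ₁' hq hx₁,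
      Expr.eval, h0, not_lt, Nat.le_zero]
    refine and_congr_right ?_
    rintro rfl
    rfl
  have h2 : (Expr.eq (tokenE outerE) outerE).Holds τ₂ ↔ D (vx b (q + 1)) = vx b (q + 1) := by
    rw [holds_eq, eval_tokenE hD₂ hx₂, hx₂, code_injective.eq_iff]
  rw [heff]
  refine ⟨rfl, ?_, ?_, ?_, ?_⟩
  · intro r hr
    simp only [hτ₁, hτ₂]
    rw [Function.update_of_ne (by omega), Function.update_of_ne (by omega),
      Function.update_of_ne (by omega)]
  · simp only [hτ₂]
    rw [Function.update_of_ne (by omega), Function.update_of_ne (by omega)]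
    simp only [hτ₁, Function.update_self, holds_sortE hτ hD hq hx, Expr.eval]
  · simp only
    rw [Function.update_of_ne (by omega)]
    simp only [hτ₂, Function.update_self, h1, eval_branchE hτ₁' hq hx₁]
    congr 1
  · simp only [Function.update_self, h2, Expr.eval]
    congr 1

theorem runs_inspect {D : StarVertex n → StarVertex n} {σ : Mem} (hσ : Layout n σ)
    (hD : HoldsConfig D σ) (hn : ∀ b, 0 < n b) :
    Runs inspect σ (numVertices n * 200 + 200) (Inspected D σ) := by
  have hinit : Runs (.seq (.set 8 (.lit 0))
      (.seq (.set 9 (.lit 0)) (.set 10 (.lt (.lit 0) (tokenE (.lit 0)))))) σ 20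
      (Inspecting D σ 1) := by
    refine (Runs.of_effect rfl ?_).mono (by decide) fun _ h1 => h1
    have h1 : ∀ v : StarVertex n, code v < 1 ↔ v = center := fun v => by
      rw [Nat.lt_one_iff, code_eq_zero]
    refine ⟨rfl, ?_, ?_, ?_, ?_⟩
    · intro r hr
      simp only [Prog.effect]
      rw [Function.update_of_ne (by omega), Function.update_of_ne (by omega),
        Function.update_of_ne (by omega)]
    · simp only [h1]
      constructor
      · intro h2
        exact absurd rfl h2
      · rintro ⟨b, p, h2, -, h3⟩
        exact absurd h3 (vx_ne_center (Nat.succ_pos p) h2)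
    · refine Or.inl ⟨rfl, fun b hb => ?_⟩
      rw [h1] at hb
      exact absurd hb (vx_ne_center one_pos (hn b))
    · simp only [h1, exists_eq_right]
      exact holds_center hD
  have hloop : ∀ τ, Inspecting D σ 1 τ → Runs (forEdges inspectEdge) τ
      (numVertices n * (8 + inspectEdge.time) + 6) (Inspecting D σ (numVertices n)) := by
    intro τ hτ
    refine runs_forEdges rfl ?_ ?_ ?_
    · intro b q hq ρ hρ hx
      have hlay : Layout n ρ := hσ.congr (hρ.reg 2 (by omega)) (by rw [hρ.arr]) (by rw [hρ.arr])
        (by rw [hρ.arr])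
      have hcfg : HoldsConfig D ρ := hD.congr (by rw [hρ.arr])
      obtain ⟨h1, h2, h3, h4, h5⟩ := effect_inspectEdge hlay hcfg hq hx
      generalize inspectEdge.effect ρ = ρ' at *
      refine ⟨h2 7 (by omega), ?_⟩
      simp only [Prog.effect]
      refine ⟨h1.trans hρ.arr, ?_, ?_, ?_, ?_⟩
      · intro r hr
        simp only
        rw [Function.update_of_ne (by omega), h2 r (by omega), hρ.reg r hr]
      · simp only
        rw [Function.update_of_ne (by omega), h3]
        constructor
        · split_ifs with h6
          · intro _
            exact ⟨b, q, hq, h6, by omega⟩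
          · intro h7
            obtain ⟨c, p, h8, h9, h10⟩ := hρ.sort.1 h7
            exact ⟨c, p, h8, h9, by omega⟩
        · rintro ⟨c, p, h8, h9, h10⟩
          rw [code_vx_lt_succ_iff h8 hq] at h10
          split_ifs with h6
          · exact one_ne_zero
          · refine hρ.sort.2 ⟨c, p, h8, h9, h10.resolve_right ?_⟩
            rintro ⟨rfl, rfl⟩
            exact h6 h9
      · simp only
        rw [Function.update_of_ne (by omega), h4]
        split_ifs with h6
        · exact Or.inr ⟨b, rfl, h6.2⟩
        · rcases hρ.front with ⟨h7, h8⟩ | h7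
          · refine Or.inl ⟨h7, fun c hc => ?_⟩
            rcases (code_vx_lt_succ_iff (p := 0) (hn c) hq).1 hc with h9 | ⟨rfl, rfl⟩
            · exact h8 c h9
            · by_contra h9
              exact h6 ⟨rfl, by omega⟩
          · exact Or.inr h7
      · simp only
        rw [Function.update_of_ne (by omega), h5]
        constructor
        · split_ifs with h6
          · intro h7
            obtain ⟨v, h8, h9⟩ := hρ.ne_id.1 h7
            exact ⟨v, h8, by omega⟩
          · intro _
            exact ⟨vx b (q + 1), h6, by omega⟩
        · rintro ⟨v, h8, h9⟩
          split_ifs with h6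
          · refine hρ.ne_id.2 ⟨v, h8, ?_⟩
            rcases Nat.lt_succ_iff_lt_or_eq.1 h9 with h10 | h10
            · exact h10
            · rw [code_injective h10] at h8
              exact absurd h6 h8
          · exact one_ne_zero
    · intro x ρ hρ
      rw [hρ.reg 2 (by omega), hσ.size]
    · refine ⟨hτ.arr, ?_, hτ.sort, hτ.front, hτ.ne_id⟩
      intro r hr
      simp only [Prog.effect]
      rw [Function.update_of_ne (by omega), hτ.reg r hr]
  have hlast : ∀ τ, Inspecting D σ (numVertices n) τ → Runs (.ite (.lt (.lit 0) (tokenE (.lit 0)))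
      (.set 11 (.cell 5 (tokenE (.lit 0)))) (.set 11 (.reg 9))) τ 30 (Inspected D σ) := by
    intro τ hτ
    refine (Runs.of_effect rfl ?_).mono (by decide) fun _ h1 => h1
    have hcfg : HoldsConfig D τ := hD.congr (by rw [hτ.arr])
    have h1 : (Expr.lit 0).eval τ = code (center : StarVertex n) := rfl
    have key : ∀ x, (D center = center ∧ x = τ.reg 9 ∨
        ∃ b : Fin h, 0 < depth b (D center) ∧ x = b.val + 1) →
        Inspected D σ { τ with reg := Function.update τ.reg 11 x } := by
      intro x hx
      refine ⟨hτ.arr, ?_, ?_, ?_, ?_, hx⟩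
      · intro r hr
        simp only
        rw [Function.update_of_ne (by omega), hτ.reg r hr]
      · refine hτ.sort.trans ?_
        simp only [code_lt, and_true]
      · rcases hτ.front with ⟨h2, h3⟩ | h2
        · exact Or.inl ⟨h2, fun b => h3 b (code_lt _)⟩
        · exact Or.inr h2
      · refine hτ.ne_id.trans ?_
        simp only [code_lt, and_true]
        rw [Ne, funext_iff, not_forall]
        rfl
    classical
    rw [effect_ite_holds]
    simp only [holds_center hcfg]
    split_ifs with h2
    · refine key _ (Or.inr ?_)
      obtain ⟨b, hb⟩ := (eq_center_or_depth_pos (D center)).resolve_left h2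
      refine ⟨b, hb, ?_⟩
      rw [Expr.eval, eval_tokenE hcfg h1, hτ.arr, hσ.branch, branchNo_eq_iff]
      exact hb
    · exact key _ (Or.inl ⟨not_not.1 h2, rfl⟩)
  have htime : inspectEdge.time ≤ 150 := by decide
  refine (hinit.seq fun τ hτ => (hloop τ hτ).seq hlast).mono ?_ fun _ h1 => h1
  have : numVertices n * (8 + inspectEdge.time) ≤ numVertices n * 200 :=
    Nat.mul_le_mul_left _ (by omega)
  omega

/-- The state of the selection of the edges `S` before the edge with outer end number `x`. -/
structure Selecting (n : Fin h → ℕ) (S : Fin h → ℕ → Prop) (σ : Mem) (x : ℕ) (τ : Mem) : Prop where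
  reg : ∀ r, r ≠ 7 → τ.reg r = σ.reg r
  arr : ∀ a, a ≠ 8 → τ.arr a = σ.arr a
  flag : ∀ b p, p < n b → code (vx b (p + 1) : StarVertex n) < x →
    (τ.arr 8 (code (vx b (p + 1) : StarVertex n)) ≠ 0 ↔ S b p)

theorem runs_selectEdges {D : StarVertex n → StarVertex n} {σ : Mem} (hσ : Layout n σ)
    (hD : HoldsConfig D σ) {S : Fin h → ℕ → Prop}
    (hS : ∀ b q, q < n b → ∀ τ : Mem, (∀ r, r ≠ 7 → τ.reg r = σ.reg r) → Layout n τ →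
      HoldsConfig D τ → τ.reg 7 = code (vx b (q + 1) : StarVertex n) →
      ((byPhase sortE changeE oddEvenE).Holds τ ↔ S b q)) :
    Runs selectEdges σ (numVertices n * 400 + 6) (Selecting n S σ (numVertices n)) := by
  have htime : (Prog.store 8 outerE (byPhase sortE changeE oddEvenE)).time ≤ 390 := by decide
  refine Runs.mono (runs_forEdges (I := Selecting n S σ) rfl ?_ ?_ ?_) ?_ fun _ h1 => h1
  · intro b q hq τ hτ hx
    have hlay : Layout n τ := hσ.congr (hτ.reg 2 (by omega)) (hτ.arr 5 (by omega))
      (hτ.arr 6 (by omega)) (hτ.arr 7 (by omega))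
    have hcfg : HoldsConfig D τ := hD.congr (hτ.arr 1 (by omega))
    have h1 := hS b q hq τ hτ.reg hlay hcfg hx
    refine ⟨rfl, ?_, ?_, ?_⟩
    · intro r hr
      simp only [Prog.effect]
      rw [Function.update_of_ne hr, hτ.reg r hr]
    · intro a ha
      simp only [Prog.effect]
      rw [Function.update_of_ne ha, hτ.arr a ha]
    · intro c p hp hc
      have h2 : outerE.eval τ = code (vx b (q + 1) : StarVertex n) := hx
      simp only [Prog.effect, Function.update_self, h2]
      rcases (code_vx_lt_succ_iff hp hq).1 hc with h3 | ⟨rfl, rfl⟩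
      · rw [Function.update_of_ne h3.ne]
        exact hτ.flag c p hp h3
      · rw [Function.update_self]
        exact h1
  · intro x τ hτ
    rw [hτ.reg 2 (by omega), hσ.size]
  · refine ⟨?_, fun _ _ => rfl, ?_⟩
    · intro r hr
      simp only [Prog.effect]
      rw [Function.update_of_ne hr]
    · intro b p hp hx
      rw [code_vx_succ hp] at hx
      omega
  · have : numVertices n * (8 + (Prog.store 8 outerE (byPhase sortE changeE oddEvenE)).time) ≤
        numVertices n * 400 := Nat.mul_le_mul_left _ (by omega)
    omega

/-! ### Performing the swaps one by one -/

theorem SelectsMatching.mono {S S' : Fin h → ℕ → Prop} (hS' : SelectsMatching n S')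
    (hSS' : ∀ b p, S b p → S' b p) : SelectsMatching n S where
  next b p hp h1 h2 := hS'.next b p hp (hSS' _ _ h1) (hSS' _ _ h2)
  zero b c hb hc h1 h2 := hS'.zero b c hb hc (hSS' _ _ h1) (hSS' _ _ h2)

/-- The inductive step for performing a matching sequentially: as the edges are disjoint, the ends
of the new edge are still untouched by the earlier swaps. -/
theorem SelectsMatching.route_insert {S S' : Fin h → ℕ → Prop} (hS' : SelectsMatching n S')
    {b : Fin h} {q : ℕ} (hq : q < n b) (hSS' : ∀ c p, S' c p ↔ S c p ∨ (c = b ∧ p = q))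
    (hbq : ¬ S b q) (D : StarVertex n → StarVertex n) :
    (route (edgesOf S') D (vx b q) = D (vx b (q + 1)) ∧
      route (edgesOf S') D (vx b (q + 1)) = D (vx b q)) ∧
    (route (edgesOf S) D (vx b q) = D (vx b q) ∧
      route (edgesOf S) D (vx b (q + 1)) = D (vx b (q + 1))) ∧
    ∀ v, v ≠ vx b q → v ≠ vx b (q + 1) → route (edgesOf S') D v = route (edgesOf S) D v := by
  have h1 : S' b q := (hSS' b q).2 (Or.inr ⟨rfl, rfl⟩)
  have h2 : ∀ c p, S c p → S' c p := fun c p h2 => (hSS' c p).2 (Or.inl h2)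
  have hS := hS'.mono h2
  refine ⟨⟨hS'.route_inner D hq h1, hS'.route_outer D hq h1⟩, ⟨?_, ?_⟩, ?_⟩
  · rcases Nat.eq_zero_or_pos q with rfl | hq0
    · rw [vx_zero]
      refine route_edgesOf_center D fun c hc h3 => hbq ?_
      obtain rfl := hS'.zero c b hc hq (h2 c 0 h3) h1
      exact h3
    · obtain ⟨r, rfl⟩ : ∃ r, q = r + 1 := ⟨q - 1, by omega⟩
      exact route_edgesOf_of_not D hq.le (fun _ => hbq)
        fun h3 => hS'.next b r hq (h2 b r h3) h1
  · exact route_edgesOf_of_not D hq (fun h3 h4 => hS'.next b q h3 h1 (h2 b _ h4)) hbq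
  · intro v hv1 hv2
    have h3 : ∀ w, s(v, w) ∈ (edgesOf S' : Set (Sym2 (StarVertex n))) ↔ s(v, w) ∈ edgesOf S := by
      intro w
      constructor
      · rintro ⟨c, p, hp, h3, h4⟩
        rcases (hSS' c p).1 h3 with h5 | ⟨rfl, rfl⟩
        · exact ⟨c, p, hp, h5, h4⟩
        · rcases Sym2.eq_iff.1 h4 with ⟨h5, -⟩ | ⟨h5, -⟩
          · exact absurd h5 hv1
          · exact absurd h5 hv2
      · rintro ⟨c, p, hp, h3, h4⟩
        exact ⟨c, p, hp, h2 c p h3, h4⟩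
    rw [route_eq, route_eq]
    congr 1
    by_cases h4 : ∃ w, s(v, w) ∈ (edgesOf S : Set (Sym2 (StarVertex n)))
    · obtain ⟨w, hw⟩ := h4
      rw [hS.isMatching.partner_eq hw, hS'.isMatching.partner_eq ((h3 w).2 hw)]
    · rw [not_exists] at h4
      rw [partner_eq_self h4, partner_eq_self fun w hw => h4 w ((h3 w).1 hw)]

variable (n) in
/-- The edges of `S` whose outer ends have numbers below `x`. -/
def Below (S : Fin h → ℕ → Prop) (x : ℕ) (b : Fin h) (p : ℕ) : Prop :=
  S b p ∧ p < n b ∧ code (vx b (p + 1) : StarVertex n) < x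

/-- The state of performing the swaps `S` before the edge with outer end number `x`. -/
structure Swapping (D : StarVertex n → StarVertex n) (Ms : List (Set (Sym2 (StarVertex n))))
    (S : Fin h → ℕ → Prop) (σ : Mem) (x : ℕ) (τ : Mem) : Prop where
  reg : ∀ r, r ≠ 0 → r ≠ 1 → r ≠ 7 → r ≠ 12 → τ.reg r = σ.reg r
  arr : ∀ a, 4 < a → τ.arr a = σ.arr a
  length : τ.reg 0 = Ms.length + 1
  config : HoldsConfig (route (edgesOf (Below n S x)) D) τ
  lists : Lists (Ms ++ [edgesOf (Below n S x)]) (τ.reg 1) (τ.arr 2) (τ.arr 3) (τ.arr 4)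

theorem edgesOf_below_one (S : Fin h → ℕ → Prop) :
    (edgesOf (Below n S 1) : Set (Sym2 (StarVertex n))) = ∅ := by
  ext e
  simp only [Set.mem_empty_iff_false, iff_false]
  rintro ⟨b, p, hp, ⟨-, -, h1⟩, -⟩
  rw [code_vx_succ hp] at h1
  omega

theorem edgesOf_below_last (S : Fin h → ℕ → Prop) :
    (edgesOf (Below n S (numVertices n)) : Set (Sym2 (StarVertex n))) = edgesOf S := by
  ext e
  constructor
  · rintro ⟨b, p, hp, h1, h2⟩
    exact ⟨b, p, hp, h1.1, h2⟩
  · rintro ⟨b, p, hp, h1, h2⟩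
    exact ⟨b, p, hp, ⟨h1, hp, code_lt _⟩, h2⟩

theorem route_empty {V : Type} (D : V → V) : route ∅ D = D := by
  funext v
  rw [route_eq, partner_eq_self (by simp)]

theorem effect_swapEdge {τ : Mem} {x w : ℕ} (hx : τ.reg 7 = x) (hw : τ.arr 6 x = w)
    (h8 : τ.arr 8 x ≠ 0) :
    swapEdge.effect τ =
      { reg := Function.update (Function.update τ.reg 12 (τ.arr 1 x)) 1 (τ.reg 1 + 1)
        arr := Function.update (Function.update (Function.update (Function.update τ.arr 1
          (Function.update (Function.update (τ.arr 1) x (τ.arr 1 w)) w (τ.arr 1 x))) 2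
          (Function.update (τ.arr 2) (τ.reg 1) (τ.reg 0 - 1))) 3
          (Function.update (τ.arr 3) (τ.reg 1) w)) 4
          (Function.update (τ.arr 4) (τ.reg 1) x) } := by
  subst hw hx
  simp [swapEdge, Prog.effect, Expr.eval, outerE, innerE, tokenE, h8]

theorem runs_swapEdges {D : StarVertex n → StarVertex n} {Ms : List (Set (Sym2 (StarVertex n)))}
    {S : Fin h → ℕ → Prop} {σ : Mem} (hσ : Layout n σ) (hD : HoldsConfig D σ)
    (hS : SelectsMatching n S) (h0 : σ.reg 0 = Ms.length)
    (hlists : Lists Ms (σ.reg 1) (σ.arr 2) (σ.arr 3) (σ.arr 4))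
    (hflag : ∀ b p, p < n b → (σ.arr 8 (code (vx b (p + 1) : StarVertex n)) ≠ 0 ↔ S b p)) :
    Runs swapEdges σ (numVertices n * 200 + 20) (Swapping D Ms S σ (numVertices n)) := by
  have htime : swapEdge.time ≤ 100 := by decide
  refine Runs.mono (Runs.seq (Q := fun τ => τ = ⟨Function.update σ.reg 0 (σ.reg 0 + 1), σ.arr⟩)
    (Runs.of_effect rfl rfl) fun τ hτ =>
      runs_forEdges (I := Swapping D Ms S σ) rfl ?_ ?_ ?_) ?_ fun _ h1 => h1
  · intro b q hq τ hτ hx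
    have hw : τ.arr 6 (code (vx b (q + 1) : StarVertex n)) = code (vx b q : StarVertex n) := by
      rw [hτ.arr 6 (by omega), hσ.inw b q hq]
    have hf := hflag b q hq
    rw [← hτ.arr 8 (by omega)] at hf
    by_cases hbq : S b q
    · have hbelow : ∀ c p, Below n S (code (vx b (q + 1) : StarVertex n) + 1) c p ↔
          Below n S (code (vx b (q + 1) : StarVertex n)) c p ∨ (c = b ∧ p = q) := by
        intro c p
        constructor
        · rintro ⟨h1, h2, h3⟩
          rcases (code_vx_lt_succ_iff h2 hq).1 h3 with h4 | h4
          · exact Or.inl ⟨h1, h2, h4⟩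
          · exact Or.inr h4
        · rintro (⟨h1, h2, h3⟩ | ⟨rfl, rfl⟩)
          · exact ⟨h1, h2, by omega⟩
          · exact ⟨hbq, hq, by omega⟩
      have hedges : (edgesOf (Below n S (code (vx b (q + 1) : StarVertex n) + 1)) :
          Set (Sym2 (StarVertex n))) = insert s(vx b q, vx b (q + 1))
            (edgesOf (Below n S (code (vx b (q + 1) : StarVertex n)))) := by
        ext e
        constructor
        · rintro ⟨c, p, h1, h2, rfl⟩
          rcases (hbelow c p).1 h2 with h3 | ⟨rfl, rfl⟩
          · exact Or.inr ⟨c, p, h1, h3, rfl⟩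
          · exact Or.inl rfl
        · rintro (rfl | ⟨c, p, h1, h2, rfl⟩)
          · exact ⟨b, q, hq, (hbelow b q).2 (Or.inr ⟨rfl, rfl⟩), rfl⟩
          · exact ⟨c, p, h1, (hbelow c p).2 (Or.inl h2), rfl⟩
      obtain ⟨⟨h1, h2⟩, ⟨h3, h4⟩, h5⟩ :=
        (hS.mono fun c p (h1 : Below n S (code (vx b (q + 1) : StarVertex n) + 1) c p) =>
          h1.1).route_insert hq hbelow (fun h1 => lt_irrefl _ h1.2.2) D
      rw [effect_swapEdge hx hw (hf.2 hbq)]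
      have hne : (vx b (q + 1) : StarVertex n) ≠ vx b q := fun h6 => by
        have := vx_inj (n := n) hq hq.le h6
        omega
      refine ⟨by simp, ?_, ?_, ?_, ?_, ?_⟩
      · intro r hr0 hr1 hr7 hr12
        simp only [Prog.effect]
        rw [Function.update_of_ne hr7, Function.update_of_ne hr1, Function.update_of_ne hr12,
          hτ.reg r hr0 hr1 hr7 hr12]
      · intro a ha
        simp only [Prog.effect]
        rw [Function.update_of_ne (by omega), Function.update_of_ne (by omega),
          Function.update_of_ne (by omega), Function.update_of_ne (by omega), hτ.arr a ha]
      · simp [Prog.effect, hτ.length]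
      · have harr : ∀ v : StarVertex n, Function.update (Function.update (τ.arr 1)
            (code (vx b (q + 1) : StarVertex n)) (τ.arr 1 (code (vx b q : StarVertex n))))
            (code (vx b q : StarVertex n)) (τ.arr 1 (code (vx b (q + 1) : StarVertex n))) (code v) =
            code (TokenSwapping.route
              (edgesOf (Below n S (code (vx b (q + 1) : StarVertex n) + 1))) D v) := by
          intro v
          by_cases hv1 : v = vx b q
          · subst hv1
            rw [Function.update_self, hτ.config, h4, h1]
          · rw [Function.update_of_ne fun h6 => hv1 (code_injective h6)]
            by_cases hv2 : v = vx b (q + 1)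
            · subst hv2
              rw [Function.update_self, hτ.config, h3, h2]
            · rw [Function.update_of_ne fun h6 => hv2 (code_injective h6), hτ.config, h5 v hv1 hv2]
        intro v
        rw [← harr v]
        simp [Prog.effect]
      · have := hτ.lists.append_insert (vx b q) (vx b (q + 1))
        rw [hedges]
        simpa [Prog.effect, hτ.length] using this
    · have heff : swapEdge.effect τ = τ := by
        have h1 : τ.arr 8 (code (vx b (q + 1) : StarVertex n)) = 0 := by
          by_contra h1
          exact hbq (hf.1 h1)
        simp [swapEdge, Prog.effect, Expr.eval, outerE, hx, h1]
      have hedges : (edgesOf (Below n S (code (vx b (q + 1) : StarVertex n) + 1)) :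
          Set (Sym2 (StarVertex n))) =
            edgesOf (Below n S (code (vx b (q + 1) : StarVertex n))) := by
        ext e
        constructor
        · rintro ⟨c, p, h1, ⟨h2, h3, h4⟩, rfl⟩
          rcases (code_vx_lt_succ_iff h3 hq).1 h4 with h5 | ⟨rfl, rfl⟩
          · exact ⟨c, p, h1, ⟨h2, h3, h5⟩, rfl⟩
          · exact absurd h2 hbq
        · rintro ⟨c, p, h1, ⟨h2, h3, h4⟩, rfl⟩
          exact ⟨c, p, h1, ⟨h2, h3, by omega⟩, rfl⟩
      rw [heff]
      refine ⟨rfl, ?_, hτ.arr, ?_, ?_, ?_⟩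
      · intro r hr0 hr1 hr7 hr12
        simp only [Prog.effect]
        rw [Function.update_of_ne hr7, hτ.reg r hr0 hr1 hr7 hr12]
      · simp [Prog.effect, hτ.length]
      · rw [hedges]
        exact hτ.config
      · rw [hedges]
        simpa [Prog.effect] using hτ.lists
  · intro x τ hτ
    rw [hτ.reg 2 (by omega) (by omega) (by omega) (by omega), hσ.size]
  · subst hτ
    refine ⟨?_, fun _ _ => rfl, ?_, ?_, ?_⟩
    · intro r hr0 hr1 hr7 hr12
      simp only [Prog.effect]
      rw [Function.update_of_ne hr7, Function.update_of_ne hr0]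
    · simp [Prog.effect, h0]
    · rw [edgesOf_below_one, route_empty]
      exact hD
    · rw [edgesOf_below_one]
      simpa [Prog.effect] using hlists.append_empty
  · have h1 : numVertices n * (8 + swapEdge.time) ≤ numVertices n * 200 :=
      Nat.mul_le_mul_left _ (by omega)
    have h2 : (Prog.set 0 (.add (.reg 0) (.lit 1))).time = 4 := rfl
    omega

/-- The values of the registers for the phase and the parity. -/
def HoldsPhase : AlgState n → Mem → Prop
  | .phase1 _, σ => σ.reg 3 = 1
  | .phase2 _, σ => σ.reg 3 = 2
  | .phase3 k _, σ => σ.reg 3 = 3 ∧ σ.reg 4 = k % 2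

/-- The memory represents the state `s` of the algorithm after the output `Ms`. -/
structure Represents (Ms : List (Set (Sym2 (StarVertex n)))) (s : AlgState n) (σ : Mem) : Prop where
  layout : Layout n σ
  config : HoldsConfig s.config σ
  length : σ.reg 0 = Ms.length
  lists : Lists Ms (σ.reg 1) (σ.arr 2) (σ.arr 3) (σ.arr 4)
  phase : HoldsPhase s σ

/-- All edges are selected before any swap, because the conditions refer to the old configuration.
-/
theorem runs_perform {D : StarVertex n → StarVertex n} {Ms : List (Set (Sym2 (StarVertex n)))}
    {S : Fin h → ℕ → Prop} {σ : Mem} (hσ : Layout n σ) (hD : HoldsConfig D σ)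
    (hS : SelectsMatching n S) (h0 : σ.reg 0 = Ms.length)
    (hlists : Lists Ms (σ.reg 1) (σ.arr 2) (σ.arr 3) (σ.arr 4))
    (hflag : ∀ b q, q < n b → ∀ τ : Mem, (∀ r, r ≠ 7 → τ.reg r = σ.reg r) → Layout n τ →
      HoldsConfig D τ → τ.reg 7 = code (vx b (q + 1) : StarVertex n) →
      ((byPhase sortE changeE oddEvenE).Holds τ ↔ S b q))
    {s : AlgState n} (hs : s.config = route (edgesOf S) D)
    (hphase : ∀ τ : Mem, τ.reg 3 = σ.reg 3 → τ.reg 4 = 1 - σ.reg 4 → HoldsPhase s τ) :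
    Runs (.seq selectEdges (.seq swapEdges (.set 4 (.sub (.lit 1) (.reg 4))))) σ
      (numVertices n * 600 + 50) (Represents (Ms ++ [edgesOf S]) s) := by
  refine Runs.mono (Runs.seq (runs_selectEdges hσ hD hflag) fun τ hτ =>
    Runs.seq (U := 4) (runs_swapEdges (D := D) (Ms := Ms) (S := S) ?_ ?_ hS ?_ ?_ ?_)
      fun ρ hρ => ?_)
    (by omega) fun _ h1 => h1
  · exact hσ.congr (hτ.reg 2 (by omega)) (hτ.arr 5 (by omega)) (hτ.arr 6 (by omega))
      (hτ.arr 7 (by omega))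
  · exact hD.congr (hτ.arr 1 (by omega))
  · rw [hτ.reg 0 (by omega), h0]
  · rw [hτ.reg 1 (by omega), hτ.arr 2 (by omega), hτ.arr 3 (by omega), hτ.arr 4 (by omega)]
    exact hlists
  · exact fun b p hp => hτ.flag b p hp (code_lt _)
  · have hreg : ∀ r, r ≠ 0 → r ≠ 1 → r ≠ 7 → r ≠ 12 → ρ.reg r = σ.reg r := fun r h1 h2 h3 h4 => by
      rw [hρ.reg r h1 h2 h3 h4, hτ.reg r h3]
    have harr : ∀ a, 4 < a → a ≠ 8 → ρ.arr a = σ.arr a := fun a h1 h2 => by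
      rw [hρ.arr a h1, hτ.arr a h2]
    have hcfg := hρ.config
    have hl := hρ.lists
    rw [edgesOf_below_last] at hcfg hl
    refine Runs.of_effect rfl ⟨?_, ?_, ?_, ?_, ?_⟩
    · refine hσ.congr ?_ (harr 5 (by omega) (by omega)) (harr 6 (by omega) (by omega))
        (harr 7 (by omega) (by omega))
      simp [Prog.effect, hreg 2]
    · rw [hs]
      exact hcfg
    · simp [Prog.effect, hρ.length]
    · simpa [Prog.effect] using hl
    · refine hphase _ ?_ ?_
      · simp [Prog.effect, hreg 3]
      · simp [Prog.effect, Expr.eval, hreg 4]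

theorem Represents.of_inspected {D : StarVertex n → StarVertex n} {σ τ : Mem}
    (hτ : Inspected D σ τ) {Ms : List (Set (Sym2 (StarVertex n)))} {s : AlgState n}
    (hσ : Represents Ms s σ) : Represents Ms s τ where
  layout := hσ.layout.congr (hτ.reg 2 (by omega)) (by rw [hτ.arr]) (by rw [hτ.arr]) (by rw [hτ.arr])
  config := hσ.config.congr (by rw [hτ.arr])
  length := by rw [hτ.reg 0 (by omega), hσ.length]
  lists := by
    rw [hτ.reg 1 (by omega), hτ.arr]
    exact hσ.lists
  phase := by
    have h1 := hσ.phase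
    cases s <;> simp only [HoldsPhase] at h1 ⊢
    · rw [hτ.reg 3 (by omega), h1]
    · rw [hτ.reg 3 (by omega), h1]
    · rw [hτ.reg 3 (by omega), hτ.reg 4 (by omega)]
      exact h1

/-- Passing to the next phase. -/
theorem runs_nextPhase {Ms : List (Set (Sym2 (StarVertex n)))} {s : AlgState n} {σ : Mem}
    (hσ : Represents Ms s σ) :
    Runs (.seq (.set 3 (.add (.reg 3) (.lit 1))) (.set 4 (.lit 1))) σ 10 fun τ =>
      τ.reg 3 = σ.reg 3 + 1 ∧ τ.reg 4 = 1 ∧ HoldsOutput Ms τ ∧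
        ∀ s' : AlgState n, s'.config = s.config → HoldsPhase s' τ → Represents Ms s' τ := by
  refine (Runs.of_effect rfl ?_).mono (by decide) fun _ h1 => h1
  have h0 : ((Prog.seq (.set 3 (.add (.reg 3) (.lit 1))) (.set 4 (.lit 1))).effect σ).reg 0 =
      Ms.length := by simp [Prog.effect, hσ.length]
  have hl : Lists Ms
      (((Prog.seq (.set 3 (.add (.reg 3) (.lit 1))) (.set 4 (.lit 1))).effect σ).reg 1) (σ.arr 2)
      (σ.arr 3) (σ.arr 4) := by simpa [Prog.effect] using hσ.lists
  refine ⟨by simp [Prog.effect, Expr.eval], by simp [Prog.effect, Expr.eval],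
    holdsOutput_of_lists h0 hl, fun s' h1 h2 => ⟨?_, ?_, h0, hl, h2⟩⟩
  · exact hσ.layout.congr (by simp [Prog.effect]) rfl rfl rfl
  · rw [h1]
    exact hσ.config

theorem innerSwaps_nonempty_iff (D : StarVertex n → StarVertex n) :
    (innerSwaps D).Nonempty ↔ ∃ b p, p < n b ∧ SortSel D b p := by
  rw [innerSwaps_eq]
  constructor
  · rintro ⟨-, b, p, h1, h2, -⟩
    exact ⟨b, p, h1, h2⟩
  · rintro ⟨b, p, h1, h2⟩
    exact ⟨_, b, p, h1, h2, rfl⟩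

/-- The invariant is needed only in the second phase, where it makes the selected edges disjoint.
The free choice there is resolved by the branch number stored in register `9`. -/
theorem runs_stepProg {L R : ℕ} {C : StarVertex n → StarVertex n} (hn : ∀ b, 0 < n b)
    {Ms : List (Set (Sym2 (StarVertex n)))} {s : AlgState n} {σ : Mem} (hσ : Represents Ms s σ)
    (hs : AlgInv L C R s) :
    Runs stepProg σ (numVertices n * 800 + 400) fun τ =>
      (∃ s' out, Step s out s' ∧ Represents (Ms ++ out) s' τ) ∨
        (Halted s ∧ τ.reg 3 = 4 ∧ HoldsOutput Ms τ) := by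
  have hcost : (byPhase (.reg 8) (.reg 9) (.reg 10)).cost ≤ 60 := by decide
  refine Runs.mono (Runs.seq (runs_inspect hσ.layout hσ.config hn) fun τ hτ =>
    Runs.ite (T := numVertices n * 600 + 50) ?_ ?_) (by omega) fun _ h1 => h1
  all_goals have hrep := hσ.of_inspected hτ
  · intro hgo
    change Holds _ _ at hgo
    cases s with
    | phase1 D =>
      have h3 : τ.reg 3 = 1 := hrep.phase
      rw [holds_byPhase_one h3, holds_reg] at hgo
      have hne := (innerSwaps_nonempty_iff D).2 (hτ.sort.1 hgo)
      refine (runs_perform (s := .phase1 (route (innerSwaps D) D)) hrep.layout hrep.config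
        (selectsMatching_sortSel D) hrep.length hrep.lists ?_ ?_ ?_).mono le_rfl
          fun ρ hρ => Or.inl ⟨_, _, Step.sortBranches D hne, ?_⟩
      · intro b q hq ρ hreg hlay hcfg hx
        rw [holds_byPhase_one ((hreg 3 (by omega)).trans h3), holds_sortE hlay hcfg hq hx]
        rfl
      · rw [innerSwaps_eq]
        rfl
      · intro ρ h4 _
        exact h4.trans h3
      · rw [innerSwaps_eq] at hρ ⊢
        exact hρ
    | phase2 D =>
      have h3 : τ.reg 3 = 2 := hrep.phase
      rw [holds_byPhase_two h3, holds_reg] at hgo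
      obtain ⟨b, h9, hb⟩ := hτ.front.resolve_left fun h4 => hgo h4.1
      have htarget : ∃ c : Fin h, Target D c ∧ τ.reg 11 = c.val + 1 := by
        rcases hτ.target with ⟨h4, h5⟩ | ⟨c, h4, h5⟩
        · exact ⟨b, Or.inl ⟨h4, hb⟩, h5.trans h9⟩
        · exact ⟨c, Or.inr h4, h5⟩
      obtain ⟨c, hT, h11⟩ := htarget
      refine (runs_perform (s := .phase2 (route (edgesOf (ChangeSel D c)) D)) hrep.layout
        hrep.config (hs.2.1.selectsMatching hT) hrep.length hrep.lists ?_ rfl ?_).mono le_rfl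
          fun ρ hρ => Or.inl ⟨_, _, Step.changeBranches D _ ⟨b, (unfinished_iff hn D b).2 hb⟩
            ((phase2Swaps_iff hn D _).2 ⟨c, hT, rfl⟩), hρ⟩
      · intro b' q hq ρ hreg hlay hcfg hx
        rw [holds_byPhase_two ((hreg 3 (by omega)).trans h3),
          holds_changeE hlay hcfg hq hx ((hreg 11 (by omega)).trans h11)]
        rfl
      · intro ρ h4 _
        exact h4.trans h3
    | phase3 k D =>
      obtain ⟨h3, h4⟩ : τ.reg 3 = 3 ∧ τ.reg 4 = k % 2 := hrep.phase
      rw [holds_byPhase_three h3, holds_reg] at hgo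
      have hne : D ≠ id := hτ.ne_id.1 hgo
      refine (runs_perform (s := .phase3 (k + 1) (route (oddEvenSwaps k D) D)) hrep.layout
        hrep.config (selectsMatching_oddEvenSel k D) hrep.length hrep.lists ?_ ?_ ?_).mono le_rfl
          fun ρ hρ => Or.inl ⟨_, _, Step.oddEven k D hne, ?_⟩
      · intro b q hq ρ hreg hlay hcfg hx
        rw [holds_byPhase_three ((hreg 3 (by omega)).trans h3),
          holds_oddEvenE hlay hcfg hq hx ((hreg 4 (by omega)).trans h4)]
        rfl
      · rw [oddEvenSwaps_eq]
        rfl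
      · intro ρ h5 h6
        exact ⟨h5.trans h3, by omega⟩
      · rw [oddEvenSwaps_eq] at hρ ⊢
        exact hρ
  · intro hgo
    have hgo : ¬ (byPhase (.reg 8) (.reg 9) (.reg 10)).Holds τ := not_not.2 hgo
    refine (runs_nextPhase hrep).mono (by omega) ?_
    rintro ρ ⟨h1, h2, h3, h4⟩
    cases s with
    | phase1 D =>
      have h5 : τ.reg 3 = 1 := hrep.phase
      rw [holds_byPhase_one h5, holds_reg] at hgo
      refine Or.inl ⟨_, _, Step.toPhase2 D ?_, ?_⟩
      · rw [innerSwaps_nonempty_iff]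
        exact fun h6 => hgo (hτ.sort.2 h6)
      · rw [List.append_nil]
        exact h4 _ rfl (by rw [HoldsPhase, h1, h5])
    | phase2 D =>
      have h5 : τ.reg 3 = 2 := hrep.phase
      rw [holds_byPhase_two h5, holds_reg] at hgo
      refine Or.inl ⟨_, _, Step.toPhase3 D ?_, ?_⟩
      · rintro ⟨b, hb⟩
        rw [unfinished_iff hn] at hb
        rcases hτ.front with ⟨-, h6⟩ | ⟨c, h6, -⟩
        · have : 0 < depth b (D (vx b 1)) := h6 b
          omega
        · omega
      · rw [List.append_nil]
        exact h4 _ rfl ⟨by rw [h1, h5], h2⟩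
    | phase3 k D =>
      obtain ⟨h5, -⟩ : τ.reg 3 = 3 ∧ τ.reg 4 = k % 2 := hrep.phase
      rw [holds_byPhase_three h5, holds_reg] at hgo
      refine Or.inr ⟨?_, by rw [h1, h5], h3⟩
      rintro out s' hstep
      cases hstep with
      | oddEven _ _ hD => exact hgo (hτ.ne_id.2 hD)

/-! ### Initialization -/

/-- The arrays are initialized for the vertices with numbers below `x`. -/
structure Initialized (n : Fin h → ℕ) (σ : Mem) (x : ℕ) (τ : Mem) : Prop where
  branches : τ.reg 0 = h
  next : τ.reg 7 = x
  sizes : τ.arr 0 = σ.arr 0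
  tokens : τ.arr 1 = σ.arr 1
  branch : ∀ v : StarVertex n, code v < x → τ.arr 5 (code v) = branchNo v
  inw : ∀ b p, p < n b → code (vx b (p + 1) : StarVertex n) < x →
    τ.arr 6 (code (vx b (p + 1) : StarVertex n)) = code (vx b p : StarVertex n)
  par : ∀ b p, p < n b → code (vx b (p + 1) : StarVertex n) < x →
    τ.arr 7 (code (vx b (p + 1) : StarVertex n)) = p % 2

theorem effect_initVertex (τ : Mem) :
    initVertex.effect τ =
      { reg := Function.update (Function.update τ.reg 7 (τ.reg 7 + 1)) 6 (τ.reg 6 + 1)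
        arr := Function.update (Function.update (Function.update τ.arr 5
          (Function.update (τ.arr 5) (τ.reg 7) (τ.reg 5 + 1))) 6
          (Function.update (τ.arr 6) (τ.reg 7) (if τ.reg 6 = 0 then 0 else τ.reg 7 - 1))) 7
          (Function.update (τ.arr 7) (τ.reg 7)
            (if τ.reg 6 = 0 then 0 else 1 - τ.arr 7 (τ.reg 7 - 1))) } := by
  by_cases h6 : τ.reg 6 = 0 <;> simp [initVertex, Prog.effect, Expr.eval, h6]

theorem Initialized.step {σ τ : Mem} {b : Fin h} {i : ℕ} (hi : i < n b)
    (hτ : Initialized n σ (1 + offset n b.val + i) τ) (h5 : τ.reg 5 = b.val) (h6 : τ.reg 6 = i) :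
    Initialized n σ (1 + offset n b.val + (i + 1)) (initVertex.effect τ) ∧
      (initVertex.effect τ).reg 5 = b.val ∧ (initVertex.effect τ).reg 6 = i + 1 := by
  have hx : code (vx b (i + 1) : StarVertex n) = 1 + offset n b.val + i := code_vx_succ hi
  have hlt : ∀ c p, p < n c → code (vx c (p + 1) : StarVertex n) < 1 + offset n b.val + (i + 1) →
      code (vx c (p + 1) : StarVertex n) < 1 + offset n b.val + i ∨ (c = b ∧ p = i) := by
    intro c p hp h1
    rw [← hx]
    exact (code_vx_lt_succ_iff hp hi).1 (by omega)
  rw [effect_initVertex, hτ.next, h5, h6]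
  refine ⟨⟨?_, ?_, ?_, ?_, ?_, ?_, ?_⟩, ?_, ?_⟩
  · simp [hτ.branches]
  · simp [add_assoc]
  · simp [hτ.sizes]
  · simp [hτ.tokens]
  · intro v hv
    by_cases h1 : code v = 1 + offset n b.val + i
    · have h2 : v = vx b (i + 1) := code_injective (h1.trans hx.symm)
      subst h2
      rw [branchNo_vx_succ hi, h1]
      simp
    · rw [← hτ.branch v (by omega)]
      simp [h1]
  · intro c p hp hc
    rcases hlt c p hp hc with h1 | ⟨rfl, rfl⟩
    · rw [← hτ.inw c p hp h1]
      simp [h1.ne]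
    · rcases Nat.eq_zero_or_pos p with rfl | hp0
      · simp [hx, code_center]
      · rw [hx, code_vx hp0 hp.le]
        simp only [ne_eq, Nat.reduceEqDiff, not_false_eq_true, Function.update_of_ne,
          Function.update_self]
        rw [if_neg (by omega)]
        omega
  · intro c p hp hc
    rcases hlt c p hp hc with h1 | ⟨rfl, rfl⟩
    · rw [← hτ.par c p hp h1]
      simp [h1.ne]
    · rcases Nat.eq_zero_or_pos p with rfl | hp0
      · simp [hx]
      · obtain ⟨q, rfl⟩ : ∃ q, p = q + 1 := ⟨p - 1, by omega⟩
        have h2 : code (vx c (q + 1) : StarVertex n) = 1 + offset n c.val + q :=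
          code_vx_succ (by omega)
        have h1 := hτ.par c q (by omega) (by omega)
        rw [h2] at h1
        rw [hx]
        simp only [Function.update_self]
        rw [if_neg (by omega),
          show 1 + offset n c.val + (q + 1) - 1 = 1 + offset n c.val + q by omega, h1]
        omega
  · simp [h5]
  · simp

theorem runs_initBranch {C : StarVertex n → StarVertex n} {σ τ : Mem} (hσ : HoldsInput C σ)
    {b : ℕ} (hb : b < h) (hτ : Initialized n σ (1 + offset n b) τ ∧ τ.reg 5 = b) :
    Runs initBranch τ (numVertices n * 100 + 20) fun ρ =>
      Initialized n σ (1 + offset n (b + 1)) ρ ∧ ρ.reg 5 = b + 1 := by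
  have htime : initVertex.time ≤ 80 := by decide
  obtain ⟨hτ, h5⟩ := hτ
  refine Runs.mono (Runs.seq (T := 2) (Q := fun ρ => Initialized n σ (1 + offset n b + 0) ρ ∧
    ρ.reg 5 = b ∧ ρ.reg 6 = 0) (Runs.of_effect rfl ?_) fun ρ hρ =>
      Runs.seq (U := 4) (Runs.loop_count (T := initVertex.time) (k := n ⟨b, hb⟩)
        (I := fun i ρ => Initialized n σ (1 + offset n b + i) ρ ∧ ρ.reg 5 = b ∧ ρ.reg 6 = i)
          ?_ ?_ hρ) fun ρ hρ => Runs.of_effect rfl ?_) ?_ fun _ h1 => h1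
  · refine ⟨⟨?_, ?_, hτ.sizes, hτ.tokens, hτ.branch, hτ.inw, hτ.par⟩, ?_, rfl⟩
    · simp [Prog.effect, hτ.branches]
    · simp [Prog.effect, hτ.next]
    · simp [Prog.effect, h5]
  · rintro i hi ρ ⟨h1, h2, h3⟩
    refine ⟨?_, Runs.of_effect rfl (h1.step (b := ⟨b, hb⟩) hi h2 h3)⟩
    simp only [Expr.eval, h2, h3, h1.sizes, hσ.2.1 ⟨b, hb⟩]
    rw [if_pos hi]
    exact one_ne_zero
  · rintro ρ ⟨h1, h2, h3⟩
    simp only [Expr.eval, h2, h3, h1.sizes, hσ.2.1 ⟨b, hb⟩]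
    rw [if_neg (lt_irrefl _)]
  · obtain ⟨h1, h2, h3⟩ := hρ
    have h4 := offset_succ (n := n) ⟨b, hb⟩
    rw [add_assoc, ← h4] at h1
    refine ⟨⟨?_, ?_, h1.sizes, h1.tokens, h1.branch, h1.inw, h1.par⟩, ?_⟩
    · simp [Prog.effect, h1.branches]
    · simp [Prog.effect, h1.next]
    · simp [Prog.effect, Expr.eval, h2]
  · have h1 := le_numVertices (n := n) ⟨b, hb⟩
    have h2 : (Expr.lt (.reg 6) (.cell 0 (.reg 5))).cost = 4 := rfl
    rw [h2]
    have : n ⟨b, hb⟩ * (1 + 4 + initVertex.time) ≤ numVertices n * 100 :=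
      Nat.mul_le_mul h1 (by omega)
    omega

theorem card_le_numVertices (hn : ∀ b, 0 < n b) : h ≤ numVertices n := by
  have : ∑ b : Fin h, 1 ≤ ∑ b, n b := Finset.sum_le_sum fun b _ => hn b
  simp only [Finset.sum_const, Finset.card_univ, Fintype.card_fin, smul_eq_mul, mul_one] at this
  unfold numVertices
  omega

theorem runs_initProg {C : StarVertex n → StarVertex n} {σ : Mem} (hσ : HoldsInput C σ)
    (hn : ∀ b, 0 < n b) :
    Runs initProg σ (numVertices n * (numVertices n * 100 + 30) + 50)
      (Represents [] (.phase1 C)) := by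
  refine Runs.mono (Runs.seq (T := 20) (Q := fun ρ => Initialized n σ (1 + offset n 0) ρ ∧
    ρ.reg 5 = 0) ((Runs.of_effect rfl ?_).mono (by decide) fun _ h1 => h1) fun ρ hρ =>
      Runs.seq (U := 20) (Runs.loop_count (T := numVertices n * 100 + 20) (k := h)
        (I := fun b ρ => Initialized n σ (1 + offset n b) ρ ∧ ρ.reg 5 = b) ?_ ?_ hρ)
          fun ρ hρ => (Runs.of_effect rfl ?_).mono (by decide) fun _ h1 => h1) ?_ fun _ h1 => h1
  · rw [offset_zero]
    have h1 : ∀ b p, p < n b → ¬ code (vx b (p + 1) : StarVertex n) < 1 := fun b p hp h1 => by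
      rw [code_vx_succ hp] at h1
      omega
    refine ⟨⟨?_, ?_, ?_, ?_, ?_, fun b p hp h2 => absurd h2 (h1 b p hp),
      fun b p hp h2 => absurd h2 (h1 b p hp)⟩, ?_⟩
    · simp [Prog.effect, hσ.1]
    · simp [Prog.effect, Expr.eval]
    · simp [Prog.effect]
    · simp [Prog.effect]
    · intro v hv
      have hv : v = center := code_eq_zero.1 (by omega)
      subst hv
      rw [code_center]
      simp [Prog.effect, Expr.eval, branchNo, center]
    · simp [Prog.effect, Expr.eval]
  · rintro b hb ρ hρ
    refine ⟨?_, runs_initBranch hσ hb hρ⟩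
    simp only [Expr.eval, hρ.2, hρ.1.branches]
    rw [if_pos hb]
    exact one_ne_zero
  · rintro ρ hρ
    simp only [Expr.eval, hρ.2, hρ.1.branches]
    rw [if_neg (lt_irrefl _)]
  · obtain ⟨h1, h2⟩ := hρ
    rw [offset_last] at h1
    refine ⟨⟨?_, fun v => h1.branch v (code_lt v), fun b p hp => h1.inw b p hp (code_lt _),
      fun b p hp => h1.par b p hp (code_lt _)⟩, ?_, ?_, ?_, ?_⟩
    · simp [Prog.effect, Expr.eval, h1.next]
    · intro v
      have : ρ.arr 1 (code v) = code (C v) := by rw [h1.tokens, hσ.2.2]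
      exact this
    · simp [Prog.effect, Expr.eval]
    · have := lists_nil (n := n) (ρ.arr 2) (ρ.arr 3) (ρ.arr 4)
      simpa [Prog.effect, Expr.eval] using this
    · simp [HoldsPhase, Prog.effect, Expr.eval]
  · have h1 := card_le_numVertices hn
    have h2 : (Expr.lt (.reg 5) (.reg 0)).cost = 3 := rfl
    rw [h2]
    have : h * (1 + 3 + (numVertices n * 100 + 20)) ≤
        numVertices n * (numVertices n * 100 + 30) := Nat.mul_le_mul h1 (by omega)
    omega

/-! ### The whole program -/

theorem Run.append {s s' s'' : AlgState n} {Ms out : List (Set (Sym2 (StarVertex n)))}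
    (hrun : Run s Ms s') (hstep : Step s' out s'') : Run s (Ms ++ out) s'' := by
  induction hrun with
  | nil s =>
    have := Run.cons hstep (Run.nil s'')
    rwa [List.append_nil] at this
  | cons h1 _ ih =>
    rw [List.append_assoc]
    exact Run.cons h1 (ih hstep)

/-- The number of phases that are not over. -/
def AlgState.remaining : AlgState n → ℕ
  | .phase1 _ => 3
  | .phase2 _ => 2
  | .phase3 _ _ => 1

theorem Step.remaining {s s' : AlgState n} {out : List (Set (Sym2 (StarVertex n)))}
    (hstep : Step s out s') : s'.remaining + 1 ≤ s.remaining + out.length := by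
  cases hstep <;> simp [AlgState.remaining]

theorem HoldsPhase.lt_four {s : AlgState n} {σ : Mem} (hs : HoldsPhase s σ) : σ.reg 3 < 4 := by
  cases s with
  | phase1 D => exact lt_of_eq_of_lt hs (by omega)
  | phase2 D => exact lt_of_eq_of_lt hs (by omega)
  | phase3 k D => exact lt_of_eq_of_lt hs.1 (by omega)

theorem runs_algProg (hn : ∀ b, 0 < n b) {C : StarVertex n → StarVertex n}
    (hC : Function.Bijective C) {σ : Mem} (hσ : HoldsInput C σ) :
    Runs algProg σ (10000 * (numVertices n + 1) ^ 2) fun τ =>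
      ∃ Ms, IsOutput C Ms ∧ HoldsOutput Ms τ := by
  have hL := lowerBound_numVertices C
  set N := numVertices n with hN
  have hinit := runs_initProg hσ hn
  rw [← hN] at hinit
  have hcost : (Expr.lt (.reg 3) (.lit 4)).cost = 3 := rfl
  -- The fuel is the budget of matchings plus the number of phases left, as each step uses up one or
  -- the other. Initially it is at most `(4N + min N h + 1) + 3 ≤ 5N + 4`.
  refine Runs.mono (Runs.seq hinit fun τ hτ => Runs.loop_of_fuel
    (e := .lt (.reg 3) (.lit 4)) (T := N * 800 + 400)
    (I := fun i τ => (∃ s Ms R, Run (.phase1 C) Ms s ∧ AlgInv N C R s ∧ Represents Ms s τ ∧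
      R + s.remaining ≤ i) ∨ (τ.reg 3 = 4 ∧ ∃ Ms, IsOutput C Ms ∧ HoldsOutput Ms τ))
    ?_ (5 * N + 4) τ (Or.inl ⟨_, [], _, Run.nil _, AlgInv.initial hC hL, hτ, ?_⟩)) ?_ fun _ h1 => h1
  · rintro i ρ (⟨s, Ms, R, h1, h2, h3, h4⟩ | ⟨h1, h2⟩)
    · have h5 : 0 < s.remaining := by cases s <;> simp [AlgState.remaining]
      refine Or.inr ⟨?_, by omega, (runs_stepProg hn h3 h2).mono le_rfl ?_⟩
      · simp [Expr.eval, h3.phase.lt_four]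
      · rintro ρ' (⟨s', out, h6, h7⟩ | ⟨h6, h7, h8⟩)
        · obtain ⟨-, -, R', h8, h9⟩ := h2.step hn hC hL h6
          have h10 := h6.remaining
          exact ⟨R' + s'.remaining, by omega,
            Or.inl ⟨s', Ms ++ out, R', h1.append h6, h8, h7, le_rfl⟩⟩
        · exact ⟨0, by omega, Or.inr ⟨h7, Ms, ⟨s, h1, h6⟩, h8⟩⟩
    · refine Or.inl ⟨?_, h2⟩
      simp [Expr.eval, h1]
  · simp only [AlgState.remaining]
    omega
  · rw [hcost]
    nlinarith [sq_nonneg N]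

theorem exists_holdsInput (C : StarVertex n → StarVertex n) : ∃ σ : Mem, HoldsInput C σ := by
  classical
  refine ⟨⟨fun _ => h, fun a x => if a = 0 then (if hx : x < h then n ⟨x, hx⟩ else 0) else
    if hv : ∃ v : StarVertex n, code v = x then code (C hv.choose) else 0⟩, rfl, ?_, ?_⟩
  · intro b
    simp
  · intro v
    have hv : ∃ w : StarVertex n, code w = code v := ⟨v, rfl⟩
    simp only [one_ne_zero, if_false]
    rw [dif_pos hv, code_injective hv.choose_spec]

/-- Read off from the halting run of the program, which simulates one execution to its end. -/
theorem exists_isOutput (hn : ∀ b, 0 < n b) {C : StarVertex n → StarVertex n}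
    (hC : Function.Bijective C) : ∃ Ms, IsOutput C Ms := by
  obtain ⟨σ, hσ⟩ := exists_holdsInput C
  obtain ⟨-, -, -, -, Ms, hMs, -⟩ := runs_algProg hn hC hσ
  exact ⟨Ms, hMs⟩

end Star

end TokenSwapping

theorem theorem3 :
    -- every execution of the algorithm stays within the bound, and ends only with a solution
    (∀ (h : ℕ) (n : Fin h → ℕ), (∀ b, 0 < n b) →
      ∀ C : StarVertex n → StarVertex n, Function.Bijective C →
        (∀ Ms s, Run (AlgState.phase1 C) Ms s →
          Ms.length ≤ 4 * OPT (starGraph n) C + min (OPT (starGraph n) C) h + 1) ∧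
        (∀ Ms, IsOutput C Ms → IsSolution (starGraph n) C Ms)) ∧
    -- one program carries the algorithm out in polynomial time on all subdivided stars
    (∃ (p : Prog) (P : Polynomial ℕ),
      ∀ (h : ℕ) (n : Fin h → ℕ), (∀ b, 0 < n b) →
        ∀ C : StarVertex n → StarVertex n, Function.Bijective C →
          ∀ σ : Mem, HoldsInput C σ →
            ∃ (t : ℕ) (σ' : Mem) (Ms : List (Set (Sym2 (StarVertex n)))),
              Exec p σ t σ' ∧ t ≤ P.eval (numVertices n) ∧ IsOutput C Ms ∧
              HoldsOutput Ms σ') := by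
  refine ⟨fun h n hn C hC => ⟨fun Ms s hrun => length_le_of_run hn hC (exists_isOutput hn hC) hrun,
    fun Ms hMs => isSolution_of_isOutput hn hC hMs⟩, algProg,
    Polynomial.C 10000 * (Polynomial.X + 1) ^ 2, fun h n hn C hC σ hσ => ?_⟩
  obtain ⟨t, σ', h1, h2, Ms, h3, h4⟩ := runs_algProg hn hC hσ
  refine ⟨t, σ', Ms, h1, ?_, h3, h4⟩
  simpa using h2
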